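/- Let $T>0$, $d\in\mathbb N$, $H_1,\dots,H_d\in[0,1]$, $K_1,\dots,K_d\in(0,1]$ with $2H_iK_i>1$ for every $i=1,\dots,d$. Let $B=(B^1,\dots,B^d)$, $B^i=B^{H_i,K_i}$, be a $d$-dimensional bifractional Brownian motion on $[0,T]$: the components are independent, and each $B^{i}$ is a centered continuous Gaussian process, starting from zero, with covariance $$R_i(t,s)=\frac1{2^{K_i}}\Big(\big(t^{2H_i}+s^{2H_i}\big)^{K_i}-|t-s|^{2H_iK_i}\Big).$$ Let $f\in C^{1,2}([0,T]\times\mathbb R^d,\mathbb R)$, that is, $f$, $\partial_tf$, $\partial_{x_i}f$ and $\partial^2_{x_ix_j}f$ exist and are continuous on $[0,T]\times\mathbb R^d$. Then for every $t\in[0,T]$, almost surely, $$f(t,B_t)=f(0,0)+\int_0^t\frac{\partial f}{\partial s}(s,B_s)\,ds+\sum_{i=1}^d\int_0^t\frac{\partial f}{\partial x_i}(s,B_s)\,\delta B^{i}_s+\sum_{i=1}^dH_iK_i\int_0^t\frac{\partial^2f}{\partial x_i^2}(s,B_s)\,s^{2H_iK_i-1}\,ds .$$ Here $\int_0^t u_s\,\delta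 B^i_s$ is the divergence (Skorohod) integral $\delta^i(u\mathbf 1_{[0,t]})$ with respect to $B^i$. Let $\mathcal H_i$ be the completion of the step functions on $[0,T]$ for $\langle \mathbf 1_{[0,t]},\mathbf 1_{[0,s]}\rangle_{\mathcal H_i}=R_i(t,s)$. A function $\varphi$ on $[0,T]$ is an element of $\mathcal H_i$ through $\langle\varphi,\mathbf 1_{[0,t]}\rangle_{\mathcal H_i}=\int_0^T\varphi(v)\,\partial_vR_i(t,v)\,dv$, $t\in[0,T]$. A variable $U\in L^2(\Omega;\mathcal H_i)$ lies in $\mathrm{Dom}(\delta^i)$ with $\delta^i(U)=G$ if $G\in L^2(\Omega,\sigma(B),P)$ and $E(FG)=E\langle D^iF,U\rangle_{\mathcal H_i}$ for all smooth functionals $F=g(B(\varphi_1),\dots,B(\varphi_n))$ of $B$ ($g\in C_b^\infty(\mathbb R^n)$), where $D^i$ is the Malliavin derivative with respect to $B^i$. For general $f$ the integral is understood in the localized sense: there are events $A_n$ increasing to an event of probability one and $U_n\in\mathbb D^{1,2}(\mathcal H)\cap\mathrm{Dom}(\delta^i)$, $\mathcal H=\bigoplus_j\mathcal H_j$, such that,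 almost surely on $A_n$, the integrand equals $U_n$ and the integral equals $\delta^i(U_n)$. Here $\mathbb D^{1,2}(\mathcal H)$ is the closure of the finite sums $\sum_kF_kh_k$ ($F_k$ smooth functionals of $B$, $h_k\in\mathcal H$) for the norm $(E\|U\|_{\mathcal H}^2+E\|DU\|_{\mathcal H\otimes\mathcal H}^2)^{1/2}$. If $f,\partial_tf,\partial_{x_i}f,\partial^2_{x_ix_j}f$ have at most polynomial growth in $x$, uniformly in $t\in[0,T]$, then moreover $\frac{\partial f}{\partial x_i}(\cdot,B_\cdot)\mathbf 1_{[0,t]}\in\mathrm{Dom}(\delta^i)$ for every $i$ and the integrals in the formula are the divergences themselves, without localization. -/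

import Mathlib

open MeasureTheory ProbabilityTheory Filter Topology Set
open scoped ENNReal TensorProduct

noncomputable section

/-! ### Bifractional Brownian motion -/

/-- The covariance function `R^{H,K}(t, s)` of bifractional Brownian motion. -/
def bifCov (H K t s : ℝ) : ℝ :=
  1 / 2 ^ K * ((t ^ (2 * H) + s ^ (2 * H)) ^ K - |t - s| ^ (2 * H * K))

variable {Ω : Type*} [MeasurableSpace Ω]

/-- `X` restricted to the time interval `[0, T]` is a bifractional Brownian motion with
parameters `H, K`: a centered Gaussian process with (almost surely) continuous paths, starting
from zero, with covariance `R^{H,K}`. The values of `X` at times outside `[0, T]` are irrelevant. -/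
structure IsBifBm (T H K : ℝ) (X : ℝ → Ω → ℝ) (P : Measure Ω) : Prop where
  measurable : ∀ t ∈ Icc 0 T, Measurable (X t)
  gaussian : IsGaussianProcess (fun t : Icc (0 : ℝ) T => X t) P
  centered : ∀ t ∈ Icc 0 T, ∫ ω, X t ω ∂P = 0
  start : ∀ᵐ ω ∂P, X 0 ω = 0
  covariance : ∀ t ∈ Icc 0 T, ∀ s ∈ Icc 0 T, cov[X t, X s; P] = bifCov H K t s
  continuous : ∀ᵐ ω ∂P, ContinuousOn (fun t => X t ω) (Icc 0 T)

/-- A `d`-dimensional bifractional Brownian motion on `[0, T]`: its components are independent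
(as processes) one-dimensional bifractional Brownian motions. -/
structure IsMultiBifBm {d : ℕ} (T : ℝ) (H K : Fin d → ℝ) (B : Fin d → ℝ → Ω → ℝ)
    (P : Measure Ω) : Prop where
  component : ∀ i, IsBifBm T (H i) (K i) (B i) P
  indep : iIndepFun (fun (i : Fin d) (ω : Ω) (t : Icc (0 : ℝ) T) => B i t ω) P

/-! ### The canonical Hilbert space

The canonical Hilbert space is the completion of the step functions for the inner product
`⟨1_[0,t], 1_[0,s]⟩ = R(t, s)`. It is realised as the Gaussian space, that is, the closed linear
span of the process in `L²(P)`, with `B_t` in the role of `1_[0,t]`; the isometry `φ ↦ B(φ)` is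
then the inclusion in `L²(P)`. For a family of independent processes the spaces of the members are
orthogonal, and the space of the family is their orthogonal direct sum. -/

/-- The closed linear span in `L²(P)` of the random variables `X i t`, `t ∈ [0, T]`. -/
def gaussianSpace {ι : Type*} (T : ℝ) (X : ι → ℝ → Ω → ℝ) (P : Measure Ω) :
    Submodule ℝ (Lp ℝ 2 P) :=
  (Submodule.span ℝ
    {Y : Lp ℝ 2 P | ∃ i, ∃ t ∈ Icc 0 T, (Y : Ω → ℝ) =ᵐ[P] X i t}).topologicalClosure

/-- The canonical Hilbert space of a single process. -/
abbrev componentSpace (T : ℝ) (X : ℝ → Ω → ℝ) (P : Measure Ω) : Submodule ℝ (Lp ℝ 2 P) :=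
  gaussianSpace T (fun _ : Unit => X) P

/-- The σ-algebra generated by all components on `[0, T]`. -/
@[reducible] def processSigma {ι : Type*} (T : ℝ) (X : ι → ℝ → Ω → ℝ) : MeasurableSpace Ω :=
  ⨆ (i : ι) (t : Icc (0 : ℝ) T), MeasurableSpace.comap (X i t) inferInstance

/-- The function `φ` on `[0, T]`, as an element of the canonical Hilbert space of the `i`-th
component, is `h`. The inner product of functions being
`∫∫ φ(u) ψ(v) ∂²R/∂u∂v (u, v) du dv`, one has `⟨φ, 1_[0,t]⟩ = ∫₀ᵀ φ(v) ∂R/∂v (t, v) dv`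
(as `R(0, v) = 0`), and since the `1_[0,t]` are total these numbers determine `h`.
On the left, `E[h Bᵢ(t)]` is the inner product of `h` and `1_[0,t]`. -/
def Represents {d : ℕ} (T : ℝ) (H K : Fin d → ℝ) (B : Fin d → ℝ → Ω → ℝ) (P : Measure Ω)
    (i : Fin d) (φ : ℝ → ℝ) (h : gaussianSpace T B P) : Prop :=
  (h : Lp ℝ 2 P) ∈ componentSpace T (B i) P ∧
  ∀ t ∈ Icc 0 T,
    IntervalIntegrable (fun v => φ v * deriv (fun w => bifCov (H i) (K i) t w) v) volume 0 T ∧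
    ∫ ω, (h : Lp ℝ 2 P) ω * B i t ω ∂P =
      ∫ v in (0 : ℝ)..T, φ v * deriv (fun w => bifCov (H i) (K i) t w) v

/-! ### Malliavin calculus -/

/-- A smooth functional `F = g(B(φ₁), …, B(φₙ))` with `g ∈ C_b^∞(ℝⁿ)` and `φⱼ` in the Gaussian
Hilbert space `𝓗`. -/
structure SmoothFunctional {P : Measure Ω} (𝓗 : Submodule ℝ (Lp ℝ 2 P)) where
  n : ℕ
  g : (Fin n → ℝ) → ℝ
  smooth : ContDiff ℝ (⊤ : ℕ∞) g
  bounded : ∀ k : ℕ, ∃ C : ℝ, ∀ x, ‖iteratedFDeriv ℝ k g x‖ ≤ C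
  φ : Fin n → 𝓗

namespace SmoothFunctional

variable {P : Measure Ω} {𝓗 : Submodule ℝ (Lp ℝ 2 P)}

/-- The value `F(ω)`. -/
def val (F : SmoothFunctional 𝓗) (ω : Ω) : ℝ :=
  F.g (fun j => (F.φ j : Lp ℝ 2 P) ω)

/-- The Malliavin derivative `DF(ω) = ∑ⱼ ∂ⱼg(B(φ₁), …, B(φₙ)) φⱼ`. -/
def D (F : SmoothFunctional 𝓗) (ω : Ω) : 𝓗 :=
  ∑ j, fderiv ℝ F.g (fun j => (F.φ j : Lp ℝ 2 P) ω) (Pi.single j 1) • F.φ j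

end SmoothFunctional

/-- A smooth elementary `𝓗`-valued random variable `∑ₖ Fₖ hₖ`, with `Fₖ` smooth functionals and
`hₖ ∈ 𝓗`. -/
structure ElementaryProcess {P : Measure Ω} (𝓗 : Submodule ℝ (Lp ℝ 2 P)) where
  m : ℕ
  F : Fin m → SmoothFunctional 𝓗
  h : Fin m → 𝓗

namespace ElementaryProcess

variable {P : Measure Ω} {𝓗 : Submodule ℝ (Lp ℝ 2 P)}

/-- The value `∑ₖ Fₖ(ω) hₖ`. -/
def val (V : ElementaryProcess 𝓗) (ω : Ω) : 𝓗 := ∑ k, (V.F k).val ω • V.h k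

/-- The Malliavin derivative `∑ₖ DFₖ(ω) ⊗ hₖ`. -/
def D (V : ElementaryProcess 𝓗) (ω : Ω) : 𝓗 ⊗[ℝ] 𝓗 := ∑ k, (V.F k).D ω ⊗ₜ[ℝ] V.h k

end ElementaryProcess

/-- `U ∈ 𝔻^{1,2}(𝓗)`: the closure of the smooth elementary `𝓗`-valued random variables for the
norm `E‖U‖² + E‖DU‖²`. The derivatives are only required to form a Cauchy sequence, since their
limit lies in the completion of `𝓗 ⊗ 𝓗`. -/
def MemD12 {P : Measure Ω} {𝓗 : Submodule ℝ (Lp ℝ 2 P)} (U : Ω → 𝓗) : Prop :=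
  MemLp U 2 P ∧ ∃ V : ℕ → ElementaryProcess 𝓗,
    Tendsto (fun n => eLpNorm (fun ω => (V n).val ω - U ω) 2 P) atTop (𝓝 0) ∧
    Tendsto (fun p : ℕ × ℕ => eLpNorm (fun ω => (V p.1).D ω - (V p.2).D ω) 2 P)
      (atTop ×ˢ atTop) (𝓝 0)

/-- `U ∈ Dom δⁱ` and `δⁱ(U) = G`, where `δⁱ` is the divergence with respect to the `i`-th component
of `B`: `U ∈ L²(Ω; 𝓗ᵢ)` and `G` is the square integrable functional of `B` with
`E(F G) = E⟨DF, U⟩` for all smooth functionals `F` of `B`. As `U` takes values in `𝓗ᵢ`, the inner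
product only sees the part of `DF` in `𝓗ᵢ`, the derivative with respect to the `i`-th component. -/
def IsDivergence {d : ℕ} (T : ℝ) (B : Fin d → ℝ → Ω → ℝ) (P : Measure Ω) (i : Fin d)
    (U : Ω → gaussianSpace T B P) (G : Ω → ℝ) : Prop :=
  MemLp U 2 P ∧ (∀ᵐ ω ∂P, (U ω : Lp ℝ 2 P) ∈ componentSpace T (B i) P) ∧
  MemLp G 2 P ∧ AEStronglyMeasurable[processSigma T B] G P ∧
  ∀ F : SmoothFunctional (gaussianSpace T B P),
    ∫ ω, F.val ω * G ω ∂P = ∫ ω, inner ℝ (F.D ω) (U ω) ∂P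

/-- `∫₀ᵀ u_s δBⁱ_s = G`, with `u` (real-valued, on `[0, T]`) in `Dom δⁱ`. -/
def IsDivergenceIntegral {d : ℕ} (T : ℝ) (H K : Fin d → ℝ) (B : Fin d → ℝ → Ω → ℝ)
    (P : Measure Ω) (i : Fin d) (u : ℝ → Ω → ℝ) (G : Ω → ℝ) : Prop :=
  ∃ U : Ω → gaussianSpace T B P,
    (∀ᵐ ω ∂P, Represents T H K B P i (fun s => u s ω) (U ω)) ∧ IsDivergence T B P i U G

/-- `∫₀ᵀ u_s δBⁱ_s = G` in the localized sense: there are events `Aₙ` increasing to an almost sure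
event and `Uₙ ∈ 𝔻^{1,2}(𝓗) ∩ Dom δⁱ` such that almost surely on `Aₙ` one has `u = Uₙ` and
`G = δⁱ(Uₙ)`. -/
def IsLocalDivergenceIntegral {d : ℕ} (T : ℝ) (H K : Fin d → ℝ) (B : Fin d → ℝ → Ω → ℝ)
    (P : Measure Ω) (i : Fin d) (u : ℝ → Ω → ℝ) (G : Ω → ℝ) : Prop :=
  ∃ (A : ℕ → Set Ω) (U : ℕ → Ω → gaussianSpace T B P) (g : ℕ → Ω → ℝ),
    Monotone A ∧ (∀ n, MeasurableSet (A n)) ∧ (∀ᵐ ω ∂P, ∃ n, ω ∈ A n) ∧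
    ∀ n, MemD12 (U n) ∧ IsDivergence T B P i (U n) (g n) ∧
      ∀ᵐ ω ∂P, ω ∈ A n → Represents T H K B P i (fun s => u s ω) (U n ω) ∧ G ω = g n ω

/-! ### Functions of class `C^{1,2}` -/

/-- The partial derivative `∂ᵢg`. -/
def pderiv {d : ℕ} (i : Fin d) (g : (Fin d → ℝ) → ℝ) (x : Fin d → ℝ) : ℝ :=
  fderiv ℝ g x (Pi.single i 1)

/-- The time derivative of `f` on `[0, T]` (one-sided at the end points). -/
def timeDeriv {d : ℕ} (T : ℝ) (f : ℝ → (Fin d → ℝ) → ℝ) (t : ℝ) (x : Fin d → ℝ) : ℝ :=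
  derivWithin (fun r => f r x) (Icc 0 T) t

/-- `f ∈ C^{1,2}([0, T] × ℝᵈ, ℝ)`: one time derivative and two space derivatives, all jointly
continuous on `[0, T] × ℝᵈ`. -/
structure IsC12 {d : ℕ} (T : ℝ) (f : ℝ → (Fin d → ℝ) → ℝ) : Prop where
  cont : ContinuousOn (fun p : ℝ × (Fin d → ℝ) => f p.1 p.2) (Icc 0 T ×ˢ univ)
  diff_time : ∀ x, DifferentiableOn ℝ (fun t => f t x) (Icc 0 T)
  diff_space : ∀ t ∈ Icc 0 T, ContDiff ℝ 2 (f t)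
  cont_time : ContinuousOn (fun p : ℝ × (Fin d → ℝ) => timeDeriv T f p.1 p.2) (Icc 0 T ×ˢ univ)
  cont_fst : ∀ i,
    ContinuousOn (fun p : ℝ × (Fin d → ℝ) => pderiv i (f p.1) p.2) (Icc 0 T ×ˢ univ)
  cont_snd : ∀ i j,
    ContinuousOn (fun p : ℝ × (Fin d → ℝ) => pderiv i (pderiv j (f p.1)) p.2) (Icc 0 T ×ˢ univ)

/-- `f` and its derivatives `∂ₜf`, `∂ᵢf`, `∂ᵢ∂ⱼf` have at most polynomial growth in `x`, uniformly
in `t ∈ [0, T]`. -/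
def HasPolyGrowth {d : ℕ} (T : ℝ) (f : ℝ → (Fin d → ℝ) → ℝ) : Prop :=
  ∃ (C : ℝ) (N : ℕ), ∀ t ∈ Icc 0 T, ∀ x : Fin d → ℝ,
    |f t x| ≤ C * (1 + ‖x‖) ^ N ∧ |timeDeriv T f t x| ≤ C * (1 + ‖x‖) ^ N ∧
    (∀ i, |pderiv i (f t) x| ≤ C * (1 + ‖x‖) ^ N) ∧
    ∀ i j, |pderiv i (pderiv j (f t)) x| ≤ C * (1 + ‖x‖) ^ N

end

/-! Since `2 H K > 1`, the process has zero quadratic variation: an increment over a step `δ` has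
variance at most `2 δ^(2HK)`, so the squared increments over the `2^n` dyadic steps sum to order
`2^(-n(2HK-1))`. A Taylor expansion along dyadic partitions therefore has a vanishing second order
remainder. What remains is the time integral and the forward Riemann sums of `∂ᵢf(s, B_s)` against
the increments of `Bⁱ`.

The second derivative enters the formula because these Riemann sums are not divergences. The
divergence of `F h` is `F B(h) - ⟨DF, h⟩`, so passing to divergences costs `∂ᵢ²f` times `R(s_k,
s_{k+1}) - R(s_k, s_k)`. By polarization this equals half the increment of the variance `s^(2HK)`
minus half the squared norm of the increment. The second part vanishes in the limit, and the first
gives the density `HK s^(2HK-1)`. This is `IsMultiBifBm.tendsto_sum_trace`, combined with the Taylor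
expansion in `IsMultiBifBm.tendsto_sub_sum_divergenceSum`.

It must also be shown that the divergence sums converge to the divergence of the integrand
(`IsMultiBifBm.exists_divergence`). Gaussian integration by parts gives, for elementary processes,
the duality with the derivative and the bound `‖δV‖ ≤ ‖V‖ + ‖DV‖` in `L²`. Hence the divergence
passes to limits in `𝔻^{1,2}` (`exists_tendsto_div`). The Riemann sums of the integrand and of its
derivative are Cauchy because the inner products of the dyadic increments are absolutely summable,
uniformly in the level (`exists_sum_abs_rectIncr_bifCov_le`). Indeed `R` is a difference of two
functions whose rectangular increments have constant sign, one by concavity of `x^K`, the other by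
convexity of `|x|^(2HK)`. The summands are only `C¹` functions of the process, so they are
approximated by smooth functionals with an error small compared with the number of terms.

For general `f` the integrands are cut off in space. On the event that the path stays in a ball, the
cutoff does not change the divergence sums, so their limits agree there and can be glued together
(`IsMultiBifBm.exists_localizing`, `ae_eq_of_tendsto_eLpNorm`). Under polynomial growth the
convergence applies to the integrand itself, and its divergence agrees with the glued one on every
such event. -/

noncomputable section

/-! ### Gaussian Hilbert spaces and Gaussian integration by parts -/

section GaussianHilbert

variable {Ω : Type*} [MeasurableSpace Ω] {P : Measure Ω} {𝓗 : Submodule ℝ (Lp ℝ 2 P)}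

/-- The random variable underlying an element of a space of square integrable functions. -/
abbrev rv (Y : 𝓗) : Ω → ℝ := ((Y : Lp ℝ 2 P) : Ω → ℝ)

lemma memLp_rv (Y : 𝓗) : MemLp (rv Y) 2 P := Lp.memLp _

lemma measurable_rv (Y : 𝓗) : Measurable (rv Y) := (Lp.stronglyMeasurable _).measurable

lemma rv_add (Y Z : 𝓗) : rv (Y + Z) =ᵐ[P] fun ω => rv Y ω + rv Z ω :=
  Lp.coeFn_add (Y : Lp ℝ 2 P) (Z : Lp ℝ 2 P)

lemma rv_sub (Y Z : 𝓗) : rv (Y - Z) =ᵐ[P] fun ω => rv Y ω - rv Z ω :=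
  Lp.coeFn_sub (Y : Lp ℝ 2 P) (Z : Lp ℝ 2 P)

lemma rv_smul (c : ℝ) (Y : 𝓗) : rv (c • Y) =ᵐ[P] fun ω => c * rv Y ω :=
  Lp.coeFn_smul c (Y : Lp ℝ 2 P)

lemma rv_zero : rv (0 : 𝓗) =ᵐ[P] fun _ => 0 := Lp.coeFn_zero ℝ 2 P

lemma rv_sum {ι : Type*} (s : Finset ι) (Y : ι → 𝓗) :
    rv (∑ i ∈ s, Y i) =ᵐ[P] fun ω => ∑ i ∈ s, rv (Y i) ω := by
  classical
  induction s using Finset.induction_on with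
  | empty => simpa using rv_zero
  | insert a s ha ih =>
    rw [Finset.sum_insert ha]
    filter_upwards [rv_add (Y a) (∑ i ∈ s, Y i), ih] with ω h1 h2
    rw [h1, h2, Finset.sum_insert ha]

lemma inner_eq_integral (Y Z : 𝓗) : inner ℝ Y Z = ∫ ω, rv Y ω * rv Z ω ∂P := by
  rw [Submodule.coe_inner, L2.inner_def]
  simp [rv, mul_comm]

/-- Every element of the space is a centered Gaussian random variable. -/
def IsGaussianHilbert (𝓗 : Submodule ℝ (Lp ℝ 2 P)) : Prop :=
  ∀ Y : 𝓗, HasGaussianLaw (rv Y) P ∧ ∫ ω, rv Y ω ∂P = 0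

lemma IsGaussianHilbert.cov_eq [IsProbabilityMeasure P] (h𝓗 : IsGaussianHilbert 𝓗) (Y Z : 𝓗) :
    cov[rv Y, rv Z; P] = inner ℝ Y Z := by
  rw [covariance_eq_sub (memLp_rv Y) (memLp_rv Z), (h𝓗 Y).2, inner_eq_integral]
  simp

lemma IsGaussianHilbert.map_rv [IsProbabilityMeasure P] (h𝓗 : IsGaussianHilbert 𝓗) (Y : 𝓗) :
    P.map (rv Y) = gaussianReal 0 (‖Y‖ ^ 2).toNNReal := by
  rw [(h𝓗 Y).1.map_eq_gaussianReal, (h𝓗 Y).2,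
    ← covariance_self (measurable_rv Y).aemeasurable, h𝓗.cov_eq, real_inner_self_eq_norm_sq]

/-- A linear functional of the vector is a linear combination of elements of `𝓗`, hence again an
element of `𝓗` and Gaussian; a vector all of whose linear functionals are Gaussian is Gaussian. -/
lemma IsGaussianHilbert.hasGaussianLaw [IsProbabilityMeasure P] (h𝓗 : IsGaussianHilbert 𝓗)
    {ι : Type*} [Fintype ι] (φ : ι → 𝓗) : HasGaussianLaw (fun ω j => rv (φ j) ω) P := by
  classical
  have hm : Measurable (fun ω j => rv (φ j) ω) := measurable_pi_lambda _ fun j => measurable_rv _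
  rw [hasGaussianLaw_iff_charFunDual_map_eq hm.aemeasurable]
  intro L
  have hL : (L ∘ fun ω j => rv (φ j) ω) =ᵐ[P] rv (∑ j, L (Pi.single j 1) • φ j) := by
    have h1 : ∀ᵐ ω ∂P, ∀ j, rv (L (Pi.single j 1) • φ j) ω = L (Pi.single j 1) * rv (φ j) ω :=
      ae_all_iff.2 fun j => rv_smul _ _
    filter_upwards [rv_sum Finset.univ fun j => L (Pi.single j 1) • φ j, h1] with ω h2 h3
    rw [h2, Function.comp_apply, Finset.sum_congr rfl fun j _ => h3 j]
    conv_lhs => rw [← Finset.univ_sum_single (fun j => rv (φ j) ω), map_sum]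
    refine Finset.sum_congr rfl fun j _ => ?_
    rw [mul_comm, ← smul_eq_mul, ← map_smul, ← Pi.single_smul, smul_eq_mul, mul_one]
  rw [integral_congr_ae hL, variance_congr hL, charFunDual_eq_charFun_map_one,
    AEMeasurable.map_map_of_aemeasurable L.continuous.measurable.aemeasurable hm.aemeasurable,
    Measure.map_congr hL, (h𝓗 _).1.charFun_map_eq]
  simp

/-- One-dimensional Gaussian integration by parts. -/
lemma integral_id_mul_gaussianReal {v : NNReal} {f f' : ℝ → ℝ} (hv : v ≠ 0)
    (hf : ∀ x, HasDerivAt f (f' x) x) (h1 : Integrable (fun x => x * f x) (gaussianReal 0 v))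
    (h0 : Integrable f (gaussianReal 0 v)) (h2 : Integrable f' (gaussianReal 0 v)) :
    ∫ x, x * f x ∂(gaussianReal 0 v) = v * ∫ x, f' x ∂(gaussianReal 0 v) := by
  have hv' : (v : ℝ) ≠ 0 := by exact_mod_cast hv
  have key : ∀ g : ℝ → ℝ, Integrable g (gaussianReal 0 v) →
      Integrable (fun x => g x * gaussianPDFReal 0 v x) := by
    intro g hg
    rw [gaussianReal_of_var_ne_zero 0 hv,
      integrable_withDensity_iff_integrable_smul₀' (by fun_prop)
        (ae_of_all _ fun x => gaussianPDF_lt_top)] at hg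
    refine hg.congr (ae_of_all _ fun x => ?_)
    simp [toReal_gaussianPDF, mul_comm]
  have hp : ∀ x, HasDerivAt (gaussianPDFReal 0 v) (-(x / v) * gaussianPDFReal 0 v x) x := by
    intro x
    rw [gaussianPDFReal_def]
    have : HasDerivAt (fun x : ℝ => -(x - 0) ^ 2 / (2 * (v : ℝ))) (-(x / v)) x := by
      have := (((hasDerivAt_id x).sub_const 0).pow 2).neg.div_const (2 * (v : ℝ))
      convert! this using 1
      simp; field_simp
    convert! (this.exp.const_mul ((√(2 * Real.pi * v))⁻¹)) using 1
    ring
  have ibp := integral_mul_deriv_eq_deriv_mul_of_integrable (u := f) (u' := f')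
    (v := gaussianPDFReal 0 v) (v' := fun x => -(x / v) * gaussianPDFReal 0 v x)
    (fun x _ => hf x) (fun x _ => hp x)
    (by
      refine ((key _ h1).const_mul (-(v : ℝ)⁻¹)).congr (ae_of_all _ fun x => ?_)
      simp only [Pi.mul_apply]; field_simp)
    (key _ h2) (key _ h0)
  rw [integral_gaussianReal_eq_integral_smul hv, integral_gaussianReal_eq_integral_smul hv]
  simp only [smul_eq_mul]
  have e1 : ∫ x, gaussianPDFReal 0 v x * f' x = ∫ x, f' x * gaussianPDFReal 0 v x :=
    integral_congr_ae (ae_of_all _ fun x => mul_comm _ _)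
  rw [e1, eq_neg_of_add_eq_zero_right (a := ∫ x, f x * (-(x / v) * gaussianPDFReal 0 v x))
    (b := ∫ x, f' x * gaussianPDFReal 0 v x) (by rw [ibp]; ring),
    mul_neg, ← integral_const_mul, ← integral_neg]
  refine integral_congr_ae (ae_of_all _ fun x => ?_)
  simp only
  field_simp

/-- Gaussian integration by parts. -/
lemma IsGaussianHilbert.integral_mul_eq_integral_fderiv [IsProbabilityMeasure P]
    (h𝓗 : IsGaussianHilbert 𝓗) {ι : Type*} [Fintype ι] (φ : ι → 𝓗) (Y : 𝓗)
    {Ψ : (ι → ℝ) → ℝ} (hΨ : ContDiff ℝ 1 Ψ)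
    (h1 : Integrable (fun ω => rv Y ω * Ψ fun j => rv (φ j) ω) P)
    (h0 : Integrable (fun ω => Ψ fun j => rv (φ j) ω) P)
    (h2 : Integrable (fun ω => fderiv ℝ Ψ (fun j => rv (φ j) ω) fun j => inner ℝ (φ j) Y) P) :
    ∫ ω, rv Y ω * Ψ (fun j => rv (φ j) ω) ∂P =
      ∫ ω, fderiv ℝ Ψ (fun j => rv (φ j) ω) (fun j => inner ℝ (φ j) Y) ∂P := by
  -- The degenerate case is separate because the argument divides by the variance `‖Y‖²`.
  rcases eq_or_ne Y 0 with rfl | hY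
  · have e : (fun j => inner ℝ (φ j) (0 : 𝓗)) = (0 : ι → ℝ) := by ext; simp
    have h : (fun ω => rv (0 : 𝓗) ω * Ψ (fun j => rv (φ j) ω)) =ᵐ[P] fun _ => 0 := by
      filter_upwards [rv_zero] with ω hω
      rw [hω, zero_mul]
    rw [integral_congr_ae h, e]
    simp
  set w : ℝ := ‖Y‖ ^ 2 with hw
  have hw0 : 0 < w := by positivity
  set v : NNReal := w.toNNReal with hv
  have hv0 : v ≠ 0 := by simpa [hv] using hw0
  have hvw : (v : ℝ) = w := Real.coe_toNNReal _ hw0.le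
  set a : ι → ℝ := fun j => inner ℝ (φ j) Y with ha
  -- The residual of `φ j` after orthogonal projection on `Y`. It is uncorrelated with `Y`, hence
  -- independent of it by joint Gaussianity. The vector of the `φ j` thus becomes `Z + Y c` with `Z`
  -- frozen, and only a one-dimensional integration by parts in `Y` is left.
  set Z : ι → 𝓗 := fun j => φ j - (a j / w) • Y with hZ
  have hmZ : Measurable (fun ω j => rv (Z j) ω) := measurable_pi_lambda _ fun j => measurable_rv _
  have hind : IndepFun (rv Y) (fun ω j => rv (Z j) ω) P := by
    have hG := h𝓗.hasGaussianLaw (fun o : Option ι => o.elim Y Z)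
    have h3 := hG.map_fun
      ((ContinuousLinearMap.pi fun _ : Unit => ContinuousLinearMap.proj (R := ℝ)
        (φ := fun _ : Option ι => ℝ) none).prod
        (ContinuousLinearMap.pi fun j : ι => ContinuousLinearMap.proj (R := ℝ)
          (φ := fun _ : Option ι => ℝ) (some j)))
    have h4 := HasGaussianLaw.indepFun_of_covariance_eval (X := fun _ : Unit => rv Y)
      (Y := fun j => rv (Z j)) (P := P) h3 (fun _ j => by
        rw [h𝓗.cov_eq, hZ, inner_sub_right, real_inner_smul_right Y Y (a j / w), real_inner_self_eq_norm_sq,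
          real_inner_comm, ← hw]
        simp only [ha]
        field_simp; simp)
    exact h4.comp (φ := fun x : Unit → ℝ => x ()) (ψ := id) (measurable_pi_apply _) measurable_id
  have hlaw : P.map (fun ω => (rv Y ω, fun j => rv (Z j) ω)) =
      (gaussianReal 0 v).prod (P.map fun ω j => rv (Z j) ω) := by
    rw [(indepFun_iff_map_prod_eq_prod_map_map (measurable_rv Y).aemeasurable
      hmZ.aemeasurable).1 hind, h𝓗.map_rv]
  set μ := P.map fun ω j => rv (Z j) ω
  have : IsProbabilityMeasure μ := Measure.isProbabilityMeasure_map hmZ.aemeasurable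
  have hmp : Measurable (fun ω => (rv Y ω, fun j => rv (Z j) ω)) := (measurable_rv Y).prodMk hmZ
  set c : ι → ℝ := fun j => a j / w
  have hφ : ∀ᵐ ω ∂P, (fun j => rv (φ j) ω) = (fun j => rv (Z j) ω) + rv Y ω • c := by
    have h5 : ∀ᵐ ω ∂P, ∀ j, rv (Z j) ω = rv (φ j) ω - rv ((a j / w) • Y) ω :=
      ae_all_iff.2 fun j => rv_sub _ _
    have h6 : ∀ᵐ ω ∂P, ∀ j, rv ((a j / w) • Y) ω = a j / w * rv Y ω :=
      ae_all_iff.2 fun j => rv_smul _ _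
    filter_upwards [h5, h6] with ω h5 h6
    ext j
    simp only [Pi.add_apply, Pi.smul_apply, smul_eq_mul, h5, h6, c]
    ring
  have hcΨ := hΨ.continuous
  have hcD : Continuous (fun x => fderiv ℝ Ψ x a) :=
    (hΨ.continuous_fderiv one_ne_zero).clm_apply continuous_const
  -- Expectations are moved to the product of the laws of `Y` and `Z`, so that Fubini applies.
  have trans : ∀ g : ℝ → (ι → ℝ) → ℝ, Continuous (Function.uncurry g) →
      Integrable (fun ω => g (rv Y ω) fun j => rv (φ j) ω) P →
      Integrable (fun p : ℝ × (ι → ℝ) => g p.1 (p.2 + p.1 • c)) ((gaussianReal 0 v).prod μ) ∧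
      ∫ ω, g (rv Y ω) (fun j => rv (φ j) ω) ∂P =
        ∫ p : ℝ × (ι → ℝ), g p.1 (p.2 + p.1 • c) ∂((gaussianReal 0 v).prod μ) := by
    intro g hg hi
    have hc : Continuous (fun p : ℝ × (ι → ℝ) => g p.1 (p.2 + p.1 • c)) :=
      hg.comp (continuous_fst.prodMk (continuous_snd.add (continuous_fst.smul continuous_const)))
    have he : (fun ω => g (rv Y ω) fun j => rv (φ j) ω) =ᵐ[P]
        (fun p : ℝ × (ι → ℝ) => g p.1 (p.2 + p.1 • c)) ∘ fun ω => (rv Y ω, fun j => rv (Z j) ω) := by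
      filter_upwards [hφ] with ω hω
      simp only [hω, Function.comp_apply]
    rw [← hlaw]
    constructor
    · rw [integrable_map_measure hc.aestronglyMeasurable hmp.aemeasurable]
      exact hi.congr he
    · rw [integral_map hmp.aemeasurable hc.aestronglyMeasurable, integral_congr_ae he]
      rfl
  obtain ⟨i1, e1⟩ := trans (fun y x => y * Ψ x) (by
    exact continuous_fst.mul (hcΨ.comp continuous_snd)) h1
  obtain ⟨i0, e0⟩ := trans (fun _ x => Ψ x) (hcΨ.comp continuous_snd) h0
  obtain ⟨i2, e2⟩ := trans (fun _ x => fderiv ℝ Ψ x a) (hcD.comp continuous_snd) h2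
  rw [e1, e2, integral_prod_symm _ i1, integral_prod_symm _ i2]
  refine integral_congr_ae ?_
  filter_upwards [i1.prod_left_ae, i0.prod_left_ae, i2.prod_left_ae] with z z1 z0 z2
  -- As `c = a / w`, the derivative along `c` carries a factor `w⁻¹`, which the variance `w` from
  -- the one-dimensional formula cancels.
  have hd : ∀ y : ℝ, HasDerivAt (fun y : ℝ => Ψ (z + y • c))
      (w⁻¹ * fderiv ℝ Ψ (z + y • c) a) y := by
    intro y
    have h7 : HasDerivAt (fun y : ℝ => z + y • c) c y := by
      simpa using! ((hasDerivAt_id y).smul_const c).const_add z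
    have h8 := ((hΨ.differentiable one_ne_zero) (z + y • c)).hasFDerivAt.comp_hasDerivAt y h7
    have h9 : c = w⁻¹ • a := by ext j; simp [c]; ring
    have h10 : fderiv ℝ Ψ (z + y • c) c = w⁻¹ * fderiv ℝ Ψ (z + y • c) a := by
      conv_lhs => rw [h9, map_smul, smul_eq_mul, ← h9]
    rw [← h10]
    exact h8
  have := integral_id_mul_gaussianReal hv0 hd z1 z0 (z2.const_mul _)
  rw [this, integral_const_mul, hvw]
  field_simp

end GaussianHilbert

/-! ### Calculus of cylindrical functionals -/

section Moments

variable {Ω : Type*} [MeasurableSpace Ω] {P : Measure Ω}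

/-- All moments of `F` are finite. -/
def HasMoments (F : Ω → ℝ) (P : Measure Ω) : Prop := ∀ p : ℝ≥0∞, p ≠ ∞ → MemLp F p P

lemma HasMoments.integrable {F : Ω → ℝ} (hF : HasMoments F P) : Integrable F P :=
  memLp_one_iff_integrable.1 (hF 1 (by simp))

lemma HasMoments.mul {F G : Ω → ℝ} (hF : HasMoments F P) (hG : HasMoments G P) :
    HasMoments (fun ω => F ω * G ω) P := by
  intro p hp
  have h2 : 2 * p ≠ ∞ := ENNReal.mul_ne_top (by simp) hp
  have : ENNReal.HolderTriple (2 * p) (2 * p) p := ⟨by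
    rw [ENNReal.mul_inv (by simp) (by simp), ← add_mul, ENNReal.inv_two_add_inv_two, one_mul]⟩
  exact (hG _ h2).mul' (hF _ h2)

lemma HasMoments.add {F G : Ω → ℝ} (hF : HasMoments F P) (hG : HasMoments G P) :
    HasMoments (fun ω => F ω + G ω) P := fun p hp => (hF p hp).add (hG p hp)

lemma HasMoments.sub {F G : Ω → ℝ} (hF : HasMoments F P) (hG : HasMoments G P) :
    HasMoments (fun ω => F ω - G ω) P := fun p hp => (hF p hp).sub (hG p hp)

lemma HasMoments.sum {ι : Type*} (s : Finset ι) {F : ι → Ω → ℝ} (hF : ∀ i, HasMoments (F i) P) :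
    HasMoments (fun ω => ∑ i ∈ s, F i ω) P := fun p hp => memLp_finsetSum s fun i _ => hF i p hp

lemma hasMoments_const [IsFiniteMeasure P] (c : ℝ) : HasMoments (fun _ : Ω => c) P :=
  fun _ _ => memLp_const c

lemma HasMoments.pow [IsFiniteMeasure P] {F : Ω → ℝ} (hF : HasMoments F P) (n : ℕ) :
    HasMoments (fun ω => F ω ^ n) P := by
  induction n with
  | zero => simpa using hasMoments_const 1
  | succ n ih => simpa only [pow_succ] using ih.mul hF

end Moments

/-- Functions of at most polynomial growth. -/
def PolyBdd {E F : Type*} [NormedAddCommGroup E] [NormedAddCommGroup F] (f : E → F) : Prop :=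
  ∃ (C : ℝ) (N : ℕ), ∀ x, ‖f x‖ ≤ C * (1 + ‖x‖) ^ N

section PolyBdd

variable {E F G : Type*} [NormedAddCommGroup E] [NormedAddCommGroup F] [NormedAddCommGroup G]

lemma PolyBdd.of_bound {f : E → F} {C : ℝ} (h : ∀ x, ‖f x‖ ≤ C) : PolyBdd f :=
  ⟨C, 0, fun x => by simpa using h x⟩

lemma PolyBdd.exists_nonneg {f : E → F} (h : PolyBdd f) :
    ∃ (C : ℝ) (N : ℕ), 0 ≤ C ∧ ∀ x, ‖f x‖ ≤ C * (1 + ‖x‖) ^ N := by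
  obtain ⟨C, N, h⟩ := h
  exact ⟨C, N, by simpa using (norm_nonneg _).trans (h 0), h⟩

lemma PolyBdd.mono {f : E → F} {f' : E → G} (h : PolyBdd f) (h' : ∀ x, ‖f' x‖ ≤ ‖f x‖) :
    PolyBdd f' := by
  obtain ⟨C, N, h⟩ := h
  exact ⟨C, N, fun x => (h' x).trans (h x)⟩

lemma PolyBdd.add {f f' : E → F} (h : PolyBdd f) (h' : PolyBdd f') :
    PolyBdd (fun x => f x + f' x) := by
  obtain ⟨C, N, hC, h⟩ := h.exists_nonneg
  obtain ⟨C', N', hC', h'⟩ := h'.exists_nonneg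
  refine ⟨C + C', max N N', fun x => (norm_add_le _ _).trans ?_⟩
  have h1 : (1 : ℝ) ≤ 1 + ‖x‖ := by linarith [norm_nonneg x]
  calc ‖f x‖ + ‖f' x‖ ≤ C * (1 + ‖x‖) ^ N + C' * (1 + ‖x‖) ^ N' := add_le_add (h x) (h' x)
    _ ≤ C * (1 + ‖x‖) ^ (max N N') + C' * (1 + ‖x‖) ^ (max N N') := by
        gcongr <;> first | exact h1 | simp
    _ = _ := by ring

lemma PolyBdd.of_le_mul {f : E → F} {f' : E → G} {k : E → ℝ} (h : PolyBdd f) (h' : PolyBdd f')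
    (hk : ∀ x, |k x| ≤ ‖f x‖ * ‖f' x‖) : PolyBdd k := by
  obtain ⟨C, N, hC, h⟩ := h.exists_nonneg
  obtain ⟨C', N', hC', h'⟩ := h'.exists_nonneg
  refine ⟨C * C', N + N', fun x => (hk x).trans ?_⟩
  calc ‖f x‖ * ‖f' x‖ ≤ (C * (1 + ‖x‖) ^ N) * (C' * (1 + ‖x‖) ^ N') :=
        mul_le_mul (h x) (h' x) (norm_nonneg _) ((norm_nonneg _).trans (h x))
    _ = _ := by ring

lemma PolyBdd.comp_le {f : E → F} (h : PolyBdd f) {L : G → E} (hL : ∀ x, ‖L x‖ ≤ ‖x‖) :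
    PolyBdd (fun x => f (L x)) := by
  obtain ⟨C, N, hC, h⟩ := h.exists_nonneg
  refine ⟨C, N, fun x => (h _).trans ?_⟩
  gcongr
  exact hL x

lemma PolyBdd.norm {f : E → F} (h : PolyBdd f) : PolyBdd (fun x => ‖f x‖) :=
  h.mono fun x => by simp

end PolyBdd

section Cylinder

variable {Ω : Type*} [MeasurableSpace Ω] {P : Measure Ω} {𝓗 : Submodule ℝ (Lp ℝ 2 P)}

/-- `F = Ψ(φ)` with `Ψ` of class `C¹` and polynomial growth, and `F' h` is the derivative of `F`
in the direction `h`. -/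
def IsCylinderOn {ι : Type} [Fintype ι] (φ : ι → 𝓗) (F : Ω → ℝ) (F' : 𝓗 → Ω → ℝ) : Prop :=
  ∃ Ψ : (ι → ℝ) → ℝ, ContDiff ℝ 1 Ψ ∧ PolyBdd Ψ ∧ PolyBdd (fderiv ℝ Ψ) ∧
    (∀ ω, F ω = Ψ fun j => rv (φ j) ω) ∧
    ∀ h ω, F' h ω = fderiv ℝ Ψ (fun j => rv (φ j) ω) fun j => inner ℝ (φ j) h

/-- `F` is a cylindrical functional and `F' h` is its derivative in the direction `h`. -/
def IsCylinder (F : Ω → ℝ) (F' : 𝓗 → Ω → ℝ) : Prop :=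
  ∃ (ι : Type) (_ : Fintype ι) (φ : ι → 𝓗), IsCylinderOn φ F F'

/-- Composing `Ψ` with the coordinate map `x ↦ x ∘ e`, which is a contraction for the sup norm,
preserves the growth bounds. Two functionals can thus be written over one common family, which
products and differences require. -/
lemma IsCylinderOn.reindex {ι κ : Type} [Fintype ι] [Fintype κ] {φ : ι → 𝓗} {ψ : κ → 𝓗}
    {F : Ω → ℝ} {F' : 𝓗 → Ω → ℝ} (h : IsCylinderOn φ F F') (e : ι → κ) (he : ∀ i, ψ (e i) = φ i) :
    IsCylinderOn ψ F F' := by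
  obtain ⟨Ψ, h1, h2, h3, h4, h5⟩ := h
  set L : (κ → ℝ) →L[ℝ] (ι → ℝ) :=
    ContinuousLinearMap.pi fun i => ContinuousLinearMap.proj (R := ℝ) (φ := fun _ : κ => ℝ) (e i)
  have hLx : ∀ x, ‖L x‖ ≤ ‖x‖ := fun x =>
    (pi_norm_le_iff_of_nonneg (norm_nonneg _)).2 fun i => norm_le_pi_norm x (e i)
  have hL1 : ‖L‖ ≤ 1 := ContinuousLinearMap.opNorm_le_bound _ zero_le_one fun x => by
    simpa using hLx x
  have hd : ∀ x, fderiv ℝ (Ψ ∘ L) x = (fderiv ℝ Ψ (L x)).comp L := fun x => by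
    rw [fderiv_comp x ((h1.differentiable one_ne_zero) _) L.differentiableAt, L.fderiv]
  refine ⟨Ψ ∘ L, h1.comp L.contDiff, h2.comp_le hLx, ?_, fun ω => ?_, fun h ω => ?_⟩
  · refine (h3.comp_le hLx).mono fun x => ?_
    rw [hd]
    refine (ContinuousLinearMap.opNorm_comp_le _ _).trans ?_
    exact mul_le_of_le_one_right (norm_nonneg _) hL1
  · simp [h4, L, he]
  · rw [h5, hd]
    simp [L, he]

lemma IsCylinder.common {F G : Ω → ℝ} {F' G' : 𝓗 → Ω → ℝ} (hF : IsCylinder F F')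
    (hG : IsCylinder G G') : ∃ (ι : Type) (_ : Fintype ι) (φ : ι → 𝓗),
      IsCylinderOn φ F F' ∧ IsCylinderOn φ G G' := by
  obtain ⟨ι, _, φ, h⟩ := hF
  obtain ⟨κ, _, ψ, h'⟩ := hG
  exact ⟨ι ⊕ κ, inferInstance, Sum.elim φ ψ, h.reindex Sum.inl fun _ => rfl,
    h'.reindex Sum.inr fun _ => rfl⟩

lemma IsCylinder.mul {F G : Ω → ℝ} {F' G' : 𝓗 → Ω → ℝ} (hF : IsCylinder F F')
    (hG : IsCylinder G G') :
    IsCylinder (fun ω => F ω * G ω) (fun h ω => F ω * G' h ω + G ω * F' h ω) := by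
  obtain ⟨ι, _, φ, ⟨Ψ, a1, a2, a3, a4, a5⟩, ⟨Θ, b1, b2, b3, b4, b5⟩⟩ := hF.common hG
  have hd : ∀ x, fderiv ℝ (fun x => Ψ x * Θ x) x = Ψ x • fderiv ℝ Θ x + Θ x • fderiv ℝ Ψ x :=
    fun x => fderiv_fun_mul ((a1.differentiable one_ne_zero) x) ((b1.differentiable one_ne_zero) x)
  refine ⟨ι, inferInstance, φ, fun x => Ψ x * Θ x, a1.mul b1,
    a2.of_le_mul b2 fun x => (abs_mul _ _).le, ?_, fun ω => by simp [a4, b4], fun h ω => ?_⟩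
  · refine ((a2.of_le_mul (k := fun x => ‖Ψ x‖ * ‖fderiv ℝ Θ x‖) b3 fun x => ?_).add
      (b2.of_le_mul (k := fun x => ‖Θ x‖ * ‖fderiv ℝ Ψ x‖) a3 fun x => ?_)).mono fun x => ?_
    · rw [abs_of_nonneg (by positivity)]
    · rw [abs_of_nonneg (by positivity)]
    · rw [hd, Real.norm_of_nonneg (by positivity), ← norm_smul, ← norm_smul]
      exact norm_add_le _ _
  · rw [hd]
    simp [a4, b4, a5, b5]

lemma IsCylinder.sub {F G : Ω → ℝ} {F' G' : 𝓗 → Ω → ℝ} (hF : IsCylinder F F')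
    (hG : IsCylinder G G') :
    IsCylinder (fun ω => F ω - G ω) (fun h ω => F' h ω - G' h ω) := by
  obtain ⟨ι, _, φ, ⟨Ψ, a1, a2, a3, a4, a5⟩, ⟨Θ, b1, b2, b3, b4, b5⟩⟩ := hF.common hG
  have hd : ∀ x, fderiv ℝ (fun x => Ψ x - Θ x) x = fderiv ℝ Ψ x - fderiv ℝ Θ x :=
    fun x => fderiv_fun_sub ((a1.differentiable one_ne_zero) x) ((b1.differentiable one_ne_zero) x)
  refine ⟨ι, inferInstance, φ, fun x => Ψ x - Θ x, a1.sub b1,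
    (a2.norm.add b2.norm).mono fun x => ?_, (a3.norm.add b3.norm).mono fun x => ?_,
    fun ω => by simp [a4, b4], fun h ω => ?_⟩
  · rw [Real.norm_of_nonneg (r := ‖Ψ x‖ + ‖Θ x‖) (by positivity)]
    exact norm_sub_le _ _
  · rw [hd, Real.norm_of_nonneg (r := ‖fderiv ℝ Ψ x‖ + ‖fderiv ℝ Θ x‖) (by positivity)]
    exact norm_sub_le _ _
  · rw [hd]
    simp [a5, b5]

lemma isCylinder_rv (Y : 𝓗) : IsCylinder (rv Y) (fun h _ => inner ℝ Y h) := by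
  set L : (Unit → ℝ) →L[ℝ] ℝ := ContinuousLinearMap.proj (R := ℝ) (φ := fun _ : Unit => ℝ) ()
  refine ⟨Unit, inferInstance, fun _ => Y, L, L.contDiff, ⟨1, 1, fun x => ?_⟩,
    ⟨‖L‖, 0, fun x => ?_⟩, fun ω => rfl, fun h ω => ?_⟩
  · have := norm_le_pi_norm x ()
    simp only [pow_one, one_mul]
    exact this.trans (by linarith)
  · simp [L.fderiv]
  · simp [L.fderiv, L]

/-- Gaussian vectors have moments of all orders, and so does any polynomial in their norm. -/
lemma hasMoments_of_polyBdd [IsProbabilityMeasure P] {ι : Type*} [Fintype ι] {X : Ω → ι → ℝ}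
    (hX : HasGaussianLaw X P) {Ψ : (ι → ℝ) → ℝ} (hΨ : Continuous Ψ) (h : PolyBdd Ψ) :
    HasMoments (fun ω => Ψ (X ω)) P := by
  obtain ⟨C, N, h⟩ := h
  have h1 : HasMoments (fun ω => ‖X ω‖) P := fun p hp => (hX.memLp hp).norm
  have h2 := (hasMoments_const C).mul (((hasMoments_const (P := P) 1).add h1).pow N)
  exact fun p hp => (h2 p hp).mono'
    (hΨ.comp_aestronglyMeasurable hX.aemeasurable.aestronglyMeasurable) (ae_of_all _ fun ω => h _)

lemma IsCylinder.hasMoments [IsProbabilityMeasure P] (h𝓗 : IsGaussianHilbert 𝓗) {F : Ω → ℝ}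
    {F' : 𝓗 → Ω → ℝ} (hF : IsCylinder F F') :
    HasMoments F P ∧ ∀ h, HasMoments (F' h) P := by
  obtain ⟨ι, _, φ, Ψ, a1, a2, a3, a4, a5⟩ := hF
  have hX := h𝓗.hasGaussianLaw φ
  constructor
  · rw [funext a4]
    exact hasMoments_of_polyBdd hX a1.continuous a2
  · intro h
    rw [funext (a5 h)]
    refine hasMoments_of_polyBdd hX
      (Ψ := fun x => fderiv ℝ Ψ x fun j => inner ℝ (φ j) h)
      ((a1.continuous_fderiv one_ne_zero).clm_apply continuous_const) ?_
    refine a3.of_le_mul (f' := fun _ : ι → ℝ => (fun j => inner ℝ (φ j) h : ι → ℝ))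
      (PolyBdd.of_bound fun _ => le_rfl) fun x => ?_
    exact (fderiv ℝ Ψ x).le_opNorm _

lemma IsCylinder.integral_rv_mul [IsProbabilityMeasure P] (h𝓗 : IsGaussianHilbert 𝓗) {F : Ω → ℝ}
    {F' : 𝓗 → Ω → ℝ} (hF : IsCylinder F F') (h : 𝓗) :
    ∫ ω, rv h ω * F ω ∂P = ∫ ω, F' h ω ∂P := by
  have m1 := ((isCylinder_rv h).hasMoments h𝓗).1.mul (hF.hasMoments h𝓗).1
  have m0 := (hF.hasMoments h𝓗).1
  have m2 := (hF.hasMoments h𝓗).2 h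
  obtain ⟨ι, _, φ, Ψ, a1, a2, a3, a4, a5⟩ := hF
  simp only [a4] at m1 ⊢
  rw [funext a4] at m0
  rw [funext (a5 h)] at m2 ⊢
  exact h𝓗.integral_mul_eq_integral_fderiv φ h a1 m1.integrable m0.integrable m2.integrable

/-- Duality between derivative and divergence for elementary integrands `F h`. -/
lemma IsCylinder.integral_mul_divergence [IsProbabilityMeasure P] (h𝓗 : IsGaussianHilbert 𝓗)
    {F G : Ω → ℝ} {F' G' : 𝓗 → Ω → ℝ} (hF : IsCylinder F F') (hG : IsCylinder G G') (h : 𝓗) :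
    ∫ ω, G ω * (F ω * rv h ω - F' h ω) ∂P = ∫ ω, F ω * G' h ω ∂P := by
  have mF := hF.hasMoments h𝓗
  have mG := hG.hasMoments h𝓗
  have mh := ((isCylinder_rv h).hasMoments h𝓗).1
  -- Integration by parts for the product `F G`: the Leibniz rule produces the wanted term and the
  -- one already subtracted in the divergence.
  have e := (hF.mul hG).integral_rv_mul h𝓗 h
  rw [integral_add (mF.1.mul (mG.2 h)).integrable (mG.1.mul (mF.2 h)).integrable] at e
  have e2 : ∫ ω, G ω * (F ω * rv h ω - F' h ω) ∂P =
      ∫ ω, (rv h ω * (F ω * G ω) - G ω * F' h ω) ∂P :=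
    integral_congr_ae (ae_of_all _ fun ω => by simp only; ring)
  rw [e2, integral_sub (mh.mul (mF.1.mul mG.1)).integrable (mG.1.mul (mF.2 h)).integrable, e]
  ring

/-- The covariance of two elementary divergences. -/
lemma IsCylinder.integral_divergence_mul_divergence [IsProbabilityMeasure P]
    (h𝓗 : IsGaussianHilbert 𝓗) {F G : Ω → ℝ} {F' G' : 𝓗 → Ω → ℝ} {G'' : 𝓗 → 𝓗 → Ω → ℝ}
    (hF : IsCylinder F F') (hG : IsCylinder G G') (hG' : ∀ h, IsCylinder (G' h) (G'' h))
    (hsymm : ∀ h k, G'' h k = G'' k h) (h k : 𝓗) :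
    ∫ ω, (F ω * rv h ω - F' h ω) * (G ω * rv k ω - G' k ω) ∂P =
      (∫ ω, F ω * G ω ∂P) * inner ℝ h k + ∫ ω, F' k ω * G' h ω ∂P := by
  have mF := hF.hasMoments h𝓗
  have mG := hG.hasMoments h𝓗
  have mG' := fun h => (hG' h).hasMoments h𝓗
  have mk := ((isCylinder_rv k).hasMoments h𝓗).1
  -- Duality is applied with the second divergence itself as the test functional; its derivative
  -- along `h` is `G ⟨k, h⟩ + B(k) G'(h) - G''(k, h)`. A second integration by parts, along `k`,
  -- removes `B(k)`, and the second derivatives cancel by symmetry.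
  have e1 := hF.integral_mul_divergence h𝓗 ((hG.mul (isCylinder_rv k)).sub (hG' k)) h
  have e2 := (hF.mul (hG' h)).integral_rv_mul h𝓗 k
  rw [integral_add (mF.1.mul ((mG' h).2 k)).integrable
    ((mG' h).1.mul (mF.2 k)).integrable] at e2
  have e3 : ∫ ω, (F ω * rv h ω - F' h ω) * (G ω * rv k ω - G' k ω) ∂P =
      ∫ ω, (G ω * rv k ω - G' k ω) * (F ω * rv h ω - F' h ω) ∂P :=
    integral_congr_ae (ae_of_all _ fun ω => mul_comm _ _)
  have e4 : ∫ ω, F ω * (G ω * inner ℝ k h + rv k ω * G' h ω - G'' k h ω) ∂P =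
      ∫ ω, (F ω * G ω * inner ℝ h k + (rv k ω * (F ω * G' h ω) - F ω * G'' h k ω)) ∂P :=
    integral_congr_ae (ae_of_all _ fun ω => by
      simp only [hsymm k h, real_inner_comm h k]; ring)
  have e5 : ∫ ω, F' k ω * G' h ω ∂P = ∫ ω, G' h ω * F' k ω ∂P :=
    integral_congr_ae (ae_of_all _ fun ω => mul_comm _ _)
  rw [e3, e1, e4, integral_add ((mF.1.mul mG.1).integrable.mul_const _)
    ((mk.mul (mF.1.mul (mG' h).1)).sub (mF.1.mul ((mG' h).2 k))).integrable,
    integral_sub (mk.mul (mF.1.mul (mG' h).1)).integrable (mF.1.mul ((mG' h).2 k)).integrable, e2,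
    integral_mul_const, e5]
  ring

end Cylinder

/-! ### The divergence of elementary processes -/

section Algebra

variable {E F ι : Type*} [NormedAddCommGroup E] [InnerProductSpace ℝ E] [NormedAddCommGroup F]
  [InnerProductSpace ℝ F] (s : Finset ι)

lemma norm_sum_smul_sq (c : ι → ℝ) (b : ι → F) :
    ‖∑ k ∈ s, c k • b k‖ ^ 2 = ∑ k ∈ s, ∑ l ∈ s, c k * c l * inner ℝ (b k) (b l) := by
  rw [← real_inner_self_eq_norm_sq, sum_inner]
  refine Finset.sum_congr rfl fun k _ => ?_
  rw [inner_sum]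
  refine Finset.sum_congr rfl fun l _ => ?_
  rw [real_inner_smul_left, real_inner_smul_right]
  ring

lemma norm_sum_tmul_sq (a : ι → E) (b : ι → F) :
    ‖∑ k ∈ s, a k ⊗ₜ[ℝ] b k‖ ^ 2 =
      ∑ k ∈ s, ∑ l ∈ s, inner ℝ (a k) (a l) * inner ℝ (b k) (b l) := by
  rw [← real_inner_self_eq_norm_sq, sum_inner]
  refine Finset.sum_congr rfl fun k _ => ?_
  rw [inner_sum]
  exact Finset.sum_congr rfl fun l _ => TensorProduct.inner_tmul _ _ _ _ _

/-- The left side is the inner product of the tensor with its flip. The flip is an isometry, so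
Cauchy–Schwarz applies. This bounds the trace term in the second moment of a divergence. -/
lemma sum_inner_mul_inner_le (a b : ι → E) :
    ∑ k ∈ s, ∑ l ∈ s, inner ℝ (a k) (b l) * inner ℝ (a l) (b k) ≤
      ‖∑ k ∈ s, a k ⊗ₜ[ℝ] b k‖ ^ 2 := by
  have h := real_inner_le_norm (∑ k ∈ s, a k ⊗ₜ[ℝ] b k)
    (TensorProduct.comm ℝ E E (∑ k ∈ s, a k ⊗ₜ[ℝ] b k))
  rw [TensorProduct.norm_comm, ← sq] at h
  refine le_trans (le_of_eq ?_) h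
  rw [map_sum, sum_inner]
  refine Finset.sum_congr rfl fun k _ => ?_
  rw [inner_sum]
  refine Finset.sum_congr rfl fun l _ => ?_
  rw [TensorProduct.comm_tmul, TensorProduct.inner_tmul, real_inner_comm (a l)]

end Algebra

section Elementary

variable {Ω : Type*} [MeasurableSpace Ω] {P : Measure Ω} {𝓗 : Submodule ℝ (Lp ℝ 2 P)}

namespace SmoothFunctional

variable (F : SmoothFunctional 𝓗)

lemma inner_D (ω : Ω) (h : 𝓗) :
    inner ℝ (F.D ω) h = fderiv ℝ F.g (fun j => rv (F.φ j) ω) fun j => inner ℝ (F.φ j) h := by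
  rw [D, sum_inner]
  conv_rhs => rw [← Finset.univ_sum_single (fun j => inner ℝ (F.φ j) h), map_sum]
  refine Finset.sum_congr rfl fun j _ => ?_
  rw [real_inner_smul_left (F.φ j) h]
  conv_rhs => rw [← mul_one (inner ℝ (F.φ j) h), ← smul_eq_mul, Pi.single_smul, map_smul]
  rw [smul_eq_mul, mul_comm]

lemma exists_bound_g : ∃ C, ∀ x, ‖F.g x‖ ≤ C := by
  obtain ⟨C, hC⟩ := F.bounded 0
  exact ⟨C, fun x => by simpa using hC x⟩

lemma exists_bound_fderiv : ∃ C, ∀ x, ‖fderiv ℝ F.g x‖ ≤ C := by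
  obtain ⟨C, hC⟩ := F.bounded 1
  exact ⟨C, fun x => by simpa only [norm_iteratedFDeriv_one] using hC x⟩

lemma isCylinder : IsCylinder F.val (fun h ω => inner ℝ (F.D ω) h) := by
  obtain ⟨C, hC⟩ := F.exists_bound_g
  obtain ⟨C', hC'⟩ := F.exists_bound_fderiv
  exact ⟨Fin F.n, inferInstance, F.φ, F.g, F.smooth.of_le (by exact_mod_cast le_top),
    .of_bound hC, .of_bound hC', fun ω => rfl, fun h ω => F.inner_D ω h⟩

/-- The second derivative. -/
def D2 (h k : 𝓗) (ω : Ω) : ℝ :=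
  fderiv ℝ (fderiv ℝ F.g) (fun j => rv (F.φ j) ω) (fun j => inner ℝ (F.φ j) k)
    fun j => inner ℝ (F.φ j) h

lemma D2_comm (h k : 𝓗) : F.D2 h k = F.D2 k h := by
  funext ω
  have h2 : ContDiffAt ℝ 2 F.g (fun j => rv (F.φ j) ω) :=
    (F.smooth.of_le (by norm_cast)).contDiffAt
  exact h2.isSymmSndFDerivAt (by simp) _ _

lemma isCylinder_D (h : 𝓗) : IsCylinder (fun ω => inner ℝ (F.D ω) h) (F.D2 h) := by
  obtain ⟨C', hC'⟩ := F.exists_bound_fderiv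
  obtain ⟨C, hC⟩ := F.bounded 2
  have h2 : ContDiff ℝ 1 (fderiv ℝ F.g) :=
    F.smooth.fderiv_right (by norm_cast)
  set a : Fin F.n → ℝ := fun j => inner ℝ (F.φ j) h
  have hd : ∀ x b, fderiv ℝ (fun x => fderiv ℝ F.g x a) x b = fderiv ℝ (fderiv ℝ F.g) x b a := by
    intro x b
    rw [fderiv_clm_apply ((h2.differentiable one_ne_zero) x) (differentiableAt_const a)]
    simp
  refine ⟨Fin F.n, inferInstance, F.φ, fun x => fderiv ℝ F.g x a, h2.clm_apply contDiff_const,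
    .of_bound (C := C' * ‖a‖) fun x => ?_, .of_bound (C := C * ‖a‖) fun x => ?_,
    fun ω => F.inner_D ω h, fun k ω => (hd _ _).symm⟩
  · exact (ContinuousLinearMap.le_opNorm _ _).trans
      (mul_le_mul_of_nonneg_right (hC' x) (norm_nonneg _))
  · have hC0 : 0 ≤ C := (norm_nonneg _).trans (hC 0)
    refine ContinuousLinearMap.opNorm_le_bound _ (by positivity) fun b => ?_
    rw [hd]
    have h3 : ‖fderiv ℝ (fderiv ℝ F.g) x‖ ≤ C := by
      rw [← norm_iteratedFDeriv_one, norm_iteratedFDeriv_fderiv]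
      exact hC x
    calc ‖fderiv ℝ (fderiv ℝ F.g) x b a‖ ≤ ‖fderiv ℝ (fderiv ℝ F.g) x b‖ * ‖a‖ :=
          ContinuousLinearMap.le_opNorm _ _
      _ ≤ C * ‖b‖ * ‖a‖ := by
          gcongr
          exact (ContinuousLinearMap.le_opNorm _ _).trans (by gcongr)
      _ = _ := by ring

lemma measurable_val : Measurable F.val :=
  F.smooth.continuous.measurable.comp (measurable_pi_lambda _ fun _ => measurable_rv _)

end SmoothFunctional

namespace ElementaryProcess

variable (V W : ElementaryProcess 𝓗)

/-- The divergence `∑ₖ (Fₖ hₖ - ⟨DFₖ, hₖ⟩)` of an elementary process. -/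
def div (ω : Ω) : ℝ := ∑ k, ((V.F k).val ω * rv (V.h k) ω - inner ℝ ((V.F k).D ω) (V.h k))

/-- The difference of two elementary processes. -/
def sub : ElementaryProcess 𝓗 where
  m := V.m + W.m
  F := Fin.append V.F W.F
  h := Fin.append V.h fun k => -W.h k

lemma sum_sub {M : Type*} [AddCommMonoid M] (φ : SmoothFunctional 𝓗 → 𝓗 → M) :
    ∑ k, φ ((V.sub W).F k) ((V.sub W).h k) =
      ∑ k, φ (V.F k) (V.h k) + ∑ k, φ (W.F k) (-W.h k) := by
  refine (Fin.sum_univ_add fun k : Fin (V.m + W.m) =>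
    φ (Fin.append V.F W.F k) (Fin.append V.h (fun k => -W.h k) k)).trans ?_
  simp only [Fin.append_left, Fin.append_right]

lemma sub_val (ω : Ω) : (V.sub W).val ω = V.val ω - W.val ω := by
  simp only [val]
  rw [V.sum_sub W fun F h => F.val ω • h]
  simp only [smul_neg, Finset.sum_neg_distrib, sub_eq_add_neg]

lemma sub_D (ω : Ω) : (V.sub W).D ω = V.D ω - W.D ω := by
  simp only [D]
  rw [V.sum_sub W fun F h => F.D ω ⊗ₜ[ℝ] h]
  simp only [TensorProduct.tmul_neg, Finset.sum_neg_distrib, sub_eq_add_neg]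

/-- The identity holds only almost surely, because the representatives of `-h` and `h` in `L²` are
opposite only off a null set. -/
lemma sub_div : (V.sub W).div =ᵐ[P] fun ω => V.div ω - W.div ω := by
  have h : ∀ᵐ ω ∂P, ∀ k, rv (-W.h k) ω = -rv (W.h k) ω :=
    ae_all_iff.2 fun _ => Lp.coeFn_neg _
  filter_upwards [h] with ω h
  simp only [div]
  rw [V.sum_sub W fun F h => F.val ω * rv h ω - inner ℝ (F.D ω) h]
  simp only [h, inner_neg_right]
  rw [sub_eq_add_neg, ← Finset.sum_neg_distrib]
  congr 1
  exact Finset.sum_congr rfl fun k _ => by ring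

lemma hasMoments_div [IsProbabilityMeasure P] (h𝓗 : IsGaussianHilbert 𝓗) : HasMoments V.div P :=
  HasMoments.sum _ fun k =>
    (((V.F k).isCylinder.hasMoments h𝓗).1.mul ((isCylinder_rv _).hasMoments h𝓗).1).sub
      (((V.F k).isCylinder.hasMoments h𝓗).2 _)

/-- The divergence of an elementary process is dual to the derivative. -/
lemma integral_mul_div [IsProbabilityMeasure P] (h𝓗 : IsGaussianHilbert 𝓗)
    (F : SmoothFunctional 𝓗) :
    ∫ ω, F.val ω * V.div ω ∂P = ∫ ω, inner ℝ (F.D ω) (V.val ω) ∂P := by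
  have mF := F.isCylinder.hasMoments h𝓗
  have mV := fun k => (V.F k).isCylinder.hasMoments h𝓗
  have mh := fun k => ((isCylinder_rv (V.h k)).hasMoments h𝓗).1
  have e : ∀ ω, inner ℝ (F.D ω) (V.val ω) =
      ∑ k, (V.F k).val ω * inner ℝ (F.D ω) (V.h k) := fun ω => by
    rw [val, inner_sum]
    exact Finset.sum_congr rfl fun k _ => real_inner_smul_right (F.D ω) (V.h k) _
  simp only [div, e, Finset.mul_sum]
  rw [integral_finsetSum _ fun k _ =>
      (mF.1.mul (((mV k).1.mul (mh k)).sub ((mV k).2 _))).integrable,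
    integral_finsetSum _ fun k _ => ((mV k).1.mul (mF.2 _)).integrable]
  exact Finset.sum_congr rfl fun k _ =>
    (V.F k).isCylinder.integral_mul_divergence h𝓗 F.isCylinder (V.h k)

lemma norm_val_sq (ω : Ω) : ‖V.val ω‖ ^ 2 =
    ∑ k, ∑ l, (V.F k).val ω * (V.F l).val ω * inner ℝ (V.h k) (V.h l) :=
  norm_sum_smul_sq _ _ _

lemma trace_le_norm_D_sq (ω : Ω) :
    ∑ k, ∑ l, inner ℝ ((V.F k).D ω) (V.h l) * inner ℝ ((V.F l).D ω) (V.h k) ≤ ‖V.D ω‖ ^ 2 :=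
  sum_inner_mul_inner_le _ _ _

end ElementaryProcess

end Elementary

/-! ### `L²` bound for the divergence -/

section DivergenceBound

variable {Ω : Type*} [MeasurableSpace Ω] {P : Measure Ω} {𝓗 : Submodule ℝ (Lp ℝ 2 P)}

lemma eLpNorm_two_sq {E : Type*} [NormedAddCommGroup E] (f : Ω → E) :
    eLpNorm f 2 P ^ 2 = ∫⁻ ω, ‖f ω‖ₑ ^ 2 ∂P := by
  have := eLpNorm_nnreal_pow_eq_lintegral (μ := P) (f := f) (p := 2) (by norm_num)
  simpa using this

lemma ofReal_integral_le_lintegral_ofReal {f : Ω → ℝ} (hf : Integrable f P) :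
    ENNReal.ofReal (∫ ω, f ω ∂P) ≤ ∫⁻ ω, ENNReal.ofReal (f ω) ∂P := by
  rw [integral_eq_lintegral_pos_part_sub_lintegral_neg_part hf]
  refine (ENNReal.ofReal_le_ofReal (sub_le_self _ ENNReal.toReal_nonneg)).trans ?_
  exact ENNReal.ofReal_toReal_le

lemma ofReal_norm_sq {E : Type*} [NormedAddCommGroup E] (x : E) :
    ENNReal.ofReal (‖x‖ ^ 2) = ‖x‖ₑ ^ 2 := by
  rw [ENNReal.ofReal_pow (norm_nonneg _), ofReal_norm]

namespace ElementaryProcess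

variable (V W : ElementaryProcess 𝓗)

lemma stronglyMeasurable_val : StronglyMeasurable V.val :=
  Finset.stronglyMeasurable_fun_sum _ fun k _ =>
    (V.F k).measurable_val.stronglyMeasurable.smul_const (V.h k)

/-- Summing the covariances of the elementary divergences gives `E δ(V)² = E‖V‖² + E Tr(DV ∘ DV)`,
and the trace is at most `‖DV‖²`. -/
lemma eLpNorm_div_sq_le [IsProbabilityMeasure P] (h𝓗 : IsGaussianHilbert 𝓗) :
    eLpNorm V.div 2 P ^ 2 ≤ eLpNorm V.val 2 P ^ 2 + eLpNorm V.D 2 P ^ 2 := by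
  have mV := fun k => (V.F k).isCylinder.hasMoments h𝓗
  have mh := fun k => ((isCylinder_rv (V.h k)).hasMoments h𝓗).1
  have mG := fun k => ((mV k).1.mul (mh k)).sub ((mV k).2 (V.h k))
  set T : Ω → ℝ := fun ω => ∑ k, ∑ l, ((V.F k).val ω * (V.F l).val ω * inner ℝ (V.h k) (V.h l) +
    inner ℝ ((V.F k).D ω) (V.h l) * inner ℝ ((V.F l).D ω) (V.h k)) with hT
  have iT : ∀ k l, HasMoments (fun ω => (V.F k).val ω * (V.F l).val ω *
      inner ℝ (V.h k) (V.h l) +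
      inner ℝ ((V.F k).D ω) (V.h l) * inner ℝ ((V.F l).D ω) (V.h k)) P := fun k l =>
    (((mV k).1.mul (mV l).1).mul (hasMoments_const _)).add (((mV k).2 _).mul ((mV l).2 _))
  have e : ∫ ω, V.div ω ^ 2 ∂P = ∫ ω, T ω ∂P := by
    have e1 : ∀ ω, V.div ω ^ 2 =
        ∑ k, ∑ l, ((V.F k).val ω * rv (V.h k) ω - inner ℝ ((V.F k).D ω) (V.h k)) *
          ((V.F l).val ω * rv (V.h l) ω - inner ℝ ((V.F l).D ω) (V.h l)) := fun ω => by
      rw [sq, div, Finset.sum_mul_sum]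
    simp only [e1, hT]
    rw [integral_finsetSum _ fun k _ => (HasMoments.sum _ fun l => (mG k).mul (mG l)).integrable,
      integral_finsetSum _ fun k _ => (HasMoments.sum _ fun l => iT k l).integrable]
    refine Finset.sum_congr rfl fun k _ => ?_
    rw [integral_finsetSum _ fun l _ => ((mG k).mul (mG l)).integrable,
      integral_finsetSum _ fun l _ => (iT k l).integrable]
    refine Finset.sum_congr rfl fun l _ => ?_
    rw [(V.F k).isCylinder.integral_divergence_mul_divergence h𝓗 (V.F l).isCylinder
      (V.F l).isCylinder_D (V.F l).D2_comm (V.h k) (V.h l),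
      integral_add (((mV k).1.mul (mV l).1).mul (hasMoments_const _)).integrable
        (((mV k).2 _).mul ((mV l).2 _)).integrable, integral_mul_const]
  have hi : Integrable T P := (HasMoments.sum _ fun k => HasMoments.sum _ fun l => iT k l).integrable
  have hle : ∀ ω, T ω ≤ ‖V.val ω‖ ^ 2 + ‖V.D ω‖ ^ 2 := fun ω => by
    simp only [hT, Finset.sum_add_distrib]
    rw [norm_val_sq]
    exact add_le_add le_rfl (V.trace_le_norm_D_sq ω)
  have hd : eLpNorm V.div 2 P ^ 2 = ENNReal.ofReal (∫ ω, V.div ω ^ 2 ∂P) := by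
    rw [eLpNorm_two_sq, ofReal_integral_eq_lintegral_ofReal ((V.hasMoments_div h𝓗).pow 2).integrable
      (ae_of_all _ fun ω => sq_nonneg _)]
    refine lintegral_congr fun ω => ?_
    rw [← ofReal_norm_sq, Real.norm_eq_abs, sq_abs]
  rw [hd, e, eLpNorm_two_sq, eLpNorm_two_sq,
    ← lintegral_add_left (V.stronglyMeasurable_val.enorm.pow_const 2)]
  refine (ofReal_integral_le_lintegral_ofReal hi).trans (lintegral_mono fun ω => ?_)
  rw [← ofReal_norm_sq, ← ofReal_norm_sq, ← ENNReal.ofReal_add (by positivity) (by positivity)]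
  exact ENNReal.ofReal_le_ofReal (hle ω)

lemma eLpNorm_div_le [IsProbabilityMeasure P] (h𝓗 : IsGaussianHilbert 𝓗) :
    eLpNorm V.div 2 P ≤ eLpNorm V.val 2 P + eLpNorm V.D 2 P := by
  rw [← ENNReal.pow_le_pow_left_iff two_ne_zero]
  refine (V.eLpNorm_div_sq_le h𝓗).trans ?_
  rw [add_sq]
  gcongr
  exact le_self_add

end ElementaryProcess

/-- On a probability space `L²` convergence implies `L¹` convergence. In this form it serves for
integrands that depend on the converging sequence in a Lipschitz way, such as pairings with bounded
functionals and characters. -/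
lemma tendsto_integral_of_eLpNorm_two [IsProbabilityMeasure P] {E E' : Type*}
    [NormedAddCommGroup E] [NormedAddCommGroup E'] [NormedSpace ℝ E']
    {u : ℕ → Ω → E'} {v : Ω → E'} {f : ℕ → Ω → E} {C : ℝ} (hu : ∀ n, Integrable (u n) P)
    (hv : Integrable v P) (hf : ∀ n, AEStronglyMeasurable (f n) P)
    (h : ∀ n ω, ‖u n ω - v ω‖ ≤ C * ‖f n ω‖)
    (h0 : Tendsto (fun n => eLpNorm (f n) 2 P) atTop (𝓝 0)) :
    Tendsto (fun n => ∫ ω, u n ω ∂P) atTop (𝓝 (∫ ω, v ω ∂P)) := by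
  refine tendsto_integral_of_L1' v hv.1 (Eventually.of_forall hu) ?_
  have h1 : Tendsto (fun n => ENNReal.ofReal C * eLpNorm (f n) 2 P) atTop (𝓝 0) := by
    simpa using ENNReal.Tendsto.const_mul h0 (Or.inr ENNReal.ofReal_ne_top)
  refine tendsto_of_tendsto_of_tendsto_of_le_of_le tendsto_const_nhds h1 (fun _ => zero_le)
    fun n => ?_
  refine (eLpNorm_le_mul_eLpNorm_of_ae_le_mul (ae_of_all _ fun ω => h n ω) 1).trans ?_
  gcongr
  exact eLpNorm_le_eLpNorm_of_exponent_le (by norm_num) (hf n)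

namespace SmoothFunctional

variable (F : SmoothFunctional 𝓗)

lemma exists_bound_D : ∃ C, ∀ ω, ‖F.D ω‖ ≤ C := by
  obtain ⟨C, hC⟩ := F.exists_bound_fderiv
  refine ⟨∑ j, C * ‖(Pi.single j 1 : Fin F.n → ℝ)‖ * ‖F.φ j‖, fun ω => ?_⟩
  refine (norm_sum_le _ _).trans (Finset.sum_le_sum fun j _ => ?_)
  rw [norm_smul]
  gcongr
  exact (ContinuousLinearMap.le_opNorm _ _).trans (by gcongr; exact hC _)

lemma stronglyMeasurable_D : StronglyMeasurable F.D := by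
  refine Finset.stronglyMeasurable_fun_sum _ fun j _ => StronglyMeasurable.smul_const ?_ _
  refine Measurable.stronglyMeasurable ?_
  have hc : Continuous fun x => fderiv ℝ F.g x (Pi.single j 1) :=
    (F.smooth.continuous_fderiv (by simp)).clm_apply continuous_const
  exact hc.measurable.comp (measurable_pi_lambda _ fun _ => measurable_rv _)

end SmoothFunctional

/-- Elements of `𝔻^{1,2}` have a divergence, the limit of those of the approximations. -/
theorem exists_tendsto_div [IsProbabilityMeasure P] (h𝓗 : IsGaussianHilbert 𝓗) {U : Ω → 𝓗}
    {V : ℕ → ElementaryProcess 𝓗} (hU : MemLp U 2 P)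
    (h1 : Tendsto (fun n => eLpNorm (fun ω => (V n).val ω - U ω) 2 P) atTop (𝓝 0))
    (h2 : Tendsto (fun p : ℕ × ℕ => eLpNorm (fun ω => (V p.1).D ω - (V p.2).D ω) 2 P)
      (atTop ×ˢ atTop) (𝓝 0)) :
    ∃ G : Lp ℝ 2 P, Tendsto (fun n => eLpNorm (fun ω => (V n).div ω - G ω) 2 P) atTop (𝓝 0) ∧
      ∀ F : SmoothFunctional 𝓗,
        ∫ ω, F.val ω * G ω ∂P = ∫ ω, inner ℝ (F.D ω) (U ω) ∂P := by
  have mdiv := fun n => (V n).hasMoments_div h𝓗 2 (by simp)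
  have mval : ∀ n, AEStronglyMeasurable (fun ω => (V n).val ω - U ω) P := fun n =>
    (V n).stronglyMeasurable_val.aestronglyMeasurable.sub hU.1
  -- The difference of two divergences is the divergence of the difference, so the `L²` bound
  -- transfers the Cauchy property from the values and derivatives. No limit of the derivatives is
  -- needed.
  have hc : CauchySeq fun n => (mdiv n).toLp := by
    rw [EMetric.cauchySeq_iff]
    intro ε hε
    have h1' : Tendsto (fun p : ℕ × ℕ => eLpNorm (fun ω => (V p.1).val ω - U ω) 2 P +
        eLpNorm (fun ω => (V p.2).val ω - U ω) 2 P +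
        eLpNorm (fun ω => (V p.1).D ω - (V p.2).D ω) 2 P) (atTop ×ˢ atTop) (𝓝 0) := by
      simpa using ((h1.comp tendsto_fst).add (h1.comp tendsto_snd)).add h2
    rw [prod_atTop_atTop_eq] at h1'
    obtain ⟨⟨N, M⟩, hNM⟩ := eventually_atTop.1 (h1'.eventually (gt_mem_nhds hε))
    refine ⟨max N M, fun m hm n hn => ?_⟩
    refine lt_of_le_of_lt ?_ (hNM (m, n) ⟨(le_max_left _ _).trans hm, (le_max_right _ _).trans hn⟩)
    rw [Lp.edist_toLp_toLp]
    have e : eLpNorm ((V m).div - (V n).div) 2 P = eLpNorm ((V m).sub (V n)).div 2 P :=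
      eLpNorm_congr_ae ((V m).sub_div (V n)).symm
    rw [e]
    refine (ElementaryProcess.eLpNorm_div_le _ h𝓗).trans ?_
    rw [funext ((V m).sub_D (V n)), funext ((V m).sub_val (V n))]
    gcongr
    have e2 : (fun ω => (V m).val ω - (V n).val ω) =
        (fun ω => (V m).val ω - U ω) - fun ω => (V n).val ω - U ω := by
      ext1 ω; simp
    rw [e2]
    exact eLpNorm_sub_le (mval m) (mval n) (by norm_num)
  obtain ⟨G, hG⟩ := cauchySeq_tendsto_of_complete hc
  have hG' : Tendsto (fun n => eLpNorm (fun ω => (V n).div ω - G ω) 2 P) atTop (𝓝 0) := by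
    rw [Lp.tendsto_Lp_iff_tendsto_eLpNorm'] at hG
    refine hG.congr fun n => eLpNorm_congr_ae ?_
    filter_upwards [(mdiv n).coeFn_toLp] with ω hω
    rw [Pi.sub_apply, hω]
  refine ⟨G, hG', fun F => ?_⟩
  obtain ⟨C, hC⟩ := F.exists_bound_g
  obtain ⟨C', hC'⟩ := F.exists_bound_D
  have hb : ∀ ω, ‖F.val ω‖ ≤ C := fun ω => hC _
  have l1 : Tendsto (fun n => ∫ ω, F.val ω * (V n).div ω ∂P) atTop
      (𝓝 (∫ ω, F.val ω * G ω ∂P)) := by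
    refine tendsto_integral_of_eLpNorm_two (f := fun n ω => (V n).div ω - G ω) (C := C)
      (fun n => ?_) ?_ (fun n => (mdiv n).1.sub (Lp.aestronglyMeasurable G)) (fun n ω => ?_) hG'
    · exact ((V n).hasMoments_div h𝓗).integrable.bdd_mul F.measurable_val.aestronglyMeasurable
        (ae_of_all _ hb)
    · exact ((Lp.memLp G).integrable (by norm_num)).bdd_mul F.measurable_val.aestronglyMeasurable
        (ae_of_all _ hb)
    · rw [← mul_sub, norm_mul]
      exact mul_le_mul_of_nonneg_right (hb ω) (abs_nonneg _)
  have l2 : Tendsto (fun n => ∫ ω, inner ℝ (F.D ω) ((V n).val ω) ∂P) atTop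
      (𝓝 (∫ ω, inner ℝ (F.D ω) (U ω) ∂P)) := by
    have hint : ∀ U' : Ω → 𝓗, MemLp U' 2 P → Integrable (fun ω => inner ℝ (F.D ω) (U' ω)) P := by
      intro U' hU'
      refine ((hU'.integrable (by norm_num)).norm.const_mul C').mono'
        (F.stronglyMeasurable_D.aestronglyMeasurable.inner hU'.1) (ae_of_all _ fun ω => ?_)
      exact (norm_inner_le_norm (𝕜 := ℝ) _ _).trans
        (mul_le_mul_of_nonneg_right (hC' ω) (norm_nonneg _))
    have mval2 : ∀ n, MemLp (V n).val 2 P := fun n =>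
      memLp_finsetSum _ fun k _ =>
        ((((V n).F k).isCylinder.hasMoments h𝓗).1 2 (by simp)).of_le_mul (c := ‖(V n).h k‖)
          (((V n).F k).measurable_val.stronglyMeasurable.smul_const _).aestronglyMeasurable
          (ae_of_all _ fun ω => (norm_smul_le _ _).trans (mul_comm _ _).le)
    refine tendsto_integral_of_eLpNorm_two (f := fun n ω => (V n).val ω - U ω) (C := C')
      (fun n => hint _ (mval2 n)) (hint _ hU) mval (fun n ω => ?_) h1
    rw [← inner_sub_right]
    exact (norm_inner_le_norm (𝕜 := ℝ) _ _).trans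
        (mul_le_mul_of_nonneg_right (hC' ω) (norm_nonneg _))
  refine tendsto_nhds_unique l1 (l2.congr fun n => ((V n).integral_mul_div h𝓗 F).symm)

end DivergenceBound

/-! ### The covariance function of bifractional Brownian motion -/

section Covariance

/-- The two inner points are convex combinations of the two outer ones with interchanged weights;
the two convexity inequalities add up. -/
lemma ConvexOn.add_le_add_of_parallelogram {s : Set ℝ} {f : ℝ → ℝ} (hf : ConvexOn ℝ s f)
    {x δ η : ℝ} (hx : x ∈ s) (hx' : x + δ + η ∈ s) (hδ : 0 ≤ δ) (hη : 0 ≤ η) :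
    f (x + δ) + f (x + η) ≤ f x + f (x + δ + η) := by
  rcases (add_nonneg hδ hη).eq_or_lt with h | h
  · have h1 : δ = 0 := by linarith
    have h2 : η = 0 := by linarith
    simp [h1, h2]
  · have e : η / (δ + η) + δ / (δ + η) = 1 := by field_simp; ring
    have h1 := hf.2 hx hx' (div_nonneg hη h.le) (div_nonneg hδ h.le) e
    have h2 := hf.2 hx hx' (div_nonneg hδ h.le) (div_nonneg hη h.le) (by rw [add_comm, e])
    simp only [smul_eq_mul] at h1 h2
    have e1 : η / (δ + η) * x + δ / (δ + η) * (x + δ + η) = x + δ := by field_simp; ring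
    have e2 : δ / (δ + η) * x + η / (δ + η) * (x + δ + η) = x + η := by field_simp; ring
    rw [e1] at h1
    rw [e2] at h2
    calc f (x + δ) + f (x + η) ≤ (η / (δ + η) + δ / (δ + η)) * (f x + f (x + δ + η)) := by
          linarith
      _ = _ := by rw [e, one_mul]

/-- The increment of a function of two variables over a rectangle. -/
def rectIncr (f : ℝ → ℝ → ℝ) (u u' v v' : ℝ) : ℝ := f u' v' - f u' v - f u v' + f u v

lemma sum_rectIncr (f : ℝ → ℝ → ℝ) (s : ℕ → ℝ) (N : ℕ) :
    ∑ k ∈ Finset.range N, ∑ l ∈ Finset.range N, rectIncr f (s k) (s (k + 1)) (s l) (s (l + 1)) =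
      rectIncr f (s 0) (s N) (s 0) (s N) := by
  have h1 : ∀ k, ∑ l ∈ Finset.range N, rectIncr f (s k) (s (k + 1)) (s l) (s (l + 1)) =
      (f (s (k + 1)) (s N) - f (s (k + 1)) (s 0)) - (f (s k) (s N) - f (s k) (s 0)) := by
    intro k
    rw [← Finset.sum_range_sub fun l => f (s (k + 1)) (s l),
      ← Finset.sum_range_sub fun l => f (s k) (s l), ← Finset.sum_sub_distrib]
    exact Finset.sum_congr rfl fun l _ => by rw [rectIncr]; ring
  simp only [h1]
  rw [Finset.sum_range_sub fun k => f (s k) (s N) - f (s k) (s 0), rectIncr]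
  ring

variable {H K : ℝ}

/-- In the monotone variables `t^(2H)`, `s^(2H)` this is the parallelogram inequality for the
concave function `x^K`. -/
lemma rectIncr_add_rpow_nonpos (hH : 0 ≤ H) (hK : K ∈ Ioc (0 : ℝ) 1)
    {u u' v v' : ℝ} (hu : 0 ≤ u) (huu : u ≤ u') (hv : 0 ≤ v) (hvv : v ≤ v') :
    rectIncr (fun t s => (t ^ (2 * H) + s ^ (2 * H)) ^ K) u u' v v' ≤ 0 := by
  have hc := (Real.concaveOn_rpow hK.1.le hK.2).neg
  have h1 : u ^ (2 * H) ≤ u' ^ (2 * H) := Real.rpow_le_rpow hu huu (by linarith)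
  have h2 : v ^ (2 * H) ≤ v' ^ (2 * H) := Real.rpow_le_rpow hv hvv (by linarith)
  have h3 : 0 ≤ u ^ (2 * H) := Real.rpow_nonneg hu _
  have h4 : 0 ≤ v ^ (2 * H) := Real.rpow_nonneg hv _
  have := hc.add_le_add_of_parallelogram (x := u ^ (2 * H) + v ^ (2 * H))
    (δ := u' ^ (2 * H) - u ^ (2 * H)) (η := v' ^ (2 * H) - v ^ (2 * H))
    (by simp only [mem_Ici]; linarith) (by simp only [mem_Ici]; linarith) (by linarith)
    (by linarith)
  simp only [Pi.neg_apply] at this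
  rw [rectIncr]
  ring_nf at this ⊢
  linarith

lemma convexOn_abs_rpow {p : ℝ} (hp : 1 ≤ p) : ConvexOn ℝ univ fun x : ℝ => |x| ^ p := by
  refine ⟨convex_univ, fun x _ y _ a b ha hb hab => ?_⟩
  have h := (convexOn_rpow hp).2 (x := |x|) (abs_nonneg x) (y := |y|) (abs_nonneg y) ha hb hab
  refine le_trans (Real.rpow_le_rpow (abs_nonneg _) ?_ (by linarith)) h
  refine (abs_add_le _ _).trans ?_
  simp [abs_mul, abs_of_nonneg ha, abs_of_nonneg hb]

/-- The four differences form a parallelogram on the line with outer points `u - v'` and `u' - v`,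
so convexity of `|x|^p` decides the sign. -/
lemma rectIncr_abs_sub_rpow_nonpos {p : ℝ} (hp : 1 ≤ p) {u u' v v' : ℝ} (huu : u ≤ u')
    (hvv : v ≤ v') : rectIncr (fun t s => |t - s| ^ p) u u' v v' ≤ 0 := by
  have := (convexOn_abs_rpow hp).add_le_add_of_parallelogram (x := u - v') (δ := u' - u)
    (η := v' - v) (mem_univ _) (mem_univ _) (by linarith) (by linarith)
  rw [rectIncr]
  ring_nf at this ⊢
  linarith

/-- The planar variation of the covariance function is finite. -/
lemma exists_sum_abs_rectIncr_bifCov_le (hH : 0 ≤ H) (hK : K ∈ Ioc (0 : ℝ) 1)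
    (hHK : 1 < 2 * H * K) (t : ℝ) : ∃ C : ℝ, 0 ≤ C ∧ ∀ (s : ℕ → ℝ) (N : ℕ), Monotone s → s 0 = 0 →
      s N = t → ∑ k ∈ Finset.range N, ∑ l ∈ Finset.range N,
        |rectIncr (bifCov H K) (s k) (s (k + 1)) (s l) (s (l + 1))| ≤ C := by
  set A : ℝ → ℝ → ℝ := fun t s => (t ^ (2 * H) + s ^ (2 * H)) ^ K
  set D : ℝ → ℝ → ℝ := fun t s => |t - s| ^ (2 * H * K)
  set c : ℝ := 1 / 2 ^ K
  have hc : 0 ≤ c := by positivity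
  -- Both parts have nonpositive rectangular increments, so the absolute value of their difference
  -- is at most minus their sum. Summing over the grid telescopes to the increment over the whole
  -- square, whatever the partition. The maximum with `0` only secures `0 ≤ C` for arbitrary `t`.
  refine ⟨max 0 (-(c * rectIncr A 0 t 0 t) - c * rectIncr D 0 t 0 t), le_max_left _ _,
    fun s N hs h0 hN => ?_⟩
  have e : ∀ u u' v v', rectIncr (bifCov H K) u u' v v' =
      c * rectIncr A u u' v v' - c * rectIncr D u u' v v' := fun u u' v v' => by
    simp only [rectIncr, bifCov, A, D, c]; ring
  refine le_trans ?_ (le_max_right _ _)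
  have h : ∀ k l, |rectIncr (bifCov H K) (s k) (s (k + 1)) (s l) (s (l + 1))| ≤
      -c * rectIncr A (s k) (s (k + 1)) (s l) (s (l + 1)) -
        c * rectIncr D (s k) (s (k + 1)) (s l) (s (l + 1)) := by
    intro k l
    have hk : 0 ≤ s k := h0 ▸ hs (Nat.zero_le k)
    have hl : 0 ≤ s l := h0 ▸ hs (Nat.zero_le l)
    have h1 := rectIncr_add_rpow_nonpos hH hK hk (hs (Nat.le_succ k)) hl (hs (Nat.le_succ l))
    have h2 := rectIncr_abs_sub_rpow_nonpos hHK.le (hs (Nat.le_succ k)) (hs (Nat.le_succ l))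
    have h1' := mul_nonpos_of_nonneg_of_nonpos hc h1
    have h2' := mul_nonpos_of_nonneg_of_nonpos hc h2
    rw [e, abs_le]
    constructor <;> simp only [Nat.succ_eq_add_one, A, D] at * <;> linarith
  calc _ ≤ ∑ k ∈ Finset.range N, ∑ l ∈ Finset.range N,
        (-c * rectIncr A (s k) (s (k + 1)) (s l) (s (l + 1)) -
          c * rectIncr D (s k) (s (k + 1)) (s l) (s (l + 1))) :=
        Finset.sum_le_sum fun k _ => Finset.sum_le_sum fun l _ => h k l
    _ = _ := by
        simp only [Finset.sum_sub_distrib, ← Finset.mul_sum]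
        rw [sum_rectIncr, sum_rectIncr, h0, hN]
        ring

lemma bifCov_self {s : ℝ} (hs : 0 ≤ s) (hHK : 1 < 2 * H * K) :
    bifCov H K s s = s ^ (2 * H * K) := by
  rw [bifCov, sub_self, abs_zero, Real.zero_rpow (by linarith), sub_zero, ← two_mul,
    Real.mul_rpow (by norm_num) (Real.rpow_nonneg hs _), ← Real.rpow_mul hs]
  field_simp

lemma bifCov_comm (t s : ℝ) : bifCov H K t s = bifCov H K s t := by
  rw [bifCov, bifCov, add_comm, abs_sub_comm]

/-- Concavity gives `x^K + y^K ≤ 2^(1-K) (x + y)^K` for `x = s^(2H)` and `y = r^(2H)`. The sum terms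
therefore contribute at most zero, and `2^(1-K) |s - r|^(2HK)` is left. -/
lemma bifCov_increment_le (hK : K ∈ Ioc (0 : ℝ) 1)
    (hHK : 1 < 2 * H * K) {s r : ℝ} (hs : 0 ≤ s) (hr : 0 ≤ r) :
    bifCov H K s s + bifCov H K r r - 2 * bifCov H K s r ≤ 2 * |s - r| ^ (2 * H * K) := by
  rw [bifCov_self hs hHK, bifCov_self hr hHK, bifCov, Real.rpow_mul hs, Real.rpow_mul hr]
  set x := s ^ (2 * H)
  set y := r ^ (2 * H)
  have hx : 0 ≤ x := Real.rpow_nonneg hs _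
  have hy : 0 ≤ y := Real.rpow_nonneg hr _
  have hcc := Real.concaveOn_rpow hK.1.le hK.2
  have h := hcc.2 hx hy (show (0 : ℝ) ≤ 1 / 2 by norm_num) (show (0 : ℝ) ≤ 1 / 2 by norm_num)
    (by norm_num)
  simp only [smul_eq_mul] at h
  rw [← mul_add, ← mul_add, Real.mul_rpow (by norm_num) (by positivity), Real.div_rpow (by norm_num)
    (by norm_num), Real.one_rpow] at h
  have hz : 0 ≤ |s - r| ^ (2 * H * K) := by positivity
  have h2 : 1 / (2 : ℝ) ^ K ≤ 1 := by
    rw [div_le_one (by positivity)]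
    exact Real.one_le_rpow (by norm_num) hK.1.le
  nlinarith

lemma continuous_bifCov (hH : 0 ≤ H) (hK : 0 ≤ K) (s : ℝ) :
    Continuous fun w => bifCov H K s w := by
  unfold bifCov
  have h1 : 0 ≤ 2 * H := by linarith
  have h2 : 0 ≤ 2 * H * K := by positivity
  exact continuous_const.mul (((continuous_const.add
    (continuous_id.rpow_const fun _ => Or.inr h1)).rpow_const fun _ => Or.inr hK).sub
    ((continuous_const.sub continuous_id).abs.rpow_const fun _ => Or.inr h2))

/-- As `K ≤ 1`, dropping `s^(2H)` from the base of the power `K - 1` only increases it, and the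
first term is bounded by a multiple of `w^(2HK-1)`. The second is a multiple of `|s - w|^(2HK-1)`.
Both exponents are positive, so there is no singularity at the origin or on the diagonal. The
constant `8` is not sharp. -/
lemma exists_hasDerivAt_bifCov (hH : H ∈ Icc (0 : ℝ) 1) (hK : K ∈ Ioc (0 : ℝ) 1)
    (hHK : 1 < 2 * H * K) {T s w : ℝ} (hs : s ∈ Icc 0 T) (hw : w ∈ Ioc 0 T) :
    ∃ D, HasDerivAt (fun w => bifCov H K s w) D w ∧ |D| ≤ 8 * T ^ (2 * H * K - 1) := by
  have hw0 : 0 < w := hw.1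
  have hs0 : 0 ≤ s ^ (2 * H) := Real.rpow_nonneg hs.1 _
  have hw1 : 0 < w ^ (2 * H) := Real.rpow_pos_of_pos hw0 _
  have hT : 0 ≤ T := hs.1.trans hs.2
  have d1 : HasDerivAt (fun w : ℝ => (s ^ (2 * H) + w ^ (2 * H)) ^ K)
      ((2 * H * w ^ (2 * H - 1)) * K * (s ^ (2 * H) + w ^ (2 * H)) ^ (K - 1)) w :=
    ((Real.hasDerivAt_rpow_const (Or.inl hw0.ne')).const_add _).rpow_const
      (Or.inl (by positivity))
  have d2 : HasDerivAt (fun w : ℝ => |s - w| ^ (2 * H * K))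
      (2 * H * K * |s - w| ^ (2 * H * K - 2) * (s - w) * (-1)) w :=
    (hasDerivAt_abs_rpow (s - w) hHK).comp w ((hasDerivAt_id w).const_sub s)
  refine ⟨_, (d1.sub d2).const_mul (1 / 2 ^ K), ?_⟩
  have hp : 2 * H * K ≤ 2 := by nlinarith [hH.1, hH.2, hK.1, hK.2]
  have hc : 1 / (2 : ℝ) ^ K ≤ 1 := by
    rw [div_le_one (by positivity)]
    exact Real.one_le_rpow (by norm_num) hK.1.le
  have b1 : |2 * H * w ^ (2 * H - 1) * K * (s ^ (2 * H) + w ^ (2 * H)) ^ (K - 1)| ≤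
      2 * T ^ (2 * H * K - 1) := by
    rw [abs_of_nonneg (by have := hH.1; have := hK.1; positivity)]
    have h1 : (s ^ (2 * H) + w ^ (2 * H)) ^ (K - 1) ≤ (w ^ (2 * H)) ^ (K - 1) :=
      Real.rpow_le_rpow_of_nonpos hw1 (by linarith) (by linarith [hK.2])
    have h2 : w ^ (2 * H - 1) * (w ^ (2 * H)) ^ (K - 1) = w ^ (2 * H * K - 1) := by
      rw [← Real.rpow_mul hw0.le, ← Real.rpow_add hw0]
      ring_nf
    have h3 : w ^ (2 * H * K - 1) ≤ T ^ (2 * H * K - 1) :=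
      Real.rpow_le_rpow hw0.le hw.2 (by linarith)
    have h4 : 0 ≤ w ^ (2 * H - 1) := by positivity
    calc _ = 2 * H * K * (w ^ (2 * H - 1) * (s ^ (2 * H) + w ^ (2 * H)) ^ (K - 1)) := by ring
      _ ≤ 2 * H * K * (w ^ (2 * H - 1) * (w ^ (2 * H)) ^ (K - 1)) := by
          have := hH.1; have := hK.1; gcongr
      _ ≤ 2 * T ^ (2 * H * K - 1) := by
          rw [h2]
          exact mul_le_mul hp h3 (by positivity) (by norm_num)
  have b2 : |2 * H * K * |s - w| ^ (2 * H * K - 2) * (s - w) * (-1)| ≤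
      2 * T ^ (2 * H * K - 1) := by
    rw [abs_mul, abs_mul, abs_mul, abs_neg, abs_one, mul_one,
      abs_of_pos (show 0 < 2 * H * K by linarith), abs_of_nonneg (a := |s - w| ^ _) (by positivity)]
    have h1 : |s - w| ^ (2 * H * K - 2) * |s - w| = |s - w| ^ (2 * H * K - 1) := by
      rcases (abs_nonneg (s - w)).eq_or_lt with h | h
      · rw [← h, mul_zero, Real.zero_rpow (by linarith)]
      · conv_lhs => rw [← Real.rpow_one |s - w|, ← Real.rpow_mul h.le, ← Real.rpow_add h]
        ring_nf
    have h2 : |s - w| ^ (2 * H * K - 1) ≤ T ^ (2 * H * K - 1) :=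
      Real.rpow_le_rpow (abs_nonneg _)
        (abs_le.2 ⟨by linarith [hs.1, hw.2], by linarith [hs.2]⟩) (by linarith)
    rw [mul_assoc, h1]
    exact mul_le_mul hp h2 (by positivity) (by norm_num)
  rw [abs_mul, abs_of_nonneg (by positivity)]
  have hT' : 0 ≤ T ^ (2 * H * K - 1) := Real.rpow_nonneg hT _
  calc _ ≤ 1 * (2 * T ^ (2 * H * K - 1) + 2 * T ^ (2 * H * K - 1)) :=
        mul_le_mul hc ((abs_sub _ _).trans (add_le_add b1 b2)) (abs_nonneg _) zero_le_one
    _ ≤ _ := by linarith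

lemma intervalIntegrable_of_bound {g : ℝ → ℝ} {u v C : ℝ} (huv : u ≤ v)
    (hg : AEStronglyMeasurable g (volume.restrict (Ioc u v)))
    (h : ∀ w ∈ Ioc u v, |g w| ≤ C) : IntervalIntegrable g volume u v := by
  rw [intervalIntegrable_iff_integrableOn_Ioc_of_le huv]
  exact Integrable.mono' (integrable_const C) hg
    ((ae_restrict_iff' measurableSet_Ioc).2 (ae_of_all _ fun w hw => by simpa using h w hw))

lemma abs_deriv_bifCov_le (hH : H ∈ Icc (0 : ℝ) 1) (hK : K ∈ Ioc (0 : ℝ) 1)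
    (hHK : 1 < 2 * H * K) {T s w : ℝ} (hs : s ∈ Icc 0 T) (hw : w ∈ Ioc 0 T) :
    |deriv (fun w => bifCov H K s w) w| ≤ 8 * T ^ (2 * H * K - 1) := by
  obtain ⟨D, h1, h2⟩ := exists_hasDerivAt_bifCov hH hK hHK hs hw
  rwa [h1.deriv]

lemma intervalIntegrable_deriv_bifCov (hH : H ∈ Icc (0 : ℝ) 1) (hK : K ∈ Ioc (0 : ℝ) 1)
    (hHK : 1 < 2 * H * K) {T s u v : ℝ} (hs : s ∈ Icc 0 T) (hu : 0 ≤ u) (huv : u ≤ v)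
    (hv : v ≤ T) : IntervalIntegrable (deriv fun w => bifCov H K s w) volume u v :=
  intervalIntegrable_of_bound huv (measurable_deriv _).aestronglyMeasurable fun _ hw =>
    abs_deriv_bifCov_le hH hK hHK hs ⟨hu.trans_lt hw.1, hw.2.trans hv⟩

lemma integral_deriv_bifCov (hH : H ∈ Icc (0 : ℝ) 1) (hK : K ∈ Ioc (0 : ℝ) 1)
    (hHK : 1 < 2 * H * K) {T s u v : ℝ} (hs : s ∈ Icc 0 T) (hu : 0 ≤ u) (huv : u ≤ v)
    (hv : v ≤ T) :
    ∫ w in u..v, deriv (fun w => bifCov H K s w) w = bifCov H K s v - bifCov H K s u := by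
  refine intervalIntegral.integral_eq_sub_of_hasDerivAt_of_le huv
    (continuous_bifCov hH.1 hK.1.le s).continuousOn (fun w hw => ?_)
    (intervalIntegrable_deriv_bifCov hH hK hHK hs hu huv hv)
  obtain ⟨D, h1, -⟩ := exists_hasDerivAt_bifCov hH hK hHK hs
    (w := w) ⟨hu.trans_lt hw.1, hw.2.le.trans hv⟩
  exact h1.differentiableAt.hasDerivAt

end Covariance

/-! ### The Gaussian space of a bifractional Brownian motion -/

lemma measurable_processSigma {Ω : Type*} {d : ℕ} {T : ℝ} {B : Fin d → ℝ → Ω → ℝ} (i : Fin d)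
    {s : ℝ} (hs : s ∈ Icc 0 T) : Measurable[processSigma T B] (B i s) := by
  have h : MeasurableSpace.comap (B i s) inferInstance ≤ processSigma T B :=
    le_iSup_of_le i (le_iSup_of_le (⟨s, hs⟩ : Icc (0 : ℝ) T) le_rfl)
  exact Measurable.mono (comap_measurable (B i s)) h le_rfl

section GaussianSpace

variable {Ω : Type*} [MeasurableSpace Ω] {P : Measure Ω}

/-- The character `y ↦ exp(ity)` is Lipschitz with constant `|t|`, so the characteristic function at
`t` is continuous in the `L²` norm. -/
lemma isClosed_setOf_charFun [IsProbabilityMeasure P] (t : ℝ) :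
    IsClosed {Y : Lp ℝ 2 P | ∫ ω, Complex.exp (t * Y ω * Complex.I) ∂P =
      Complex.exp (-(‖Y‖ ^ 2 * t ^ 2 / 2 : ℝ))} := by
  refine isClosed_eq ?_ (by fun_prop)
  refine continuous_iff_seqContinuous.2 fun Y Z hYZ => ?_
  have hi : ∀ Y : Lp ℝ 2 P, Integrable (fun ω => Complex.exp (t * Y ω * Complex.I)) P := by
    intro Y
    have hm : Measurable (Y : Ω → ℝ) := (Lp.stronglyMeasurable Y).measurable
    refine (integrable_const (1 : ℝ)).mono' (by fun_prop) (ae_of_all _ fun ω => ?_)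
    rw [← Complex.ofReal_mul, Complex.norm_exp_ofReal_mul_I]
  rw [Lp.tendsto_Lp_iff_tendsto_eLpNorm'] at hYZ
  refine tendsto_integral_of_eLpNorm_two (f := fun n => (Y n : Ω → ℝ) - (Z : Ω → ℝ)) (C := |t|)
    (fun n => hi _) (hi _) (fun n => (Lp.aestronglyMeasurable _).sub (Lp.aestronglyMeasurable _))
    (fun n ω => ?_) hYZ
  have e : Complex.exp (t * Y n ω * Complex.I) - Complex.exp (t * Z ω * Complex.I) =
      Complex.exp (t * Z ω * Complex.I) *
        (Complex.exp (Complex.I * ((t * Y n ω - t * Z ω : ℝ) : ℂ)) - 1) := by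
    rw [mul_sub, ← Complex.exp_add]
    push_cast
    ring_nf
  rw [e, norm_mul, ← Complex.ofReal_mul, Complex.norm_exp_ofReal_mul_I, one_mul]
  refine (Real.norm_exp_I_mul_ofReal_sub_one_le).trans ?_
  rw [← mul_sub, norm_mul]
  simp

/-- This expresses centered Gaussianity as a family of closed conditions on `L²`, so that it
survives passage to the closed span. -/
lemma hasGaussianLaw_iff_charFun [IsProbabilityMeasure P] (Y : Lp ℝ 2 P) :
    (HasGaussianLaw Y P ∧ ∫ ω, Y ω ∂P = 0) ↔ ∀ t : ℝ,
      ∫ ω, Complex.exp (t * Y ω * Complex.I) ∂P = Complex.exp (-(‖Y‖ ^ 2 * t ^ 2 / 2 : ℝ)) := by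
  have hm : AEMeasurable (Y : Ω → ℝ) P := (Lp.stronglyMeasurable Y).measurable.aemeasurable
  have e : ∀ t : ℝ, charFun (P.map Y) t = ∫ ω, Complex.exp (t * Y ω * Complex.I) ∂P := by
    intro t
    rw [charFun_apply_real, integral_map hm (by fun_prop)]
  have e2 : ∀ t : ℝ, charFun (gaussianReal 0 (‖Y‖ ^ 2).toNNReal) t =
      Complex.exp (-(‖Y‖ ^ 2 * t ^ 2 / 2 : ℝ)) := by
    intro t
    rw [charFun_gaussianReal, Real.coe_toNNReal _ (by positivity)]
    push_cast
    ring_nf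
  constructor
  · rintro ⟨h1, h2⟩ t
    have hv : Var[Y; P] = ‖Y‖ ^ 2 := by
      rw [variance_of_integral_eq_zero hm h2, ← real_inner_self_eq_norm_sq, L2.inner_def]
      simp [sq]
    rw [← e, h1.map_eq_gaussianReal, h2, hv, e2]
  · intro h
    have h3 : P.map Y = gaussianReal 0 (‖Y‖ ^ 2).toNNReal := by
      have : IsProbabilityMeasure (P.map Y) := Measure.isProbabilityMeasure_map hm
      refine Measure.ext_of_charFun (funext fun t => ?_)
      rw [e, h, e2]
    refine ⟨⟨by rw [h3]; infer_instance⟩, ?_⟩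
    have h4 := integral_map hm (f := fun x : ℝ => x) (by fun_prop)
    rw [← h4, h3, integral_id_gaussianReal]

lemma covariance_congr_ae {X X' Y Y' : Ω → ℝ} (hX : X =ᵐ[P] X') (hY : Y =ᵐ[P] Y') :
    cov[X, Y; P] = cov[X', Y'; P] := by
  rw [covariance, covariance, integral_congr_ae hX, integral_congr_ae hY]
  refine integral_congr_ae ?_
  filter_upwards [hX, hY] with ω h1 h2
  rw [h1, h2]

variable {d : ℕ} {T : ℝ} {H K : Fin d → ℝ} {B : Fin d → ℝ → Ω → ℝ}

lemma IsMultiBifBm.hasGaussianLaw_sum [IsProbabilityMeasure P] (hB : IsMultiBifBm T H K B P)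
    (s : Finset (Icc (0 : ℝ) T)) (c : Fin d → Icc (0 : ℝ) T → ℝ) :
    HasGaussianLaw (fun ω => ∑ i, ∑ r ∈ s, c i r * B i r ω) P ∧
      ∫ ω, ∑ i, ∑ r ∈ s, c i r * B i r ω ∂P = 0 := by
  have hint : ∀ i (r : Icc (0 : ℝ) T), Integrable (B i r) P := fun i r =>
    ((hB.component i).gaussian.hasGaussianLaw_eval r).integrable
  constructor
  · have hg : ∀ i, HasGaussianLaw (fun ω => ∑ r ∈ s, c i r * B i r ω) P := fun i =>
      ((hB.component i).gaussian.smul (c i)).hasGaussianLaw_fun_sum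
    have hi := hB.indep.comp (fun i (x : Icc (0 : ℝ) T → ℝ) => ∑ r ∈ s, c i r * x r)
      (fun i => Finset.measurable_fun_sum _ fun r _ => (measurable_pi_apply r).const_mul _)
    exact iIndepFun.hasGaussianLaw_fun_sum hg hi
  · rw [integral_finsetSum _ fun i _ => integrable_finsetSum _ fun r _ =>
      (hint i r).const_mul _]
    refine Finset.sum_eq_zero fun i _ => ?_
    rw [integral_finsetSum _ fun r _ => (hint i r).const_mul _]
    refine Finset.sum_eq_zero fun r _ => ?_
    rw [integral_const_mul, (hB.component i).centered r r.2, mul_zero]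

/-- Finite linear combinations of the process are centered Gaussian, by Gaussianity within each
component and independence between them. This property is closed in `L²`, so it extends to the
closed span. -/
lemma IsMultiBifBm.isGaussianHilbert [IsProbabilityMeasure P] (hB : IsMultiBifBm T H K B P) :
    IsGaussianHilbert (gaussianSpace T B P) := by
  classical
  -- The coefficients vanish off the finite set of times, so two combinations can be rewritten over
  -- the union of their time sets and added.
  let M : Submodule ℝ (Lp ℝ 2 P) :=
    { carrier := {Y | ∃ (s : Finset (Icc (0 : ℝ) T)) (c : Fin d → Icc (0 : ℝ) T → ℝ),
        (∀ i, ∀ r ∉ s, c i r = 0) ∧ (Y : Ω → ℝ) =ᵐ[P] fun ω => ∑ i, ∑ r ∈ s, c i r * B i r ω}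
      zero_mem' := ⟨∅, fun _ _ => 0, by simp, by simpa using! Lp.coeFn_zero ℝ 2 P⟩
      add_mem' := by
        rintro Y Z ⟨s, c, hc, hY⟩ ⟨s', c', hc', hZ⟩
        refine ⟨s ∪ s', c + c', fun i r hr => ?_, ?_⟩
        · simp only [Finset.mem_union, not_or] at hr
          simp [hc i r hr.1, hc' i r hr.2]
        · filter_upwards [Lp.coeFn_add Y Z, hY, hZ] with ω h1 h2 h3
          rw [h1, Pi.add_apply, h2, h3, ← Finset.sum_add_distrib]
          refine Finset.sum_congr rfl fun i _ => ?_
          rw [Finset.sum_subset (Finset.subset_union_left (s₁ := s) (s₂ := s'))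
              fun r _ hr => by rw [hc i r hr, zero_mul],
            Finset.sum_subset (Finset.subset_union_right (s₁ := s) (s₂ := s'))
              fun r _ hr => by rw [hc' i r hr, zero_mul], ← Finset.sum_add_distrib]
          exact Finset.sum_congr rfl fun r _ => by simp [add_mul]
      smul_mem' := by
        rintro a Y ⟨s, c, hc, hY⟩
        refine ⟨s, a • c, fun i r hr => by simp [hc i r hr], ?_⟩
        filter_upwards [Lp.coeFn_smul a Y, hY] with ω h1 h2
        rw [h1, Pi.smul_apply, h2, smul_eq_mul, Finset.mul_sum]
        refine Finset.sum_congr rfl fun i _ => ?_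
        rw [Finset.mul_sum]
        exact Finset.sum_congr rfl fun r _ => by simp [mul_assoc] }
  have h1 : Submodule.span ℝ {Y : Lp ℝ 2 P | ∃ i, ∃ t ∈ Icc 0 T, (Y : Ω → ℝ) =ᵐ[P] B i t} ≤ M := by
    rw [Submodule.span_le]
    rintro Y ⟨i, t, ht, hY⟩
    refine ⟨{⟨t, ht⟩}, fun j r => if j = i ∧ r = ⟨t, ht⟩ then 1 else 0, fun j r hr => ?_, ?_⟩
    · simp only [Finset.mem_singleton] at hr
      simp [hr]
    · filter_upwards [hY] with ω hω
      simp [hω]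
  set S : Set (Lp ℝ 2 P) := {Y | HasGaussianLaw Y P ∧ ∫ ω, Y ω ∂P = 0} with hS
  have hclosed : IsClosed S := by
    have : S = ⋂ t : ℝ, {Y : Lp ℝ 2 P | ∫ ω, Complex.exp (t * Y ω * Complex.I) ∂P =
        Complex.exp (-(‖Y‖ ^ 2 * t ^ 2 / 2 : ℝ))} := by
      ext Y
      simp only [hS, mem_ofPred_eq, mem_iInter]
      exact hasGaussianLaw_iff_charFun Y
    rw [this]
    exact isClosed_iInter isClosed_setOf_charFun
  have h2 : (M : Set (Lp ℝ 2 P)) ⊆ S := by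
    rintro Y ⟨s, c, -, hY⟩
    obtain ⟨h3, h4⟩ := hB.hasGaussianLaw_sum s c
    exact ⟨h3.congr hY.symm, (integral_congr_ae hY).trans h4⟩
  intro Y
  have hY : (Y : Lp ℝ 2 P) ∈ closure (Submodule.span ℝ
      {Y : Lp ℝ 2 P | ∃ i, ∃ t ∈ Icc 0 T, (Y : Ω → ℝ) =ᵐ[P] B i t} : Set (Lp ℝ 2 P)) := Y.2
  exact closure_minimal (Subset.trans (SetLike.coe_subset_coe.2 h1) h2) hclosed hY

lemma IsMultiBifBm.hasMoments [IsProbabilityMeasure P] (hB : IsMultiBifBm T H K B P) (i : Fin d)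
    {s : ℝ} (hs : s ∈ Icc 0 T) : HasMoments (B i s) P := fun _ hp =>
  ((hB.component i).gaussian.hasGaussianLaw_eval ⟨s, hs⟩).memLp hp

open scoped Classical in
/-- The element `1_[0,s]` of the canonical Hilbert space of the `i`-th component. -/
def timeVec (T : ℝ) (B : Fin d → ℝ → Ω → ℝ) (P : Measure Ω) (i : Fin d) (s : ℝ) :
    gaussianSpace T B P :=
  if h : s ∈ Icc 0 T ∧ MemLp (B i s) 2 P then
    ⟨h.2.toLp, Submodule.le_topologicalClosure _
      (Submodule.subset_span ⟨i, s, h.1, h.2.coeFn_toLp⟩)⟩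
  -- A default value; for a bifractional Brownian motion it is reached only at times outside `[0,
  -- T]`.
  else 0

lemma IsMultiBifBm.rv_timeVec [IsProbabilityMeasure P] (hB : IsMultiBifBm T H K B P) (i : Fin d)
    {s : ℝ} (hs : s ∈ Icc 0 T) : rv (timeVec T B P i s) =ᵐ[P] B i s := by
  have h : s ∈ Icc 0 T ∧ MemLp (B i s) 2 P := ⟨hs, hB.hasMoments i hs 2 (by simp)⟩
  rw [timeVec, dif_pos h]
  exact h.2.coeFn_toLp

lemma timeVec_mem_componentSpace (i : Fin d) (s : ℝ) :
    (timeVec T B P i s : Lp ℝ 2 P) ∈ componentSpace T (B i) P := by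
  rw [timeVec]
  split_ifs with h
  · exact Submodule.le_topologicalClosure _
      (Submodule.subset_span ⟨(), s, h.1, h.2.coeFn_toLp⟩)
  · exact Submodule.zero_mem _

lemma IsMultiBifBm.inner_timeVec [IsProbabilityMeasure P] (hB : IsMultiBifBm T H K B P)
    (i : Fin d) {s r : ℝ} (hs : s ∈ Icc 0 T) (hr : r ∈ Icc 0 T) :
    inner ℝ (timeVec T B P i s) (timeVec T B P i r) = bifCov (H i) (K i) s r := by
  rw [← (hB.component i).covariance s hs r hr, ← hB.isGaussianHilbert.cov_eq]
  exact covariance_congr_ae (hB.rv_timeVec i hs) (hB.rv_timeVec i hr)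

lemma IsMultiBifBm.inner_timeVec_of_ne [IsProbabilityMeasure P] (hB : IsMultiBifBm T H K B P)
    {i j : Fin d} (hij : i ≠ j) {s r : ℝ} (hs : s ∈ Icc 0 T) (hr : r ∈ Icc 0 T) :
    inner ℝ (timeVec T B P i s) (timeVec T B P j r) = 0 := by
  rw [← hB.isGaussianHilbert.cov_eq,
    covariance_congr_ae (hB.rv_timeVec i hs) (hB.rv_timeVec j hr)]
  have hm : ∀ r : Icc (0 : ℝ) T, Measurable fun x : Icc (0 : ℝ) T → ℝ => x r :=
    fun r => measurable_pi_apply r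
  have hind : IndepFun (B i s) (B j r) P :=
    (hB.indep.indepFun hij).comp (hm ⟨s, hs⟩) (hm ⟨r, hr⟩)
  exact hind.covariance_eq_zero (hB.hasMoments i hs 2 (by simp)) (hB.hasMoments j hr 2 (by simp))

lemma IsMultiBifBm.processSigma_le (hB : IsMultiBifBm T H K B P) :
    processSigma T B ≤ ‹MeasurableSpace Ω› :=
  iSup_le fun i => iSup_le fun t => ((hB.component i).measurable t t.2).comap_le

lemma IsMultiBifBm.norm_sub_timeVec_sq_le [IsProbabilityMeasure P] (hB : IsMultiBifBm T H K B P)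
    (hK : ∀ i, K i ∈ Ioc (0 : ℝ) 1) (hHK : ∀ i, 1 < 2 * H i * K i)
    (i : Fin d) {s r : ℝ} (hs : s ∈ Icc 0 T) (hr : r ∈ Icc 0 T) :
    ‖timeVec T B P i s - timeVec T B P i r‖ ^ 2 ≤ 2 * |s - r| ^ (2 * H i * K i) := by
  rw [norm_sub_sq_real, ← real_inner_self_eq_norm_sq (timeVec T B P i s),
    ← real_inner_self_eq_norm_sq (timeVec T B P i r), hB.inner_timeVec i hs hs,
    hB.inner_timeVec i hr hr, hB.inner_timeVec i hs hr]
  linarith [bifCov_increment_le (hK i) (hHK i) hs.1 hr.1]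

end GaussianSpace

/-! ### Dyadic partitions and Riemann sums in tensor products -/

section Dyadic

/-- The dyadic points of `[0, t]`. -/
def dyadic (t : ℝ) (n k : ℕ) : ℝ := t * k / 2 ^ n

lemma dyadic_zero (t : ℝ) (n : ℕ) : dyadic t n 0 = 0 := by simp [dyadic]

lemma dyadic_last (t : ℝ) (n : ℕ) : dyadic t n (2 ^ n) = t := by simp [dyadic]

lemma dyadic_mono {t : ℝ} (ht : 0 ≤ t) (n : ℕ) : Monotone (dyadic t n) := fun a b hab => by
  have : (a : ℝ) ≤ b := by exact_mod_cast hab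
  unfold dyadic
  gcongr

lemma dyadic_mem {t : ℝ} (ht : 0 ≤ t) {n k : ℕ} (hk : k ≤ 2 ^ n) : dyadic t n k ∈ Icc 0 t :=
  ⟨(dyadic_zero t n).symm.trans_le (dyadic_mono ht n (Nat.zero_le k)),
    (dyadic_mono ht n hk).trans (dyadic_last t n).le⟩

lemma dyadic_succ_sub (t : ℝ) (n k : ℕ) : dyadic t n (k + 1) - dyadic t n k = t / 2 ^ n := by
  simp only [dyadic]; push_cast; ring

lemma dyadic_two_mul (t : ℝ) (n k : ℕ) : dyadic t (n + 1) (2 * k) = dyadic t n k := by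
  simp only [dyadic]; push_cast; rw [pow_succ]; field_simp

lemma dyadic_mul_pow (t : ℝ) (n m k : ℕ) : dyadic t (n + m) (k * 2 ^ m) = dyadic t n k := by
  simp only [dyadic]; push_cast; rw [pow_add]; field_simp

/-- A dyadic point and the preceding point of a coarser partition. -/
lemma abs_dyadic_div_sub_le {t : ℝ} (ht : 0 ≤ t) (n m l : ℕ) :
    |dyadic t n (l / 2 ^ m) - dyadic t (n + m) l| ≤ t / 2 ^ n := by
  have h1 : l / 2 ^ m * 2 ^ m ≤ l := Nat.div_mul_le_self _ _
  have h2 : l ≤ (l / 2 ^ m + 1) * 2 ^ m := by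
    have := Nat.lt_div_mul_add (a := l) (b := 2 ^ m) (by positivity)
    rw [add_mul, one_mul]; exact this.le
  have h3 := dyadic_mono ht (n + m) h1
  have h4 := dyadic_mono ht (n + m) h2
  rw [dyadic_mul_pow] at h3 h4
  rw [abs_sub_comm, abs_of_nonneg (by linarith), ← dyadic_succ_sub t n (l / 2 ^ m)]
  linarith

lemma tendsto_div_two_pow (t : ℝ) : Tendsto (fun n : ℕ => t / 2 ^ n) atTop (𝓝 0) := by
  have h := (tendsto_pow_atTop_nhds_zero_of_lt_one (r := (1 / 2 : ℝ)) (by norm_num)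
    (by norm_num)).const_mul t
  rw [mul_zero] at h
  refine h.congr fun n => ?_
  rw [one_div, inv_pow]; rfl

/-- The increments of `e` along the dyadic partition. -/
def incr {F : Type*} [Sub F] (e : ℝ → F) (t : ℝ) (n k : ℕ) : F :=
  e (dyadic t n (k + 1)) - e (dyadic t n k)

lemma Finset.sum_range_two_mul {M : Type*} [AddCommMonoid M] (f : ℕ → M) (N : ℕ) :
    ∑ l ∈ Finset.range (2 * N), f l =
      ∑ k ∈ Finset.range N, (f (2 * k) + f (2 * k + 1)) := by
  induction N with
  | zero => simp
  | succ N ih => rw [Finset.sum_range_succ, ← ih, mul_add, mul_one, Finset.sum_range_succ,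
      Finset.sum_range_succ, add_assoc]

/-- A coarse increment is the sum of the finer ones it contains, and `l / 2 ^ m` is the coarse index
above the fine index `l`. Riemann sums of two levels can thus be compared term by term on the finer
partition. -/
lemma sum_incr_refine {F M : Type*} [AddCommGroup F] [AddCommMonoid M] (e : ℝ → F) (t : ℝ)
    (β : ℕ → F → M) (hβ : ∀ k x y, β k (x + y) = β k x + β k y) (n m : ℕ) :
    ∑ k ∈ Finset.range (2 ^ n), β k (incr e t n k) =
      ∑ l ∈ Finset.range (2 ^ (n + m)), β (l / 2 ^ m) (incr e t (n + m) l) := by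
  induction m with
  | zero => simp
  | succ m ih =>
    rw [ih, ← add_assoc, pow_succ' 2 (n + m), Finset.sum_range_two_mul]
    refine Finset.sum_congr rfl fun l _ => ?_
    have h1 : 2 * l / 2 ^ (m + 1) = l / 2 ^ m := by
      rw [pow_succ', Nat.mul_div_mul_left _ _ (by norm_num)]
    have h2 : (2 * l + 1) / 2 ^ (m + 1) = l / 2 ^ m := by
      rw [pow_succ', ← Nat.div_div_eq_div_mul]
      congr 1
      omega
    rw [h1, h2, ← hβ]
    congr 1
    have h3 : 2 * l + 1 + 1 = 2 * (l + 1) := by ring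
    simp only [incr]
    rw [h3, dyadic_two_mul, dyadic_two_mul]
    abel

end Dyadic

/-! ### Schur bounds for sums weighted by inner products -/

section TensorBound

variable {ι : Type*} (s : Finset ι)

/-- Schur's test: `2 x_k x_l ≤ x_k² + x_l²`, and the two halves are equal by symmetry of `c`. -/
lemma sum_mul_mul_le (x : ι → ℝ) (c : ι → ι → ℝ) (hc : ∀ k l, 0 ≤ c k l)
    (hs : ∀ k l, c k l = c l k) :
    ∑ k ∈ s, ∑ l ∈ s, x k * x l * c k l ≤ ∑ k ∈ s, x k ^ 2 * ∑ l ∈ s, c k l := by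
  have h1 : ∑ k ∈ s, ∑ l ∈ s, x k * x l * c k l ≤
      ∑ k ∈ s, ∑ l ∈ s, (x k ^ 2 * c k l / 2 + x l ^ 2 * c l k / 2) := by
    refine Finset.sum_le_sum fun k _ => Finset.sum_le_sum fun l _ => ?_
    rw [hs l k]
    nlinarith [hc k l, mul_nonneg (hc k l) (sq_nonneg (x k - x l))]
  refine h1.trans (le_of_eq ?_)
  simp only [Finset.sum_add_distrib]
  rw [Finset.sum_comm (f := fun k l => x l ^ 2 * c l k / 2), ← Finset.sum_add_distrib]
  refine Finset.sum_congr rfl fun k _ => ?_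
  rw [← Finset.sum_add_distrib, Finset.mul_sum]
  exact Finset.sum_congr rfl fun l _ => by ring

variable {E F : Type*} [NormedAddCommGroup E] [InnerProductSpace ℝ E] [NormedAddCommGroup F]
  [InnerProductSpace ℝ F]

/-- The weights `∑ₗ |⟨b_k, b_l⟩|` have as total the planar variation of the integrator. Uniformly
small coefficients therefore give a small sum, independently of the number of terms. -/
lemma norm_sum_tmul_sq_le (a : ι → E) (b : ι → F) :
    ‖∑ k ∈ s, a k ⊗ₜ[ℝ] b k‖ ^ 2 ≤ ∑ k ∈ s, ‖a k‖ ^ 2 * ∑ l ∈ s, |inner ℝ (b k) (b l)| := by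
  rw [norm_sum_tmul_sq]
  refine le_trans (Finset.sum_le_sum fun k _ => Finset.sum_le_sum fun l _ => ?_)
    (sum_mul_mul_le s (fun k => ‖a k‖) (fun k l => |inner ℝ (b k) (b l)|)
      (fun _ _ => abs_nonneg _) fun k l => by rw [real_inner_comm])
  refine (le_abs_self _).trans ?_
  rw [abs_mul]
  exact mul_le_mul_of_nonneg_right (abs_real_inner_le_norm _ _) (abs_nonneg _)

/-- The scalar case of the tensor bound, through the isometry `ℝ ⊗ F ≃ F`. -/
lemma norm_sum_smul_sq_le (a : ι → ℝ) (b : ι → F) :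
    ‖∑ k ∈ s, a k • b k‖ ^ 2 ≤ ∑ k ∈ s, ‖a k‖ ^ 2 * ∑ l ∈ s, |inner ℝ (b k) (b l)| := by
  have h := norm_sum_tmul_sq_le s a b
  rw [← TensorProduct.norm_lid, map_sum] at h
  simpa only [TensorProduct.lid_tmul] using h

lemma norm_sum_smul_le {a : ι → ℝ} {b : ι → F} {C ε : ℝ} (hε : 0 ≤ ε)
    (hC : ∑ k ∈ s, ∑ l ∈ s, |inner ℝ (b k) (b l)| ≤ C) (ha : ∀ k ∈ s, |a k| ≤ ε) :
    ‖∑ k ∈ s, a k • b k‖ ≤ √C * ε := by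
  have h : ‖∑ k ∈ s, a k • b k‖ ^ 2 ≤ C * ε ^ 2 := by
    refine (norm_sum_smul_sq_le s a b).trans ?_
    refine le_trans (Finset.sum_le_sum fun k hk => mul_le_mul_of_nonneg_right
      (pow_le_pow_left₀ (norm_nonneg _) (ha k hk) 2)
      (Finset.sum_nonneg fun l _ => abs_nonneg _)) ?_
    rw [← Finset.mul_sum, mul_comm]
    gcongr
  have hC0 : 0 ≤ C := (Finset.sum_nonneg fun k _ => Finset.sum_nonneg fun l _ =>
    abs_nonneg _).trans hC
  rw [← Real.sqrt_sq hε, ← Real.sqrt_mul hC0]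
  exact Real.le_sqrt_of_sq_le h

variable {Ω : Type*} [MeasurableSpace Ω] {P : Measure Ω}

lemma eLpNorm_two_le_of_sq_le {G : Type*} [NormedAddCommGroup G] {Y : Ω → G} {a : ι → Ω → E}
    {w : ι → ℝ} {C : ℝ} {ε : ℝ≥0∞} (ha : ∀ k ∈ s, AEStronglyMeasurable (a k) P)
    (hw : ∀ k, 0 ≤ w k) (hC : ∑ k ∈ s, w k ≤ C) (hε : ∀ k ∈ s, eLpNorm (a k) 2 P ≤ ε)
    (hY : ∀ ω, ‖Y ω‖ ^ 2 ≤ ∑ k ∈ s, ‖a k ω‖ ^ 2 * w k) :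
    eLpNorm Y 2 P ≤ ENNReal.ofReal √C * ε := by
  have hC0 : 0 ≤ C := (Finset.sum_nonneg fun k _ => hw k).trans hC
  rw [← ENNReal.pow_le_pow_left_iff two_ne_zero, mul_pow, ← ENNReal.ofReal_pow (Real.sqrt_nonneg _),
    Real.sq_sqrt hC0, eLpNorm_two_sq]
  calc ∫⁻ ω, ‖Y ω‖ₑ ^ 2 ∂P ≤ ∫⁻ ω, ∑ k ∈ s, ‖a k ω‖ₑ ^ 2 * ENNReal.ofReal (w k) ∂P := by
        refine lintegral_mono fun ω => ?_
        rw [← ofReal_norm_sq]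
        refine (ENNReal.ofReal_le_ofReal (hY ω)).trans (le_of_eq ?_)
        rw [ENNReal.ofReal_sum_of_nonneg fun k _ => mul_nonneg (sq_nonneg _) (hw k)]
        refine Finset.sum_congr rfl fun k _ => ?_
        rw [ENNReal.ofReal_mul (sq_nonneg _), ofReal_norm_sq]
    _ = ∑ k ∈ s, eLpNorm (a k) 2 P ^ 2 * ENNReal.ofReal (w k) := by
        rw [lintegral_finsetSum' _ fun k hk => ((ha k hk).enorm.pow_const 2).mul_const _]
        refine Finset.sum_congr rfl fun k hk => ?_
        rw [lintegral_mul_const'' _ ((ha k hk).enorm.pow_const 2), eLpNorm_two_sq]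
    _ ≤ ∑ k ∈ s, ε ^ 2 * ENNReal.ofReal (w k) := by
        refine Finset.sum_le_sum fun k hk => ?_
        gcongr
        exact hε k hk
    _ = ENNReal.ofReal (∑ k ∈ s, w k) * ε ^ 2 := by
        rw [← Finset.mul_sum, ENNReal.ofReal_sum_of_nonneg fun k _ => hw k, mul_comm]
    _ ≤ _ := by gcongr

lemma eLpNorm_sum_tmul_le {a : ι → Ω → E} {b : ι → F} {C : ℝ} {ε : ℝ≥0∞}
    (ha : ∀ k ∈ s, AEStronglyMeasurable (a k) P)
    (hC : ∑ k ∈ s, ∑ l ∈ s, |inner ℝ (b k) (b l)| ≤ C) (hε : ∀ k ∈ s, eLpNorm (a k) 2 P ≤ ε) :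
    eLpNorm (fun ω => ∑ k ∈ s, a k ω ⊗ₜ[ℝ] b k) 2 P ≤ ENNReal.ofReal √C * ε :=
  eLpNorm_two_le_of_sq_le s ha (fun _ => Finset.sum_nonneg fun _ _ => abs_nonneg _) hC hε
    fun ω => norm_sum_tmul_sq_le s (fun k => a k ω) b

lemma eLpNorm_sum_smul_le {a : ι → Ω → ℝ} {b : ι → F} {C : ℝ} {ε : ℝ≥0∞}
    (ha : ∀ k ∈ s, AEStronglyMeasurable (a k) P)
    (hC : ∑ k ∈ s, ∑ l ∈ s, |inner ℝ (b k) (b l)| ≤ C) (hε : ∀ k ∈ s, eLpNorm (a k) 2 P ≤ ε) :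
    eLpNorm (fun ω => ∑ k ∈ s, a k ω • b k) 2 P ≤ ENNReal.ofReal √C * ε :=
  eLpNorm_two_le_of_sq_le s ha (fun _ => Finset.sum_nonneg fun _ _ => abs_nonneg _) hC hε
    fun ω => norm_sum_smul_sq_le s (fun k => a k ω) b

end TensorBound

/-! ### Square integrable curves and smooth approximation -/

section Curves

variable {Ω : Type*} [MeasurableSpace Ω] {P : Measure Ω} {E : Type*} [NormedAddCommGroup E]

/-- Convergence in `L²` from almost sure convergence and a bound in `L⁴`. -/
lemma tendsto_eLpNorm_two_of_bdd_four [IsProbabilityMeasure P] {f : ℕ → Ω → E} {M : ℝ≥0∞}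
    (hM : M ≠ ∞) (hf : ∀ n, AEStronglyMeasurable (f n) P) (h4 : ∀ n, eLpNorm (f n) 4 P ≤ M)
    (h0 : ∀ᵐ ω ∂P, Tendsto (fun n => f n ω) atTop (𝓝 0)) :
    Tendsto (fun n => eLpNorm (f n) 2 P) atTop (𝓝 0) := by
  have hui : UnifIntegrable f 2 P := by
    intro ε hε
    set m := M.toReal with hm
    have hm0 : 0 ≤ m := ENNReal.toReal_nonneg
    -- By Hölder the `L²` norm over `s` is at most the `L⁴` norm times `P(s)^(1/4)`; the fourth
    -- power compensates for this exponent.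
    refine ⟨(ε / (m + 1)) ^ 4, by positivity, fun n s hs hμ => ?_⟩
    rw [eLpNorm_indicator_eq_eLpNorm_restrict hs]
    refine (eLpNorm_le_eLpNorm_mul_rpow_measure_univ (q := 4) (by norm_num)
      (hf n).restrict).trans ?_
    have h1 : eLpNorm (f n) 4 (P.restrict s) ≤ ENNReal.ofReal m := by
      rw [hm, ENNReal.ofReal_toReal hM]
      exact (eLpNorm_mono_measure _ Measure.restrict_le_self).trans (h4 n)
    have h2 : (P.restrict s) univ ^ (1 / (2 : ℝ≥0∞).toReal - 1 / (4 : ℝ≥0∞).toReal) ≤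
        ENNReal.ofReal (ε / (m + 1)) := by
      rw [Measure.restrict_apply_univ]
      calc P s ^ (1 / (2 : ℝ≥0∞).toReal - 1 / (4 : ℝ≥0∞).toReal)
          ≤ ENNReal.ofReal ((ε / (m + 1)) ^ 4) ^
            (1 / (2 : ℝ≥0∞).toReal - 1 / (4 : ℝ≥0∞).toReal) :=
            ENNReal.rpow_le_rpow hμ (by norm_num)
        _ = ENNReal.ofReal (ε / (m + 1)) := by
            rw [ENNReal.ofReal_rpow_of_nonneg (by positivity) (by norm_num), ← Real.rpow_natCast,
              ← Real.rpow_mul (by positivity)]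
            norm_num
    refine (mul_le_mul' h1 h2).trans ?_
    rw [← ENNReal.ofReal_mul hm0]
    refine ENNReal.ofReal_le_ofReal ?_
    rw [mul_div_assoc', div_le_iff₀ (by positivity)]
    nlinarith
  have h := tendsto_Lp_finite_of_tendsto_ae (p := 2) (by norm_num) (by norm_num) hf
    (MemLp.zero' (p := 2)) hui h0
  refine h.congr fun n => ?_
  congr 1
  ext ω; simp

/-- A curve with almost surely continuous paths that is bounded in `L⁴` is uniformly continuous
in `L²`. -/
lemma exists_delta_eLpNorm_sub_le [IsProbabilityMeasure P] {c : ℝ → Ω → E} {t : ℝ} {M : ℝ≥0∞}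
    (hM : M ≠ ∞) (hm : ∀ s ∈ Icc 0 t, AEStronglyMeasurable (c s) P)
    (h4 : ∀ s ∈ Icc 0 t, eLpNorm (c s) 4 P ≤ M)
    (hc : ∀ᵐ ω ∂P, ContinuousOn (fun s => c s ω) (Icc 0 t)) {ε : ℝ≥0∞} (hε : 0 < ε) :
    ∃ δ > 0, ∀ s ∈ Icc 0 t, ∀ r ∈ Icc 0 t, |s - r| ≤ δ →
      eLpNorm (fun ω => c s ω - c r ω) 2 P ≤ ε := by
  -- Otherwise there are pairs of times with gaps tending to zero whose `L²` distance stays above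
  -- `ε`. By compactness both times converge to one point along a subsequence. Path continuity and
  -- the `L⁴` bound then force the distance to zero.
  by_contra! hcon
  choose s hs r hr hsr hlt using fun n : ℕ => hcon (1 / ((n : ℝ) + 1)) (by positivity)
  obtain ⟨x, hx, φ, hφ, hsx⟩ := isCompact_Icc.tendsto_subseq hs
  have hd : Tendsto (fun n => s (φ n) - r (φ n)) atTop (𝓝 0) := by
    have h1 : Tendsto (fun n => 1 / ((φ n : ℝ) + 1)) atTop (𝓝 0) :=
      tendsto_one_div_add_atTop_nhds_zero_nat.comp hφ.tendsto_atTop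
    exact squeeze_zero_norm (fun n => hsr (φ n)) h1
  have hrx : Tendsto (fun n => r (φ n)) atTop (𝓝 x) := by
    simpa using hsx.sub hd
  have h := tendsto_eLpNorm_two_of_bdd_four (f := fun n ω => c (s (φ n)) ω - c (r (φ n)) ω)
    (M := M + M) (ENNReal.add_ne_top.2 ⟨hM, hM⟩)
    (fun n => (hm _ (hs _)).sub (hm _ (hr _)))
    (fun n => (eLpNorm_sub_le (hm _ (hs _)) (hm _ (hr _)) (by norm_num)).trans
      (add_le_add (h4 _ (hs _)) (h4 _ (hr _)))) (by
      filter_upwards [hc] with ω hω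
      have h2 := (hω x hx).tendsto
      have h3 := h2.comp (tendsto_nhdsWithin_iff.2 ⟨hsx, Eventually.of_forall fun n => hs _⟩)
      have h4 := h2.comp (tendsto_nhdsWithin_iff.2 ⟨hrx, Eventually.of_forall fun n => hr _⟩)
      simpa using h3.sub h4)
  obtain ⟨n, hn⟩ := (h.eventually (gt_mem_nhds hε)).exists
  exact absurd hn (hlt (φ n)).le.not_gt

end Curves

/-! ### Smooth approximation of `C¹` functions with their derivatives -/

section Approximation

variable {V : Type*} [NormedAddCommGroup V] [NormedSpace ℝ V] [FiniteDimensional ℝ V]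

/-- Approximation of compactly supported `C¹` functions by smooth ones. -/
lemma exists_smooth_approx {g : V → ℝ} (hg : ContDiff ℝ 1 g) (hc : HasCompactSupport g) {ε : ℝ}
    (hε : 0 < ε) : ∃ h : V → ℝ, ContDiff ℝ (⊤ : ℕ∞) h ∧ HasCompactSupport h ∧
      (∀ x, |h x - g x| ≤ ε) ∧ ∀ x, ‖fderiv ℝ h x - fderiv ℝ g x‖ ≤ ε := by
  borelize V
  set μ : Measure V := Measure.addHaar
  have hcd : Continuous (fderiv ℝ g) := hg.continuous_fderiv one_ne_zero
  have u1 := hc.uniformContinuous_of_continuous hg.continuous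
  have u2 := (hc.fderiv ℝ).uniformContinuous_of_continuous hcd
  obtain ⟨δ₁, hδ₁, h1⟩ := Metric.uniformContinuous_iff.1 u1 ε hε
  obtain ⟨δ₂, hδ₂, h2⟩ := Metric.uniformContinuous_iff.1 u2 ε hε
  set δ := min δ₁ δ₂
  have hδ : 0 < δ := lt_min hδ₁ hδ₂
  let φ : ContDiffBump (0 : V) := ⟨δ / 2, δ, half_pos hδ, half_lt_self hδ⟩
  have hφi : LocallyIntegrable (φ.normed μ) μ := φ.continuous_normed.locallyIntegrable
  -- Mollification at a scale `δ` below the moduli of uniform continuity of `g` and of its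
  -- derivative; the derivative of the convolution is the convolution with the derivative.
  refine ⟨MeasureTheory.convolution (φ.normed μ) g (ContinuousLinearMap.lsmul ℝ ℝ) μ, ?_, ?_,
    fun x => ?_, fun x => ?_⟩
  · exact φ.hasCompactSupport_normed.contDiff_convolution_left _ φ.contDiff_normed
      hg.continuous.locallyIntegrable
  · exact φ.hasCompactSupport_normed.convolution _ hc
  · exact φ.dist_normed_convolution_le hg.continuous.aestronglyMeasurable
      fun y hy => (h1 (lt_of_lt_of_le hy (min_le_left _ _))).le
  · have hd := (hc.hasFDerivAt_convolution_right (ContinuousLinearMap.lsmul ℝ ℝ) hφi hg x).fderiv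
    have e : MeasureTheory.convolution (φ.normed μ) (fderiv ℝ g)
        ((ContinuousLinearMap.lsmul ℝ ℝ).precompR V) μ x =
        MeasureTheory.convolution (φ.normed μ) (fderiv ℝ g) (ContinuousLinearMap.lsmul ℝ ℝ) μ x := by
      simp only [MeasureTheory.convolution]
      refine integral_congr_ae (ae_of_all _ fun y => ?_)
      ext v
      simp [ContinuousLinearMap.precompR_apply]
    rw [hd, e, ← dist_eq_norm]
    exact φ.dist_normed_convolution_le hcd.aestronglyMeasurable
      fun y hy => (h2 (lt_of_lt_of_le hy (min_le_right _ _))).le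

lemma exists_bound_iteratedFDeriv {h : V → ℝ} (hs : ContDiff ℝ (⊤ : ℕ∞) h)
    (hc : HasCompactSupport h) (k : ℕ) : ∃ C : ℝ, ∀ x, ‖iteratedFDeriv ℝ k h x‖ ≤ C :=
  (hs.continuous_iteratedFDeriv (by exact_mod_cast le_top)).bounded_above_of_compact_support
    (hc.iteratedFDeriv k)

variable {Ω : Type*} [MeasurableSpace Ω] {P : Measure Ω} {ι : Type*} [Fintype ι]

/-- Approximation of `C¹` functions of polynomial growth in the `L²` space of a Gaussian law. -/
lemma exists_smooth_approx_gaussian [IsProbabilityMeasure P] {X : Ω → ι → ℝ}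
    (hX : HasGaussianLaw X P) {g : (ι → ℝ) → ℝ} (hg : ContDiff ℝ 1 g) (hb : PolyBdd g)
    (hb' : PolyBdd (fderiv ℝ g)) {ε : ℝ≥0∞} (hε : 0 < ε) :
    ∃ h : (ι → ℝ) → ℝ, ContDiff ℝ (⊤ : ℕ∞) h ∧
      (∀ k : ℕ, ∃ C : ℝ, ∀ x, ‖iteratedFDeriv ℝ k h x‖ ≤ C) ∧
      eLpNorm (fun ω => h (X ω) - g (X ω)) 2 P ≤ ε ∧
      eLpNorm (fun ω => ‖fderiv ℝ h (X ω) - fderiv ℝ g (X ω)‖) 2 P ≤ ε := by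
  have hXm : AEMeasurable X P := hX.aemeasurable
  let χ : ContDiffBump (0 : ι → ℝ) := ⟨1, 2, one_pos, one_lt_two⟩
  have hχ : ContDiff ℝ 1 χ := χ.contDiff
  set L : ℕ → (ι → ℝ) →L[ℝ] (ι → ℝ) := fun m =>
    ((m : ℝ) + 1)⁻¹ • ContinuousLinearMap.id ℝ (ι → ℝ) with hL
  have hL1 : ∀ m, ‖L m‖ ≤ 1 := fun m => by
    refine ContinuousLinearMap.opNorm_le_bound _ zero_le_one fun x => ?_
    have : ‖((m : ℝ) + 1)⁻¹‖ ≤ 1 := by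
      rw [Real.norm_of_nonneg (by positivity)]
      exact inv_le_one_of_one_le₀ (by linarith [Nat.cast_nonneg (α := ℝ) m])
    rw [hL]
    simp only [smul_apply, ContinuousLinearMap.id_apply, norm_smul]
    exact mul_le_mul_of_nonneg_right this (norm_nonneg x)
  -- Truncation at radius of order `m`. Near any fixed point it is eventually equal to `g`. The
  -- errors of the value and of the derivative are dominated by `|g|` and `‖Dg‖ + D |g|`, which have
  -- all moments. After truncation the compactly supported approximation applies.
  set gm : ℕ → (ι → ℝ) → ℝ := fun m x => χ (L m x) * g x with hgm
  have cgm : ∀ m, ContDiff ℝ 1 (gm m) := fun m => (hχ.comp (L m).contDiff).mul hg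
  obtain ⟨D, hD⟩ := (hχ.continuous_fderiv one_ne_zero).bounded_above_of_compact_support
    (χ.hasCompactSupport.fderiv ℝ)
  have hD0 : 0 ≤ D := (norm_nonneg _).trans (hD 0)
  have dgm : ∀ m x, fderiv ℝ (gm m) x =
      χ (L m x) • fderiv ℝ g x + g x • (fderiv ℝ χ (L m x)).comp (L m) := fun m x => by
    have h1 : HasFDerivAt (fun x => χ (L m x)) ((fderiv ℝ χ (L m x)).comp (L m)) x :=
      ((hχ.differentiable one_ne_zero) _).hasFDerivAt.comp x (L m).hasFDerivAt
    exact (h1.mul ((hg.differentiable one_ne_zero) x).hasFDerivAt).fderiv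
  have supp : ∀ m, HasCompactSupport (gm m) := fun m => by
    refine HasCompactSupport.intro (isCompact_closedBall (0 : ι → ℝ) (2 * (m + 1))) fun x hx => ?_
    rw [mem_closedBall_zero_iff, not_le] at hx
    have : χ (L m x) = 0 := by
      refine χ.zero_of_le_dist ?_
      rw [dist_zero_right, hL]
      simp only [smul_apply, ContinuousLinearMap.id_apply, norm_smul]
      rw [Real.norm_of_nonneg (by positivity), inv_mul_eq_div, le_div_iff₀ (by positivity)]
      exact hx.le
    simp [hgm, this]
  have ev : ∀ x, ∀ᶠ m : ℕ in atTop, gm m =ᶠ[𝓝 x] g := fun x => by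
    filter_upwards [eventually_ge_atTop ⌈‖x‖⌉₊] with m hm
    have hx : L m x ∈ Metric.ball (0 : ι → ℝ) χ.rIn := by
      rw [mem_ball_zero_iff, hL]
      simp only [smul_apply, ContinuousLinearMap.id_apply, norm_smul]
      rw [Real.norm_of_nonneg (by positivity), inv_mul_eq_div, div_lt_iff₀ (by positivity)]
      have := (Nat.le_ceil ‖x‖).trans (Nat.cast_le.2 hm)
      change ‖x‖ < 1 * ((m : ℝ) + 1)
      linarith
    have := (L m).continuous.continuousAt.eventually (χ.eventuallyEq_one_of_mem_ball hx)
    filter_upwards [this] with y hy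
    simp only [hgm, hy, Pi.one_apply, one_mul]
  have mg := hasMoments_of_polyBdd hX hg.continuous hb
  have mg' := hasMoments_of_polyBdd hX (hg.continuous_fderiv one_ne_zero).norm hb'.norm
  have t0 : Tendsto (fun m => eLpNorm (fun ω => gm m (X ω) - g (X ω)) 2 P) atTop (𝓝 0) := by
    refine tendsto_eLpNorm_two_of_bdd_four (M := eLpNorm (fun ω => g (X ω)) 4 P)
      (mg 4 (by simp)).2.ne (fun m => ?_) (fun m => ?_) (ae_of_all _ fun ω => ?_)
    · exact (((cgm m).continuous.sub hg.continuous).measurable.comp_aemeasurable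
        hXm).aestronglyMeasurable
    · refine eLpNorm_mono fun ω => ?_
      have e : gm m (X ω) - g (X ω) = (χ (L m (X ω)) - 1) * g (X ω) := by simp only [hgm]; ring
      rw [e, norm_mul]
      refine mul_le_of_le_one_left (norm_nonneg _) ?_
      rw [Real.norm_eq_abs, abs_le]
      constructor <;> linarith [χ.nonneg (x := L m (X ω)), χ.le_one (x := L m (X ω))]
    · refine tendsto_const_nhds.congr' ?_
      filter_upwards [ev (X ω)] with m hm
      rw [hm.eq_of_nhds, sub_self]
  have t1 : Tendsto (fun m => eLpNorm (fun ω => ‖fderiv ℝ (gm m) (X ω) - fderiv ℝ g (X ω)‖) 2 P)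
      atTop (𝓝 0) := by
    have mM := mg'.add ((hasMoments_const D).mul fun p hp => (mg p hp).norm)
    refine tendsto_eLpNorm_two_of_bdd_four (mM 4 (by simp)).2.ne
      (fun m => ?_) (fun m => ?_) (ae_of_all _ fun ω => ?_)
    · exact ((((cgm m).continuous_fderiv one_ne_zero).sub
        (hg.continuous_fderiv one_ne_zero)).norm.measurable.comp_aemeasurable
        hXm).aestronglyMeasurable
    · refine eLpNorm_mono fun ω => ?_
      have e : fderiv ℝ (gm m) (X ω) - fderiv ℝ g (X ω) = (χ (L m (X ω)) - 1) • fderiv ℝ g (X ω) +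
          g (X ω) • (fderiv ℝ χ (L m (X ω))).comp (L m) := by
        ext v
        simp only [dgm, sub_apply, add_apply, smul_apply]
        simp only [smul_eq_mul]
        ring
      have b1 : ‖χ (L m (X ω)) - 1‖ ≤ 1 := by
        rw [Real.norm_eq_abs, abs_le]
        constructor <;> linarith [χ.nonneg (x := L m (X ω)), χ.le_one (x := L m (X ω))]
      have b2 : ‖(fderiv ℝ χ (L m (X ω))).comp (L m)‖ ≤ D :=
        (ContinuousLinearMap.opNorm_comp_le _ _).trans
          ((mul_le_mul (hD _) (hL1 m) (norm_nonneg _) hD0).trans (mul_one D).le)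
      rw [e, norm_norm, Real.norm_of_nonneg (r := ‖fderiv ℝ g (X ω)‖ + D * ‖g (X ω)‖)
        (by positivity)]
      refine (norm_add_le _ _).trans (add_le_add ?_ ?_)
      · rw [norm_smul]; exact mul_le_of_le_one_left (norm_nonneg _) b1
      · rw [norm_smul, mul_comm]; gcongr
    · refine tendsto_const_nhds.congr' ?_
      filter_upwards [ev (X ω)] with m hm
      rw [hm.fderiv_eq, sub_self, norm_zero]
  have hε2 : 0 < ε / 2 := ENNReal.half_pos hε.ne'
  obtain ⟨m, hm0, hm1⟩ := ((t0.eventually (gt_mem_nhds hε2)).and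
    (t1.eventually (gt_mem_nhds hε2))).exists
  obtain ⟨η, hη, hηε⟩ : ∃ η : ℝ, 0 < η ∧ ENNReal.ofReal η ≤ ε / 2 := by
    obtain ⟨η, h1, h2⟩ := ENNReal.lt_iff_exists_nnreal_btwn.1 hε2
    exact ⟨η, by exact_mod_cast h1, by simpa using h2.le⟩
  obtain ⟨h, h1, h2, h3, h4⟩ := exists_smooth_approx (cgm m) (supp m) hη
  have small : ∀ u : Ω → ℝ, (∀ ω, ‖u ω‖ ≤ η) → eLpNorm u 2 P ≤ ε / 2 := fun u hu => by
    refine le_trans ?_ hηε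
    simpa using eLpNorm_le_of_ae_bound (p := 2) (μ := P) (ae_of_all _ hu)
  refine ⟨h, h1, exists_bound_iteratedFDeriv h1 h2, ?_, ?_⟩
  · have e : (fun ω => h (X ω) - g (X ω)) =
        (fun ω => h (X ω) - gm m (X ω)) + fun ω => gm m (X ω) - g (X ω) := by ext ω; simp
    rw [e, ← ENNReal.add_halves ε]
    refine (eLpNorm_add_le ?_ ?_ (by norm_num)).trans (add_le_add (small _ fun ω => h3 _) hm0.le)
    · exact ((h1.continuous.sub (cgm m).continuous).measurable.comp_aemeasurable
        hXm).aestronglyMeasurable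
    · exact (((cgm m).continuous.sub hg.continuous).measurable.comp_aemeasurable
        hXm).aestronglyMeasurable
  · have hs := small (fun ω => ‖fderiv ℝ h (X ω) - fderiv ℝ (gm m) (X ω)‖)
      fun ω => (norm_norm _).trans_le (h4 _)
    rw [← ENNReal.add_halves ε]
    refine le_trans ?_ (add_le_add hs hm1.le)
    have c1 : Continuous fun x => ‖fderiv ℝ h x - fderiv ℝ (gm m) x‖ :=
      ((h1.continuous_fderiv (by simp)).sub ((cgm m).continuous_fderiv one_ne_zero)).norm
    have c2 : Continuous fun x => ‖fderiv ℝ (gm m) x - fderiv ℝ g x‖ :=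
      (((cgm m).continuous_fderiv one_ne_zero).sub (hg.continuous_fderiv one_ne_zero)).norm
    have m1 : AEStronglyMeasurable (fun ω => ‖fderiv ℝ h (X ω) - fderiv ℝ (gm m) (X ω)‖) P :=
      (c1.measurable.comp_aemeasurable hXm).aestronglyMeasurable
    have m2 : AEStronglyMeasurable (fun ω => ‖fderiv ℝ (gm m) (X ω) - fderiv ℝ g (X ω)‖) P :=
      (c2.measurable.comp_aemeasurable hXm).aestronglyMeasurable
    refine le_trans (eLpNorm_mono_real fun ω => ?_) (eLpNorm_add_le m1 m2 one_le_two)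
    rw [norm_norm]
    exact norm_sub_le_norm_sub_add_norm_sub _ _ _

end Approximation

/-! ### Riemann sums with values in a Hilbert space -/

section Riemann

lemma sum_dyadic_sub {F M : Type*} [AddCommGroup F] [AddCommGroup M] (e : ℝ → F) (t : ℝ)
    (β : ℝ → F → M) (hβ : ∀ s x y, β s (x + y) = β s x + β s y) (n m : ℕ) :
    ∑ k ∈ Finset.range (2 ^ n), β (dyadic t n k) (incr e t n k) -
      ∑ l ∈ Finset.range (2 ^ (n + m)), β (dyadic t (n + m) l) (incr e t (n + m) l) =
      ∑ l ∈ Finset.range (2 ^ (n + m)), (β (dyadic t n (l / 2 ^ m)) (incr e t (n + m) l) -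
        β (dyadic t (n + m) l) (incr e t (n + m) l)) := by
  rw [sum_incr_refine e t (fun k => β (dyadic t n k)) (fun k => hβ _) n m, Finset.sum_sub_distrib]

lemma dyadic_div_mem {t : ℝ} (ht : 0 ≤ t) {n m l : ℕ} (hl : l ∈ Finset.range (2 ^ (n + m))) :
    dyadic t n (l / 2 ^ m) ∈ Icc 0 t := by
  refine dyadic_mem ht ?_
  have : l / 2 ^ m < 2 ^ n := by
    rw [Nat.div_lt_iff_lt_mul (by positivity), ← pow_add]
    exact Finset.mem_range.1 hl
  exact this.le

lemma dyadic_mem_of_mem_range {t : ℝ} (ht : 0 ≤ t) {n l : ℕ} (hl : l ∈ Finset.range (2 ^ n)) :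
    dyadic t n l ∈ Icc 0 t := dyadic_mem ht (Finset.mem_range.1 hl).le

lemma dyadic_succ_mem_of_mem_range {t : ℝ} (ht : 0 ≤ t) {n l : ℕ}
    (hl : l ∈ Finset.range (2 ^ n)) : dyadic t n (l + 1) ∈ Icc 0 t :=
  dyadic_mem ht (Finset.mem_range.1 hl)

variable {F : Type*} [NormedAddCommGroup F] [InnerProductSpace ℝ F]

/-- On the finer of two partitions the Riemann sums differ only in the point where `φ` is evaluated.
Uniform continuity makes the coefficients small, and the bound on the inner products of the
increments makes this enough. -/
lemma cauchySeq_riemann {e : ℝ → F} {t C : ℝ} (ht : 0 ≤ t)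
    (hC : ∀ n, ∑ k ∈ Finset.range (2 ^ n), ∑ l ∈ Finset.range (2 ^ n),
      |inner ℝ (incr e t n k) (incr e t n l)| ≤ C) {φ : ℝ → ℝ} (hφ : ContinuousOn φ (Icc 0 t)) :
    CauchySeq fun n => ∑ k ∈ Finset.range (2 ^ n), φ (dyadic t n k) • incr e t n k := by
  rw [Metric.cauchySeq_iff']
  intro ε hε
  have hu := Metric.uniformContinuousOn_iff_le.1
    (isCompact_Icc.uniformContinuousOn_of_continuous hφ) (ε / (2 * (√C + 1))) (by positivity)
  obtain ⟨δ, hδ, h⟩ := hu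
  obtain ⟨N, hN⟩ := ((tendsto_div_two_pow t).eventually (gt_mem_nhds hδ)).exists
  refine ⟨N, fun n hn => ?_⟩
  obtain ⟨m, rfl⟩ := Nat.exists_eq_add_of_le hn
  rw [dist_comm, dist_eq_norm, sum_dyadic_sub e t (fun s x => φ s • x) fun s x y => smul_add _ _ _]
  simp only [← sub_smul]
  refine lt_of_le_of_lt (norm_sum_smul_le _ (by positivity) (hC _) fun l hl =>
    h _ (dyadic_div_mem ht hl) _ (dyadic_mem_of_mem_range ht hl)
      ((abs_dyadic_div_sub_le ht _ _ _).trans hN.le)) ?_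
  rw [mul_div_assoc', div_lt_iff₀ (by positivity)]
  nlinarith [Real.sqrt_nonneg C]

/-- Riemann sums with respect to an absolutely continuous integrator. -/
lemma tendsto_sum_mul_integral {t : ℝ} (ht : 0 ≤ t) {φ w : ℝ → ℝ} (hφ : ContinuousOn φ (Icc 0 t))
    (hw : IntervalIntegrable w volume 0 t) :
    Tendsto (fun n => ∑ k ∈ Finset.range (2 ^ n),
      φ (dyadic t n k) * ∫ v in dyadic t n k..dyadic t n (k + 1), w v) atTop
      (𝓝 (∫ v in (0 : ℝ)..t, φ v * w v)) := by
  have hsub : ∀ {n k : ℕ}, k ∈ Finset.range (2 ^ n) →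
      uIcc (dyadic t n k) (dyadic t n (k + 1)) ⊆ uIcc 0 t := fun {n k} hk => by
    rw [uIcc_of_le (dyadic_mono ht n (Nat.le_succ k)), uIcc_of_le ht]
    exact Icc_subset_Icc (dyadic_mem_of_mem_range ht hk).1 (dyadic_succ_mem_of_mem_range ht hk).2
  have hφw : IntervalIntegrable (fun v => φ v * w v) volume 0 t :=
    hw.continuousOn_mul (by rwa [uIcc_of_le ht])
  set I := ∫ v in (0 : ℝ)..t, |w v|
  have hI : 0 ≤ I := intervalIntegral.integral_nonneg ht fun _ _ => abs_nonneg _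
  rw [Metric.tendsto_atTop]
  intro ε hε
  obtain ⟨δ, hδ, h⟩ := Metric.uniformContinuousOn_iff_le.1
    (isCompact_Icc.uniformContinuousOn_of_continuous hφ) (ε / (2 * (I + 1))) (by positivity)
  obtain ⟨N, hN⟩ := eventually_atTop.1 ((tendsto_div_two_pow t).eventually (gt_mem_nhds hδ))
  refine ⟨N, fun n hn => ?_⟩
  have e1 : ∫ v in (0 : ℝ)..t, φ v * w v = ∑ k ∈ Finset.range (2 ^ n),
      ∫ v in dyadic t n k..dyadic t n (k + 1), φ v * w v := by
    rw [intervalIntegral.sum_integral_adjacent_intervals (a := dyadic t n) (n := 2 ^ n) fun k hk =>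
      hφw.mono_set (hsub (Finset.mem_range.2 hk)), dyadic_zero, dyadic_last]
  have e2 : I = ∑ k ∈ Finset.range (2 ^ n),
      ∫ v in dyadic t n k..dyadic t n (k + 1), |w v| := by
    rw [intervalIntegral.sum_integral_adjacent_intervals (a := dyadic t n) (n := 2 ^ n) fun k hk =>
      hw.abs.mono_set (hsub (Finset.mem_range.2 hk)), dyadic_zero, dyadic_last]
  rw [e1, dist_eq_norm, ← Finset.sum_sub_distrib]
  refine lt_of_le_of_lt ((norm_sum_le _ _).trans (Finset.sum_le_sum
    (g := fun k => ε / (2 * (I + 1)) * ∫ v in dyadic t n k..dyadic t n (k + 1), |w v|)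
    fun k hk => ?_)) ?_
  · have hle := dyadic_mono ht n (Nat.le_succ k)
    have hwk := hw.mono_set (hsub hk)
    have hφk := hφw.mono_set (hsub hk)
    rw [← intervalIntegral.integral_const_mul, ← intervalIntegral.integral_sub
      (hwk.const_mul _) hφk, ← intervalIntegral.integral_const_mul]
    refine intervalIntegral.norm_integral_le_of_norm_le hle (ae_of_all _ fun v hv => ?_)
      (hwk.abs.const_mul _)
    rw [← sub_mul, norm_mul]
    refine mul_le_mul_of_nonneg_right ?_ (abs_nonneg _)
    refine h _ (dyadic_mem_of_mem_range ht hk) _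
      ⟨(dyadic_mem_of_mem_range ht hk).1.trans hv.1.le,
        hv.2.trans (dyadic_succ_mem_of_mem_range ht hk).2⟩ ?_
    rw [dist_comm, Real.dist_eq, abs_of_nonneg (by linarith [hv.1])]
    have := dyadic_succ_sub t n k
    linarith [hv.2, hN n hn]
  · rw [← Finset.mul_sum, ← e2, div_mul_eq_mul_div, div_lt_iff₀ (by positivity)]
    nlinarith

variable {Ω : Type*} [MeasurableSpace Ω] {P : Measure Ω}

/-- Riemann sums of an `L²`-curve form a Cauchy sequence, uniformly in the summation. -/
lemma exists_eLpNorm_riemann_sub_le [IsProbabilityMeasure P] {E G : Type*} [NormedAddCommGroup E]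
    [NormedAddCommGroup G] {e : ℝ → F} {t C : ℝ} (ht : 0 ≤ t) {c : ℝ → Ω → E} {M : ℝ≥0∞}
    (β : E → F → G) (hβ : ∀ a x y, β a (x + y) = β a x + β a y)
    (hβ' : ∀ a b x, β (a - b) x = β a x - β b x)
    (hbound : ∀ (n : ℕ) (a : ℕ → Ω → E) (ε : ℝ≥0∞), (∀ k ∈ Finset.range (2 ^ n),
      AEStronglyMeasurable (a k) P) → (∀ k ∈ Finset.range (2 ^ n), eLpNorm (a k) 2 P ≤ ε) →
      eLpNorm (fun ω => ∑ k ∈ Finset.range (2 ^ n), β (a k ω) (incr e t n k)) 2 P ≤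
        ENNReal.ofReal √C * ε)
    (hM : M ≠ ∞) (hm : ∀ s ∈ Icc 0 t, AEStronglyMeasurable (c s) P)
    (h4 : ∀ s ∈ Icc 0 t, eLpNorm (c s) 4 P ≤ M)
    (hc : ∀ᵐ ω ∂P, ContinuousOn (fun s => c s ω) (Icc 0 t)) {ε : ℝ≥0∞} (hε : 0 < ε) :
    ∃ N, ∀ n ≥ N, ∀ m, eLpNorm (fun ω =>
      ∑ k ∈ Finset.range (2 ^ n), β (c (dyadic t n k) ω) (incr e t n k) -
      ∑ l ∈ Finset.range (2 ^ (n + m)), β (c (dyadic t (n + m) l) ω) (incr e t (n + m) l)) 2 P ≤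
        ENNReal.ofReal √C * ε := by
  obtain ⟨δ, hδ, h⟩ := exists_delta_eLpNorm_sub_le hM hm h4 hc hε
  obtain ⟨N, hN⟩ := eventually_atTop.1 ((tendsto_div_two_pow t).eventually (gt_mem_nhds hδ))
  refine ⟨N, fun n hn m => ?_⟩
  have e1 : ∀ ω, ∑ k ∈ Finset.range (2 ^ n), β (c (dyadic t n k) ω) (incr e t n k) -
      ∑ l ∈ Finset.range (2 ^ (n + m)), β (c (dyadic t (n + m) l) ω) (incr e t (n + m) l) =
      ∑ l ∈ Finset.range (2 ^ (n + m)), β (c (dyadic t n (l / 2 ^ m)) ω -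
        c (dyadic t (n + m) l) ω) (incr e t (n + m) l) := fun ω => by
    rw [sum_dyadic_sub e t (fun s x => β (c s ω) x) fun s x y => hβ _ _ _]
    simp only [hβ']
  simp only [e1]
  exact hbound (n + m) (fun l ω => c (dyadic t n (l / 2 ^ m)) ω - c (dyadic t (n + m) l) ω) ε
    (fun k hk => (hm _ (dyadic_div_mem ht hk)).sub (hm _ (dyadic_mem_of_mem_range ht hk)))
    fun k hk => h _ (dyadic_div_mem ht hk) _ (dyadic_mem_of_mem_range ht hk)
      ((abs_dyadic_div_sub_le ht _ _ _).trans (hN n hn).le)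

variable [IsProbabilityMeasure P] {e : ℝ → F} {t C : ℝ} {M : ℝ≥0∞}

lemma exists_eLpNorm_riemann_smul_sub_le (ht : 0 ≤ t)
    (hC : ∀ n, ∑ k ∈ Finset.range (2 ^ n), ∑ l ∈ Finset.range (2 ^ n),
      |inner ℝ (incr e t n k) (incr e t n l)| ≤ C) {c : ℝ → Ω → ℝ}
    (hM : M ≠ ∞) (hm : ∀ s ∈ Icc 0 t, AEStronglyMeasurable (c s) P)
    (h4 : ∀ s ∈ Icc 0 t, eLpNorm (c s) 4 P ≤ M)
    (hc : ∀ᵐ ω ∂P, ContinuousOn (fun s => c s ω) (Icc 0 t)) {ε : ℝ≥0∞} (hε : 0 < ε) :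
    ∃ N, ∀ n ≥ N, ∀ m, eLpNorm (fun ω =>
      ∑ k ∈ Finset.range (2 ^ n), c (dyadic t n k) ω • incr e t n k -
      ∑ l ∈ Finset.range (2 ^ (n + m)), c (dyadic t (n + m) l) ω • incr e t (n + m) l) 2 P ≤
        ENNReal.ofReal √C * ε :=
  exists_eLpNorm_riemann_sub_le ht (fun a x => a • x) smul_add sub_smul
    (fun n _ _ h1 h2 => eLpNorm_sum_smul_le _ h1 (hC n) h2) hM hm h4 hc hε

lemma exists_eLpNorm_riemann_tmul_sub_le {E : Type*} [NormedAddCommGroup E]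
    [InnerProductSpace ℝ E] (ht : 0 ≤ t)
    (hC : ∀ n, ∑ k ∈ Finset.range (2 ^ n), ∑ l ∈ Finset.range (2 ^ n),
      |inner ℝ (incr e t n k) (incr e t n l)| ≤ C) {c : ℝ → Ω → E}
    (hM : M ≠ ∞) (hm : ∀ s ∈ Icc 0 t, AEStronglyMeasurable (c s) P)
    (h4 : ∀ s ∈ Icc 0 t, eLpNorm (c s) 4 P ≤ M)
    (hc : ∀ᵐ ω ∂P, ContinuousOn (fun s => c s ω) (Icc 0 t)) {ε : ℝ≥0∞} (hε : 0 < ε) :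
    ∃ N, ∀ n ≥ N, ∀ m, eLpNorm (fun ω =>
      ∑ k ∈ Finset.range (2 ^ n), c (dyadic t n k) ω ⊗ₜ[ℝ] incr e t n k -
      ∑ l ∈ Finset.range (2 ^ (n + m)), c (dyadic t (n + m) l) ω ⊗ₜ[ℝ] incr e t (n + m) l) 2 P ≤
        ENNReal.ofReal √C * ε :=
  exists_eLpNorm_riemann_sub_le ht (fun a x => a ⊗ₜ[ℝ] x) TensorProduct.tmul_add
    TensorProduct.sub_tmul (fun n _ _ h1 h2 => eLpNorm_sum_tmul_le _ h1 (hC n) h2) hM hm h4 hc hε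

end Riemann

/-! ### Curves in the Gaussian space of the process -/

instance completeSpace_gaussianSpace {Ω ι : Type*} [MeasurableSpace Ω] {P : Measure Ω} {T : ℝ}
    {B : ι → ℝ → Ω → ℝ} : CompleteSpace (gaussianSpace T B P) :=
  (Submodule.isClosed_topologicalClosure _).completeSpace_coe

lemma fderiv_apply_eq_sum_pderiv {d : ℕ} (g : (Fin d → ℝ) → ℝ) (x v : Fin d → ℝ) :
    fderiv ℝ g x v = ∑ j, v j * pderiv j g x := by
  conv_lhs => rw [← Finset.univ_sum_single v]
  rw [map_sum]
  refine Finset.sum_congr rfl fun j _ => ?_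
  have : (Pi.single j (v j) : Fin d → ℝ) = v j • Pi.single j 1 := by
    rw [← Pi.single_smul, smul_eq_mul, mul_one]
  rw [this, map_smul, smul_eq_mul, pderiv]

lemma norm_fderiv_le_sum_pderiv {d : ℕ} (g : (Fin d → ℝ) → ℝ) (x : Fin d → ℝ) :
    ‖fderiv ℝ g x‖ ≤ ∑ j, |pderiv j g x| := by
  refine ContinuousLinearMap.opNorm_le_bound _ (Finset.sum_nonneg fun _ _ => abs_nonneg _)
    fun v => ?_
  rw [fderiv_apply_eq_sum_pderiv, Finset.sum_mul]
  refine (norm_sum_le _ _).trans (Finset.sum_le_sum fun j _ => ?_)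
  rw [norm_mul, mul_comm]
  exact mul_le_mul_of_nonneg_left (norm_le_pi_norm v j) (abs_nonneg _)

/-- Functions on `[0, T] × ℝᵈ` of class `C¹` in space, with continuous derivatives of polynomial
growth. -/
structure IsAdmissible {d : ℕ} (T : ℝ) (g : ℝ → (Fin d → ℝ) → ℝ) : Prop where
  diff : ∀ s ∈ Icc 0 T, ContDiff ℝ 1 (g s)
  cont : ContinuousOn (fun p : ℝ × (Fin d → ℝ) => g p.1 p.2) (Icc 0 T ×ˢ univ)
  cont_pderiv : ∀ j,
    ContinuousOn (fun p : ℝ × (Fin d → ℝ) => pderiv j (g p.1) p.2) (Icc 0 T ×ˢ univ)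
  growth : ∃ (C : ℝ) (N : ℕ), 0 ≤ C ∧ ∀ s ∈ Icc 0 T, ∀ x : Fin d → ℝ,
    |g s x| ≤ C * (1 + ‖x‖) ^ N ∧ ∀ j, |pderiv j (g s) x| ≤ C * (1 + ‖x‖) ^ N

section TimeCurves

variable {Ω : Type*} [MeasurableSpace Ω] {P : Measure Ω} [IsProbabilityMeasure P]
  {d : ℕ} {T : ℝ} {H K : Fin d → ℝ} {B : Fin d → ℝ → Ω → ℝ}

/-- The law is that of `‖Y‖` times a standard normal variable, so every moment is controlled by the
Hilbert norm. This yields moment bounds uniform in time. -/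
lemma eLpNorm_gaussian_le (h𝓗 : IsGaussianHilbert (gaussianSpace T B P))
    (Y : gaussianSpace T B P) (q : ℝ≥0∞) :
    eLpNorm (rv Y) q P = ENNReal.ofReal ‖Y‖ * eLpNorm id q (gaussianReal 0 1) := by
  have h1 : P.map (rv Y) = (gaussianReal 0 1).map (fun x => ‖Y‖ * x) := by
    rw [h𝓗.map_rv, gaussianReal_map_const_mul, mul_zero, mul_one]
    congr 1
    ext
    simp
  have h2 : eLpNorm (rv Y) q P = eLpNorm id q (P.map (rv Y)) :=
    (eLpNorm_map_measure aestronglyMeasurable_id (measurable_rv Y).aemeasurable).symm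
  rw [h2, h1, eLpNorm_map_measure aestronglyMeasurable_id (by fun_prop)]
  have h3 : (id ∘ fun x : ℝ => ‖Y‖ * x) = ‖Y‖ • id := by ext; simp
  rw [h3, eLpNorm_const_smul, Real.enorm_of_nonneg (norm_nonneg _)]

lemma IsMultiBifBm.measurable_vec (hB : IsMultiBifBm T H K B P) {s : ℝ} (hs : s ∈ Icc 0 T) :
    Measurable fun ω j => B j s ω :=
  measurable_pi_lambda _ fun j => (hB.component j).measurable s hs

lemma IsMultiBifBm.ae_continuousOn_vec (hB : IsMultiBifBm T H K B P) :
    ∀ᵐ ω ∂P, ContinuousOn (fun s j => B j s ω) (Icc 0 T) := by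
  filter_upwards [ae_all_iff.2 fun j => (hB.component j).continuous] with ω hω
  exact continuousOn_pi.2 hω

lemma IsMultiBifBm.ae_rv_timeVec (hB : IsMultiBifBm T H K B P) {s : ℝ} (hs : s ∈ Icc 0 T) :
    (fun ω j => rv (timeVec T B P j s) ω) =ᵐ[P] fun ω j => B j s ω := by
  filter_upwards [ae_all_iff.2 fun j => hB.rv_timeVec j hs] with ω hω
  ext j
  exact hω j

lemma IsMultiBifBm.hasGaussianLaw_vec (hB : IsMultiBifBm T H K B P) {s : ℝ} (hs : s ∈ Icc 0 T) :
    HasGaussianLaw (fun ω j => B j s ω) P :=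
  (hB.isGaussianHilbert.hasGaussianLaw fun j => timeVec T B P j s).congr (hB.ae_rv_timeVec hs)

lemma IsMultiBifBm.norm_timeVec_sq_le (hB : IsMultiBifBm T H K B P)
    (hHK : ∀ i, 1 < 2 * H i * K i) (j : Fin d) {s : ℝ} (hs : s ∈ Icc 0 T) :
    ‖timeVec T B P j s‖ ^ 2 ≤ T ^ (2 * H j * K j) := by
  rw [← real_inner_self_eq_norm_sq (timeVec T B P j s), hB.inner_timeVec j hs hs,
    bifCov_self hs.1 (hHK j)]
  exact Real.rpow_le_rpow hs.1 hs.2 (by linarith [hHK j])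

lemma IsMultiBifBm.eLpNorm_abs_le (hB : IsMultiBifBm T H K B P)
    (hHK : ∀ i, 1 < 2 * H i * K i) (j : Fin d) {s : ℝ} (hs : s ∈ Icc 0 T) (q : ℝ≥0∞) :
    eLpNorm (fun ω => |B j s ω|) q P ≤
      ENNReal.ofReal √(T ^ (2 * H j * K j)) * eLpNorm id q (gaussianReal 0 1) := by
  have h1 : eLpNorm (fun ω => |B j s ω|) q P = eLpNorm (B j s) q P := by
    simpa only [Real.norm_eq_abs] using eLpNorm_norm (p := q) (μ := P) (B j s)
  have h2 := eLpNorm_gaussian_le hB.isGaussianHilbert (timeVec T B P j s) q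
  have h3 : eLpNorm (rv (timeVec T B P j s)) q P = eLpNorm (B j s) q P :=
    eLpNorm_congr_ae (hB.rv_timeVec j hs)
  rw [h1, ← h3, h2]
  exact mul_le_mul_left (ENNReal.ofReal_le_ofReal
    (Real.le_sqrt_of_sq_le (hB.norm_timeVec_sq_le hHK j hs))) _

/-- Moments of polynomials in `B_s` are bounded uniformly in `s`. -/
lemma IsMultiBifBm.exists_eLpNorm_four_le (hB : IsMultiBifBm T H K B P)
    (hHK : ∀ i, 1 < 2 * H i * K i) (C : ℝ) (N : ℕ) : ∃ M : ℝ≥0∞, M ≠ ∞ ∧ ∀ s ∈ Icc 0 T,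
      eLpNorm (fun ω => C * (1 + ‖fun j => B j s ω‖) ^ N) 4 P ≤ M := by
  -- The power `N` is raised to `N + 1` so that the exponent is positive and `q ≥ 1` also when `N =
  -- 0`. The `L⁴` norm of a power `N + 1` is then a power of the `L^q` norm.
  set q : NNReal := 4 * (N + 1) with hq
  set γ := eLpNorm id q (gaussianReal 0 1) with hγ
  have hγt : γ ≠ ∞ := (memLp_id_gaussianReal q).2.ne
  set A : ℝ≥0∞ := 1 + ∑ j, ENNReal.ofReal √(T ^ (2 * H j * K j)) * γ with hA
  have hAt : A ≠ ∞ := ENNReal.add_ne_top.2 ⟨by simp, (ENNReal.sum_lt_top.2 fun j _ =>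
    ENNReal.mul_lt_top ENNReal.ofReal_lt_top hγt.lt_top).ne⟩
  refine ⟨‖C‖ₑ * A ^ ((N : ℝ) + 1), ENNReal.mul_ne_top enorm_ne_top
    (ENNReal.rpow_ne_top_of_nonneg (by positivity) hAt), fun s hs => ?_⟩
  have hq1 : (1 : ℝ≥0∞) ≤ q := by
    rw [hq]; exact_mod_cast (by nlinarith [Nat.zero_le N] : 1 ≤ 4 * (N + 1))
  have hm : ∀ j, AEStronglyMeasurable (fun ω => |B j s ω|) P := fun j =>
    ((hB.component j).measurable s hs).abs.aestronglyMeasurable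
  have h1 : eLpNorm (fun ω => 1 + ∑ j, |B j s ω|) q P ≤ A := by
    have e : (fun ω => 1 + ∑ j, |B j s ω|) = (fun _ => (1 : ℝ)) + ∑ j, fun ω => |B j s ω| := by
      ext ω; simp
    rw [e]
    refine (eLpNorm_add_le aestronglyMeasurable_const
      (Finset.aestronglyMeasurable_sum _ fun j _ => hm j) hq1).trans (add_le_add ?_ ?_)
    · rw [eLpNorm_const _ (by positivity) (NeZero.ne P)]
      simp
    · exact (eLpNorm_sum_le (fun j _ => hm j) hq1).trans
        (Finset.sum_le_sum fun j _ => hB.eLpNorm_abs_le hHK j hs q)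
  have h2 : ∀ ω, (1 + ‖fun j => B j s ω‖) ^ N ≤ ‖1 + ∑ j, |B j s ω|‖ ^ ((N : ℝ) + 1) := fun ω => by
    have h3 : ‖fun j => B j s ω‖ ≤ ∑ j, |B j s ω| :=
      (pi_norm_le_iff_of_nonneg (Finset.sum_nonneg fun _ _ => abs_nonneg _)).2 fun j =>
        Finset.single_le_sum (f := fun j => |B j s ω|) (fun _ _ => abs_nonneg _)
          (Finset.mem_univ j)
    have h4 : 0 ≤ ∑ j, |B j s ω| := Finset.sum_nonneg fun _ _ => abs_nonneg _
    rw [Real.norm_of_nonneg (by linarith)]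
    calc (1 + ‖fun j => B j s ω‖) ^ N ≤ (1 + ∑ j, |B j s ω|) ^ N := by gcongr
      _ ≤ (1 + ∑ j, |B j s ω|) ^ (N + 1) := pow_le_pow_right₀ (by linarith) (Nat.le_succ N)
      _ = _ := by rw [← Real.rpow_natCast]; push_cast; rfl
  have e : (fun ω => C * (1 + ‖fun j => B j s ω‖) ^ N) =
      C • fun ω => (1 + ‖fun j => B j s ω‖) ^ N := rfl
  rw [e, eLpNorm_const_smul]
  gcongr
  refine (eLpNorm_mono_real (g := fun ω => ‖1 + ∑ j, |B j s ω|‖ ^ ((N : ℝ) + 1)) fun ω => ?_).trans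
    ?_
  · rw [Real.norm_of_nonneg (by positivity)]
    exact h2 ω
  · rw [eLpNorm_norm_rpow _ (by positivity)]
    have : (4 : ℝ≥0∞) * ENNReal.ofReal ((N : ℝ) + 1) = q := by
      rw [hq, ENNReal.ofReal_add (by positivity) zero_le_one]
      simp
    rw [this]
    gcongr

lemma IsMultiBifBm.continuousOn_timeVec (hB : IsMultiBifBm T H K B P)
    (hK : ∀ i, K i ∈ Ioc (0 : ℝ) 1) (hHK : ∀ i, 1 < 2 * H i * K i) (j : Fin d) :
    ContinuousOn (timeVec T B P j) (Icc 0 T) := by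
  intro s hs
  rw [ContinuousWithinAt, tendsto_iff_norm_sub_tendsto_zero]
  have hp : 0 < 2 * H j * K j := by linarith [hHK j]
  have hc : Tendsto (fun r => √(2 * |r - s| ^ (2 * H j * K j))) (𝓝[Icc 0 T] s) (𝓝 0) := by
    have h : ContinuousAt (fun r => √(2 * |r - s| ^ (2 * H j * K j))) s :=
      (continuousAt_const.mul (((continuousAt_id.sub continuousAt_const).abs).rpow_const
        (Or.inr hp.le))).sqrt
    have h' := h.tendsto
    simp only [sub_self, abs_zero, Real.zero_rpow hp.ne', mul_zero, Real.sqrt_zero] at h'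
    exact h'.mono_left nhdsWithin_le_nhds
  refine squeeze_zero' (Eventually.of_forall fun _ => norm_nonneg _) ?_ hc
  filter_upwards [self_mem_nhdsWithin] with r hr
  exact Real.le_sqrt_of_sq_le (hB.norm_sub_timeVec_sq_le hK hHK j hr hs)

/-- The inner product of two increments is a rectangular increment of the covariance, so this is its
finite planar variation. -/
lemma IsMultiBifBm.exists_variation_le (hB : IsMultiBifBm T H K B P)
    (hH : ∀ i, H i ∈ Icc (0 : ℝ) 1) (hK : ∀ i, K i ∈ Ioc (0 : ℝ) 1)
    (hHK : ∀ i, 1 < 2 * H i * K i) (i : Fin d) {t : ℝ} (ht : t ∈ Icc 0 T) :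
    ∃ C : ℝ, 0 ≤ C ∧ ∀ n, ∑ k ∈ Finset.range (2 ^ n), ∑ l ∈ Finset.range (2 ^ n),
      |inner ℝ (incr (timeVec T B P i) t n k) (incr (timeVec T B P i) t n l)| ≤ C := by
  obtain ⟨C, hC0, hC⟩ := exists_sum_abs_rectIncr_bifCov_le (hH i).1 (hK i) (hHK i) t
  refine ⟨C, hC0, fun n => le_trans (le_of_eq ?_) (hC (dyadic t n) (2 ^ n) (dyadic_mono ht.1 n)
    (dyadic_zero t n) (dyadic_last t n))⟩
  have hsub : Icc 0 t ⊆ Icc 0 T := Icc_subset_Icc_right ht.2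
  refine Finset.sum_congr rfl fun k hk => Finset.sum_congr rfl fun l hl => ?_
  have k1 := hsub (dyadic_mem_of_mem_range ht.1 hk)
  have k2 := hsub (dyadic_succ_mem_of_mem_range ht.1 hk)
  have l1 := hsub (dyadic_mem_of_mem_range ht.1 hl)
  have l2 := hsub (dyadic_succ_mem_of_mem_range ht.1 hl)
  have gen : ∀ {F : Type _} [NormedAddCommGroup F] [InnerProductSpace ℝ F] (a b c e : F),
      inner ℝ (a - b) (c - e) = inner ℝ a c - inner ℝ a e - inner ℝ b c + inner ℝ b e := by
    intro F _ _ a b c e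
    rw [inner_sub_left, inner_sub_right, inner_sub_right]; ring
  congr 1
  refine (gen _ _ _ _).trans ?_
  rw [hB.inner_timeVec i k2 l2, hB.inner_timeVec i k2 l1, hB.inner_timeVec i k1 l2,
    hB.inner_timeVec i k1 l1, rectIncr]

/-- The Malliavin derivative of `g(s, B_s)`. -/
def derivCurve (T : ℝ) (B : Fin d → ℝ → Ω → ℝ) (P : Measure Ω) (g : ℝ → (Fin d → ℝ) → ℝ) (s : ℝ)
    (ω : Ω) : gaussianSpace T B P :=
  ∑ j, pderiv j (g s) (fun j => B j s ω) • timeVec T B P j s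

variable {g : ℝ → (Fin d → ℝ) → ℝ}

lemma IsAdmissible.continuous_pderiv (hg : IsAdmissible T g) {s : ℝ} (hs : s ∈ Icc 0 T)
    (j : Fin d) : Continuous (pderiv j (g s)) :=
  ((hg.diff s hs).continuous_fderiv one_ne_zero).clm_apply continuous_const

/-- The function `g s` is only `C¹` with polynomial growth, while smooth functionals ask for bounded
derivatives of all orders. Hence the value and the derivative are approximated at the same time. -/
lemma IsMultiBifBm.exists_smoothFunctional (hB : IsMultiBifBm T H K B P) (hg : IsAdmissible T g)
    {s : ℝ} (hs : s ∈ Icc 0 T) {ε : ℝ≥0∞} (hε : 0 < ε) :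
    ∃ F : SmoothFunctional (gaussianSpace T B P),
      eLpNorm (fun ω => F.val ω - g s (fun j => B j s ω)) 2 P ≤ ε ∧
      eLpNorm (fun ω => F.D ω - derivCurve T B P g s ω) 2 P ≤ ε := by
  obtain ⟨C, N, hC, hgr⟩ := hg.growth
  have hb : PolyBdd (g s) := ⟨C, N, fun x => (hgr s hs x).1⟩
  have hb' : PolyBdd (fderiv ℝ (g s)) := ⟨∑ _ : Fin d, C, N, fun x => by
    refine (norm_fderiv_le_sum_pderiv _ _).trans ?_
    rw [Finset.sum_mul]
    exact Finset.sum_le_sum fun j _ => (hgr s hs x).2 j⟩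
  -- The norm of the Malliavin derivative is at most `Λ` times that of the derivative of the
  -- function. The approximation is taken finer by the factor `1 + Λ`, which cannot vanish.
  set Λ : ℝ := ∑ j, ‖timeVec T B P j s‖ with hΛ
  have hΛ0 : 0 ≤ Λ := Finset.sum_nonneg fun _ _ => norm_nonneg _
  obtain ⟨h, h1, h2, h3, h4⟩ := exists_smooth_approx_gaussian (hB.hasGaussianLaw_vec hs)
    (hg.diff s hs) hb hb' (ε := ε / ENNReal.ofReal (1 + Λ))
    (ENNReal.div_pos hε.ne' ENNReal.ofReal_ne_top)
  have hone : (1 : ℝ≥0∞) ≤ ENNReal.ofReal (1 + Λ) := by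
    rw [← ENNReal.ofReal_one]; exact ENNReal.ofReal_le_ofReal (by linarith)
  have hne : ENNReal.ofReal (1 + Λ) ≠ 0 := (zero_lt_one.trans_le hone).ne'
  refine ⟨⟨d, h, h1, h2, fun j => timeVec T B P j s⟩, ?_, ?_⟩
  · refine le_trans (le_of_eq (eLpNorm_congr_ae ?_)) (h3.trans (ENNReal.div_le_of_le_mul
      (le_mul_of_one_le_right' hone)))
    filter_upwards [hB.ae_rv_timeVec hs] with ω hω
    change h (fun j => rv (timeVec T B P j s) ω) - _ = _
    rw [hω]
  · have key : ∀ᵐ ω ∂P, ‖SmoothFunctional.D ⟨d, h, h1, h2, fun j => timeVec T B P j s⟩ ω -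
        derivCurve T B P g s ω‖ ≤ (1 + Λ) *
        ‖‖fderiv ℝ h (fun j => B j s ω) - fderiv ℝ (g s) (fun j => B j s ω)‖‖ := by
      filter_upwards [hB.ae_rv_timeVec hs] with ω hω
      have e : SmoothFunctional.D ⟨d, h, h1, h2, fun j => timeVec T B P j s⟩ ω =
          ∑ j, fderiv ℝ h (fun j => B j s ω) (Pi.single j 1) • timeVec T B P j s := by
        change ∑ j, fderiv ℝ h (fun j => rv (timeVec T B P j s) ω) (Pi.single j 1) •
          timeVec T B P j s = _
        rw [hω]
      rw [e, derivCurve, ← Finset.sum_sub_distrib, norm_norm]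
      refine (norm_sum_le _ _).trans ?_
      refine le_trans ?_ (mul_le_mul_of_nonneg_right (by linarith : Λ ≤ 1 + Λ) (norm_nonneg _))
      rw [hΛ, Finset.sum_mul]
      refine Finset.sum_le_sum fun j _ => ?_
      rw [← sub_smul, norm_smul, mul_comm]
      refine mul_le_mul_of_nonneg_left ?_ (norm_nonneg _)
      have := (fderiv ℝ h (fun j => B j s ω) - fderiv ℝ (g s) (fun j => B j s ω)).le_opNorm
        (Pi.single j 1)
      rw [Pi.norm_single, norm_one, mul_one] at this
      exact this
    refine (eLpNorm_le_mul_eLpNorm_of_ae_le_mul key 2).trans ?_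
    refine (mul_le_mul_right h4 _).trans ?_
    rw [ENNReal.mul_div_cancel hne ENNReal.ofReal_ne_top]

lemma IsMultiBifBm.measurable_comp (hB : IsMultiBifBm T H K B P) (hg : IsAdmissible T g) {s : ℝ}
    (hs : s ∈ Icc 0 T) : Measurable fun ω => g s fun j => B j s ω :=
  (hg.diff s hs).continuous.measurable.comp (hB.measurable_vec hs)

lemma IsMultiBifBm.measurable_comp_pderiv (hB : IsMultiBifBm T H K B P) (hg : IsAdmissible T g)
    {s : ℝ} (hs : s ∈ Icc 0 T) (j : Fin d) :
    Measurable fun ω => pderiv j (g s) fun j => B j s ω :=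
  (hg.continuous_pderiv hs j).measurable.comp (hB.measurable_vec hs)

lemma IsMultiBifBm.stronglyMeasurable_derivCurve (hB : IsMultiBifBm T H K B P)
    (hg : IsAdmissible T g) {s : ℝ} (hs : s ∈ Icc 0 T) :
    StronglyMeasurable (derivCurve T B P g s) :=
  Finset.stronglyMeasurable_fun_sum _ fun j _ =>
    (hB.measurable_comp_pderiv hg hs j).stronglyMeasurable.smul_const _

lemma continuousOn_comp_path {u : ℝ → (Fin d → ℝ) → ℝ}
    (hu : ContinuousOn (fun p : ℝ × (Fin d → ℝ) => u p.1 p.2) (Icc 0 T ×ˢ univ))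
    {b : ℝ → Fin d → ℝ} (hb : ContinuousOn b (Icc 0 T)) :
    ContinuousOn (fun s => u s (b s)) (Icc 0 T) :=
  hu.comp (continuousOn_id.prodMk hb) fun _ hs => ⟨hs, mem_univ _⟩

lemma IsMultiBifBm.ae_continuousOn_derivCurve (hB : IsMultiBifBm T H K B P)
    (hK : ∀ i, K i ∈ Ioc (0 : ℝ) 1) (hHK : ∀ i, 1 < 2 * H i * K i) (hg : IsAdmissible T g) :
    ∀ᵐ ω ∂P, ContinuousOn (fun s => derivCurve T B P g s ω) (Icc 0 T) := by
  filter_upwards [hB.ae_continuousOn_vec] with ω hω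
  exact continuousOn_finsetSum _ fun j _ =>
    (continuousOn_comp_path (hg.cont_pderiv j) hω).smul (hB.continuousOn_timeVec hK hHK j)

lemma IsMultiBifBm.exists_eLpNorm_comp_le (hB : IsMultiBifBm T H K B P)
    (hHK : ∀ i, 1 < 2 * H i * K i) (hg : IsAdmissible T g) :
    ∃ M : ℝ≥0∞, M ≠ ∞ ∧ ∀ s ∈ Icc 0 T,
      eLpNorm (fun ω => g s fun j => B j s ω) 4 P ≤ M ∧ eLpNorm (derivCurve T B P g s) 4 P ≤ M := by
  obtain ⟨C, N, hC, hgr⟩ := hg.growth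
  obtain ⟨M, hM, h⟩ := hB.exists_eLpNorm_four_le hHK C N
  set Λ : ℝ := ∑ j, √(T ^ (2 * H j * K j))
  refine ⟨M + ENNReal.ofReal Λ * M, ENNReal.add_ne_top.2 ⟨hM, ENNReal.mul_ne_top
    ENNReal.ofReal_ne_top hM⟩, fun s hs => ⟨?_, ?_⟩⟩
  · exact ((eLpNorm_mono_real fun ω => (hgr s hs _).1).trans (h s hs)).trans le_self_add
  · refine le_trans ?_ le_add_self
    refine (eLpNorm_le_mul_eLpNorm_of_ae_le_mul (ae_of_all _ fun ω => ?_) 4).trans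
      (mul_le_mul_right (h s hs) _)
    rw [Real.norm_of_nonneg (by positivity), derivCurve, Finset.sum_mul]
    refine (norm_sum_le _ _).trans (Finset.sum_le_sum fun j _ => ?_)
    rw [norm_smul, mul_comm]
    exact mul_le_mul (Real.le_sqrt_of_sq_le (hB.norm_timeVec_sq_le hHK j hs)) ((hgr s hs _).2 j)
      (norm_nonneg _) (Real.sqrt_nonneg _)

end TimeCurves

/-! ### Divergence integrals of functions of the process -/

/-- The limit of a sequence converging in the mean is measurable with respect to the σ-algebra of
the sequence. -/
lemma aestronglyMeasurable_of_tendsto_eLpNorm {Ω : Type*} {m m₀ : MeasurableSpace Ω}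
    {P : Measure Ω} (hm : m ≤ m₀) {S : ℕ → Ω → ℝ} {G : Ω → ℝ} (hS : ∀ n, Measurable[m] (S n))
    (hG : AEStronglyMeasurable G P)
    (h : Tendsto (fun n => eLpNorm (fun ω => S n ω - G ω) 1 P) atTop (𝓝 0)) :
    AEStronglyMeasurable[m] G P := by
  obtain ⟨ns, -, hns⟩ := (tendstoInMeasure_of_tendsto_eLpNorm one_ne_zero
    (fun n => ((hS n).mono hm le_rfl).aestronglyMeasurable) hG h).exists_seq_tendsto_ae
  refine ⟨fun ω => limUnder atTop fun k => S (ns k) ω,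
    @StronglyMeasurable.limUnder _ _ _ m _ _ _ _ _ _ _ fun k =>
      (hS (ns k)).stronglyMeasurable, ?_⟩
  filter_upwards [hns] with ω hω
  exact hω.limUnder_eq.symm

/-- Cauchy sequences in `L²` from nearby ones. -/
lemma tendsto_eLpNorm_sub_prod {Ω E : Type*} [MeasurableSpace Ω] {P : Measure Ω}
    [NormedAddCommGroup E] {v a : ℕ → Ω → E} (hv : ∀ n, AEStronglyMeasurable (v n) P)
    (ha : ∀ n, AEStronglyMeasurable (a n) P)
    (hva : Tendsto (fun n => eLpNorm (fun ω => v n ω - a n ω) 2 P) atTop (𝓝 0))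
    (hc : ∀ ε : ℝ≥0∞, 0 < ε → ∃ N, ∀ n ≥ N, ∀ m,
      eLpNorm (fun ω => a n ω - a (n + m) ω) 2 P ≤ ε) :
    Tendsto (fun p : ℕ × ℕ => eLpNorm (fun ω => v p.1 ω - v p.2 ω) 2 P) (atTop ×ˢ atTop)
      (𝓝 0) := by
  refine ENNReal.tendsto_nhds_zero.2 fun ε hε => ?_
  have hε3 : 0 < ε / 3 := ENNReal.div_pos hε.ne' (by simp)
  obtain ⟨N, hN⟩ := hc (ε / 3) hε3
  obtain ⟨N', hN'⟩ := eventually_atTop.1 (ENNReal.tendsto_nhds_zero.1 hva (ε / 3) hε3)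
  have key : ∀ n ≥ max N N', ∀ m, eLpNorm (fun ω => v n ω - v (n + m) ω) 2 P ≤ ε := fun n hn m => by
    have e : (fun ω => v n ω - v (n + m) ω) = ((fun ω => v n ω - a n ω) +
        fun ω => a n ω - a (n + m) ω) - fun ω => v (n + m) ω - a (n + m) ω := by
      ext ω; simp only [Pi.sub_apply, Pi.add_apply]; abel
    rw [e, ← ENNReal.add_thirds ε]
    refine (eLpNorm_sub_le (((hv _).sub (ha _)).add ((ha _).sub (ha _))) ((hv _).sub (ha _))
      one_le_two).trans (add_le_add ((eLpNorm_add_le ((hv _).sub (ha _)) ((ha _).sub (ha _))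
      one_le_two).trans (add_le_add ?_ ?_)) ?_)
    · exact hN' n ((le_max_right _ _).trans hn)
    · exact hN n ((le_max_left _ _).trans hn) m
    · exact hN' _ (((le_max_right _ _).trans hn).trans (Nat.le_add_right _ _))
  filter_upwards [prod_mem_prod (Ici_mem_atTop (max N N')) (Ici_mem_atTop (max N N'))] with p hp
  rcases le_total p.1 p.2 with h | h
  · obtain ⟨m, hm⟩ := Nat.exists_eq_add_of_le h
    rw [hm]
    exact key _ hp.1 m
  · obtain ⟨m, hm⟩ := Nat.exists_eq_add_of_le h
    rw [hm]
    have := key _ hp.2 m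
    rwa [← eLpNorm_neg, show -(fun ω => v p.2 ω - v (p.2 + m) ω) =
      fun ω => v (p.2 + m) ω - v p.2 ω from by ext ω; simp] at this

lemma stronglyMeasurable_tmul_const {Ω E F : Type*} [MeasurableSpace Ω] [NormedAddCommGroup E]
    [InnerProductSpace ℝ E] [NormedAddCommGroup F] [InnerProductSpace ℝ F] {a : Ω → E}
    (ha : StronglyMeasurable a) (h : F) : StronglyMeasurable fun ω => a ω ⊗ₜ[ℝ] h := by
  have hc : Continuous fun x : E => x ⊗ₜ[ℝ] h :=
    ((TensorProduct.mk ℝ E F).flip h).mkContinuous ‖h‖ (fun x => by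
      rw [LinearMap.flip_apply, TensorProduct.mk_apply, TensorProduct.norm_tmul, mul_comm]) |>.cont
  exact hc.comp_stronglyMeasurable ha

section DivergenceIntegral

variable {Ω : Type*} [MeasurableSpace Ω] {P : Measure Ω} [IsProbabilityMeasure P]
  {d : ℕ} {T : ℝ} {H K : Fin d → ℝ} {B : Fin d → ℝ → Ω → ℝ} {g : ℝ → (Fin d → ℝ) → ℝ}

/-- The Riemann sums of the divergence integral of `g(s, B_s)` with respect to `Bⁱ`. -/
def divergenceSum (H K : Fin d → ℝ) (B : Fin d → ℝ → Ω → ℝ) (g : ℝ → (Fin d → ℝ) → ℝ) (i : Fin d)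
    (t : ℝ) (n : ℕ) (ω : Ω) : ℝ :=
  ∑ k ∈ Finset.range (2 ^ n),
    (g (dyadic t n k) (fun j => B j (dyadic t n k) ω) *
        (B i (dyadic t n (k + 1)) ω - B i (dyadic t n k) ω) -
      pderiv i (g (dyadic t n k)) (fun j => B j (dyadic t n k) ω) *
        (bifCov (H i) (K i) (dyadic t n k) (dyadic t n (k + 1)) -
          bifCov (H i) (K i) (dyadic t n k) (dyadic t n k)))

/-- The Riemann sums of the integrand as an element of the canonical Hilbert space. -/
def integrandSum (T : ℝ) (B : Fin d → ℝ → Ω → ℝ) (P : Measure Ω) (g : ℝ → (Fin d → ℝ) → ℝ)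
    (i : Fin d) (t : ℝ) (n : ℕ) (ω : Ω) : gaussianSpace T B P :=
  ∑ k ∈ Finset.range (2 ^ n),
    g (dyadic t n k) (fun j => B j (dyadic t n k) ω) • incr (timeVec T B P i) t n k

lemma measurable_divergenceSum (hg : IsAdmissible T g) (i : Fin d) {t : ℝ} (ht : t ∈ Icc 0 T)
    (n : ℕ) : Measurable[processSigma T B] (divergenceSum H K B g i t n) := by
  have hv : ∀ s ∈ Icc 0 T, Measurable[processSigma T B] fun ω j => B j s ω := fun s hs =>
    @measurable_pi_lambda _ _ _ (processSigma T B) _ _ fun j => measurable_processSigma j hs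
  refine @Finset.measurable_fun_sum _ _ _ _ _ _ (processSigma T B) _ _ fun k hk => ?_
  have h1 := Icc_subset_Icc_right ht.2 (dyadic_mem_of_mem_range ht.1 hk)
  have h2 := Icc_subset_Icc_right ht.2 (dyadic_succ_mem_of_mem_range ht.1 hk)
  have m1 := (hg.diff _ h1).continuous.measurable.comp (hv _ h1)
  have m2 := (hg.continuous_pderiv h1 i).measurable.comp (hv _ h1)
  have m3 := measurable_processSigma (T := T) (B := B) i h1
  have m4 := measurable_processSigma (T := T) (B := B) i h2
  exact (m1.mul (m4.sub m3)).sub (m2.mul_const _)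

lemma stronglyMeasurable_integrandSum (hB : IsMultiBifBm T H K B P) (hg : IsAdmissible T g)
    (i : Fin d) {t : ℝ} (ht : t ∈ Icc 0 T) (n : ℕ) :
    StronglyMeasurable (integrandSum T B P g i t n) :=
  Finset.stronglyMeasurable_fun_sum _ fun _ hk =>
    (hB.measurable_comp hg (Icc_subset_Icc_right ht.2
      (dyadic_mem_of_mem_range ht.1 hk))).stronglyMeasurable.smul_const _

/-- The `L¹` distance of the terms of two divergences. -/
lemma eLpNorm_mul_rv_sub_inner_le {𝓗 : Submodule ℝ (Lp ℝ 2 P)} {a : Ω → ℝ} {c : Ω → 𝓗} (b : 𝓗)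
    (ha : AEStronglyMeasurable a P) (hc : AEStronglyMeasurable c P) {ε : ℝ≥0∞}
    (h1 : eLpNorm a 2 P ≤ ε) (h2 : eLpNorm c 2 P ≤ ε) :
    eLpNorm (fun ω => a ω * rv b ω - inner ℝ (c ω) b) 1 P ≤ 2 * ENNReal.ofReal ‖b‖ * ε := by
  have hb : eLpNorm (rv b) 2 P = ENNReal.ofReal ‖b‖ := by
    have e : ‖b‖ = ‖(b : Lp ℝ 2 P)‖ := rfl
    rw [e, Lp.norm_def, ENNReal.ofReal_toReal (memLp_rv b).2.ne]
  have e1 : eLpNorm (fun ω => a ω * rv b ω) 1 P ≤ ε * ENNReal.ofReal ‖b‖ := by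
    have h : eLpNorm (a • rv b) 1 P ≤ eLpNorm a 2 P * eLpNorm (rv b) 2 P :=
      eLpNorm_smul_le_mul_eLpNorm (measurable_rv b).aestronglyMeasurable ha
    rw [hb] at h
    exact h.trans (mul_le_mul_left h1 _)
  have e2 : eLpNorm (fun ω => inner ℝ (c ω) b) 1 P ≤ ENNReal.ofReal ‖b‖ * ε := by
    refine (eLpNorm_le_mul_eLpNorm_of_ae_le_mul (c := ‖b‖) (g := c) (ae_of_all _ fun ω => ?_)
      1).trans (mul_le_mul_right ((eLpNorm_le_eLpNorm_of_exponent_le one_le_two hc).trans h2) _)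
    rw [mul_comm]
    exact abs_real_inner_le_norm _ _
  refine (eLpNorm_sub_le (ha.mul (measurable_rv b).aestronglyMeasurable)
    (hc.inner aestronglyMeasurable_const) le_rfl).trans ((add_le_add e1 e2).trans (le_of_eq ?_))
  ring

/-- Different components are orthogonal, so only the partial derivative in the direction `i`
survives. This identifies the correction term in `divergenceSum`. -/
lemma IsMultiBifBm.inner_derivCurve (hB : IsMultiBifBm T H K B P) (i : Fin d) {s r r' : ℝ}
    (hs : s ∈ Icc 0 T) (hr : r ∈ Icc 0 T) (hr' : r' ∈ Icc 0 T) (ω : Ω) :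
    inner ℝ (derivCurve T B P g s ω) (timeVec T B P i r - timeVec T B P i r') =
      pderiv i (g s) (fun j => B j s ω) *
        (bifCov (H i) (K i) s r - bifCov (H i) (K i) s r') := by
  have gen : ∀ {F : Type _} [NormedAddCommGroup F] [InnerProductSpace ℝ F] (a : Fin d → ℝ)
      (e : Fin d → F) (x y : F), inner ℝ (∑ j, a j • e j) (x - y) =
        ∑ j, a j * (inner ℝ (e j) x - inner ℝ (e j) y) := by
    intro F _ _ a e x y
    simp only [sum_inner, real_inner_smul_left, inner_sub_right, mul_sub,
      Finset.sum_sub_distrib]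
  refine (gen _ _ _ _).trans ?_
  rw [Finset.sum_eq_single i]
  · rw [hB.inner_timeVec i hs hr, hB.inner_timeVec i hs hr']
  · intro j _ hj
    rw [hB.inner_timeVec_of_ne hj hs hr, hB.inner_timeVec_of_ne hj hs hr', sub_zero, mul_zero]
  · simp

/-- The divergence sum in terms of the Gaussian space. -/
lemma IsMultiBifBm.divergenceSum_ae_eq (hB : IsMultiBifBm T H K B P) (i : Fin d) {t : ℝ}
    (ht : t ∈ Icc 0 T) (n : ℕ) : divergenceSum H K B g i t n =ᵐ[P] fun ω =>
      ∑ k ∈ Finset.range (2 ^ n),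
        (g (dyadic t n k) (fun j => B j (dyadic t n k) ω) *
          rv (incr (timeVec T B P i) t n k) ω -
          inner ℝ (derivCurve T B P g (dyadic t n k) ω) (incr (timeVec T B P i) t n k)) := by
  have h : ∀ᵐ ω ∂P, ∀ k ∈ Finset.range (2 ^ n), rv (incr (timeVec T B P i) t n k) ω =
      B i (dyadic t n (k + 1)) ω - B i (dyadic t n k) ω := by
    refine (ae_ball_iff (Finset.countable_toSet _)).2 fun k hk => ?_
    have h1 := Icc_subset_Icc_right ht.2 (dyadic_mem_of_mem_range ht.1 hk)
    have h2 := Icc_subset_Icc_right ht.2 (dyadic_succ_mem_of_mem_range ht.1 hk)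
    filter_upwards [rv_sub (timeVec T B P i (dyadic t n (k + 1))) (timeVec T B P i (dyadic t n k)),
      hB.rv_timeVec i h1, hB.rv_timeVec i h2] with ω e1 e2 e3
    rw [incr, e1, e2, e3]
  filter_upwards [h] with ω hω
  refine Finset.sum_congr rfl fun k hk => ?_
  have h1 := Icc_subset_Icc_right ht.2 (dyadic_mem_of_mem_range ht.1 hk)
  have h2 := Icc_subset_Icc_right ht.2 (dyadic_succ_mem_of_mem_range ht.1 hk)
  rw [hω k hk, incr, hB.inner_derivCurve i h1 h2 h1]

/-- The limit of the Riemann sums represents the integrand. -/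
lemma IsMultiBifBm.represents_of_tendsto (hB : IsMultiBifBm T H K B P)
    (hH : ∀ i, H i ∈ Icc (0 : ℝ) 1) (hK : ∀ i, K i ∈ Ioc (0 : ℝ) 1)
    (hHK : ∀ i, 1 < 2 * H i * K i) (i : Fin d) {t : ℝ} (ht : t ∈ Icc 0 T) {φ : ℝ → ℝ}
    (hφ : ContinuousOn φ (Icc 0 t)) {h : gaussianSpace T B P}
    (hh : Tendsto (fun n => ∑ k ∈ Finset.range (2 ^ n),
      φ (dyadic t n k) • incr (timeVec T B P i) t n k) atTop (𝓝 h)) :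
    Represents T H K B P i (fun s => (Icc 0 t).indicator φ s) h := by
  constructor
  · have hc : IsClosed (componentSpace T (B i) P : Set (Lp ℝ 2 P)) :=
      Submodule.isClosed_topologicalClosure _
    refine hc.mem_of_tendsto ((continuous_subtype_val.tendsto h).comp hh)
      (Eventually.of_forall fun n => ?_)
    simp only [Function.comp_apply, incr]
    rw [SetLike.mem_coe, Submodule.coe_sum]
    refine Submodule.sum_mem _ fun k _ => ?_
    rw [Submodule.coe_smul, Submodule.coe_sub]
    exact Submodule.smul_mem _ _ (Submodule.sub_mem _ (timeVec_mem_componentSpace _ _)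
      (timeVec_mem_componentSpace _ _))
  · intro r hr
    have hw0 := intervalIntegrable_deriv_bifCov (hH i) (hK i) (hHK i) hr le_rfl ht.1 ht.2
    have hT := hr.1.trans hr.2
    have hfun : (fun v => (Icc 0 t).indicator φ v * deriv (fun w => bifCov (H i) (K i) r w) v) =
        (Icc 0 t).indicator fun v => φ v * deriv (fun w => bifCov (H i) (K i) r w) v := by
      ext v
      rw [indicator_mul_left]
    have hφw : IntervalIntegrable (fun v => φ v * deriv (fun w => bifCov (H i) (K i) r w) v)
        volume 0 t := hw0.continuousOn_mul (by rwa [uIcc_of_le ht.1])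
    -- The left end point is a null set; interval integrals run over half-open intervals.
    have hae : ((Icc 0 t).indicator fun v => φ v * deriv (fun w => bifCov (H i) (K i) r w) v)
        =ᵐ[volume] (Ioc 0 t).indicator fun v => φ v * deriv (fun w => bifCov (H i) (K i) r w) v :=
      indicator_ae_eq_of_ae_eq_set Ioc_ae_eq_Icc.symm
    have hii : Integrable ((Ioc 0 t).indicator
        fun v => φ v * deriv (fun w => bifCov (H i) (K i) r w) v) volume :=
      (integrable_indicator_iff measurableSet_Ioc).2 hφw.1
    rw [hfun]
    refine ⟨(hii.congr hae.symm).intervalIntegrable, ?_⟩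
    have e1 : ∫ v in (0 : ℝ)..T, (Icc 0 t).indicator
        (fun v => φ v * deriv (fun w => bifCov (H i) (K i) r w) v) v =
        ∫ v in (0 : ℝ)..t, φ v * deriv (fun w => bifCov (H i) (K i) r w) v := by
      rw [intervalIntegral.integral_of_le hT, intervalIntegral.integral_of_le ht.1,
        integral_congr_ae (ae_restrict_of_ae hae), setIntegral_indicator measurableSet_Ioc,
        inter_eq_right.2 (Ioc_subset_Ioc_right ht.2)]
    have e2 : ∫ ω, (h : Lp ℝ 2 P) ω * B i r ω ∂P = inner ℝ h (timeVec T B P i r) := by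
      rw [inner_eq_integral]
      refine integral_congr_ae ?_
      filter_upwards [hB.rv_timeVec i hr] with ω hω
      rw [hω]
    rw [e1, e2]
    have gen : ∀ {F : Type _} [NormedAddCommGroup F] [InnerProductSpace ℝ F] (s : Finset ℕ)
        (a : ℕ → ℝ) (b c : ℕ → F) (y : F), inner ℝ (∑ k ∈ s, a k • (b k - c k)) y =
          ∑ k ∈ s, a k * (inner ℝ y (b k) - inner ℝ y (c k)) := by
      intro F _ _ s a b c y
      simp only [sum_inner, real_inner_smul_left, inner_sub_left]
      simp only [real_inner_comm]
    -- Paired with `1_[0,r]`, an increment gives an increment of `R(r, ·)`, that is, an integral of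
    -- its derivative. The pairings of the sums are thus Riemann sums for the required integral.
    have l1 : Tendsto (fun n => ∑ k ∈ Finset.range (2 ^ n), φ (dyadic t n k) *
        ∫ v in dyadic t n k..dyadic t n (k + 1), deriv (fun w => bifCov (H i) (K i) r w) v) atTop
        (𝓝 (inner ℝ h (timeVec T B P i r))) := by
      refine (hh.inner tendsto_const_nhds).congr fun n => (gen _ _ _ _ _).trans ?_
      refine Finset.sum_congr rfl fun k hk => ?_
      have h1 := dyadic_mem_of_mem_range ht.1 hk
      have h2 := dyadic_succ_mem_of_mem_range ht.1 hk
      rw [integral_deriv_bifCov (hH i) (hK i) (hHK i) hr h1.1 (dyadic_mono ht.1 n (Nat.le_succ k))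
        (h2.2.trans ht.2), hB.inner_timeVec i hr (Icc_subset_Icc_right ht.2 h1),
        hB.inner_timeVec i hr (Icc_subset_Icc_right ht.2 h2)]
    exact tendsto_nhds_unique l1 (tendsto_sum_mul_integral ht.1 hφ hw0)

/-- The smooth approximations of the Riemann sums. -/
def riemannProcess {𝓗 : Submodule ℝ (Lp ℝ 2 P)} (F : ℕ → SmoothFunctional 𝓗) (b : ℕ → 𝓗) (n : ℕ) :
    ElementaryProcess 𝓗 where
  m := 2 ^ n
  F := fun k => F k
  h := fun k => b k

set_option maxHeartbeats 1000000 in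
/-- Functions of the process of polynomial growth are in the domain of the divergence, and their
divergence is the limit of the divergence sums. -/
theorem IsMultiBifBm.exists_divergence (hB : IsMultiBifBm T H K B P)
    (hH : ∀ i, H i ∈ Icc (0 : ℝ) 1) (hK : ∀ i, K i ∈ Ioc (0 : ℝ) 1)
    (hHK : ∀ i, 1 < 2 * H i * K i) (hg : IsAdmissible T g) (i : Fin d) {t : ℝ}
    (ht : t ∈ Icc 0 T) :
    ∃ (U : Ω → gaussianSpace T B P) (G : Ω → ℝ), MemD12 U ∧ IsDivergence T B P i U G ∧
      (∀ᵐ ω ∂P, Represents T H K B P i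
        (fun s => (Icc 0 t).indicator (fun r => g r fun j => B j r ω) s) (U ω)) ∧
      Tendsto (fun n => eLpNorm (fun ω => divergenceSum H K B g i t n ω - G ω) 1 P) atTop
        (𝓝 0) := by
  have hsub : Icc 0 t ⊆ Icc 0 T := Icc_subset_Icc_right ht.2
  obtain ⟨C, hC0, hC⟩ := hB.exists_variation_le hH hK hHK i ht
  obtain ⟨M, hM, hM4⟩ := hB.exists_eLpNorm_comp_le hHK hg
  set b : ℕ → ℕ → gaussianSpace T B P := fun n k => incr (timeVec T B P i) t n k with hb
  set γ : ℝ≥0∞ := ENNReal.ofReal √C with hγ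
  have hγt : γ ≠ ∞ := ENNReal.ofReal_ne_top
  have hcg : ∀ᵐ ω ∂P, ContinuousOn (fun s => g s fun j => B j s ω) (Icc 0 t) := by
    filter_upwards [hB.ae_continuousOn_vec] with ω hω
    exact (continuousOn_comp_path hg.cont hω).mono hsub
  have hcd : ∀ᵐ ω ∂P, ContinuousOn (fun s => derivCurve T B P g s ω) (Icc 0 t) := by
    filter_upwards [hB.ae_continuousOn_derivCurve hK hHK hg] with ω hω
    exact hω.mono hsub
  have hmg : ∀ s ∈ Icc 0 t, AEStronglyMeasurable (fun ω => g s fun j => B j s ω) P := fun s hs =>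
    (hB.measurable_comp hg (hsub hs)).aestronglyMeasurable
  have hmd : ∀ s ∈ Icc 0 t, AEStronglyMeasurable (derivCurve T B P g s) P := fun s hs =>
    (hB.stronglyMeasurable_derivCurve hg (hsub hs)).aestronglyMeasurable
  set Φ := integrandSum T B P g i t with hΦ
  have hΦm : ∀ n, StronglyMeasurable (Φ n) := stronglyMeasurable_integrandSum hB hg i ht
  -- The limit is taken path by path, not only in `L²`, because the integrand has to be represented
  -- by `U ω` for almost every `ω`.
  set U : Ω → gaussianSpace T B P := fun ω => limUnder atTop fun n => Φ n ω with hU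
  have hlim : ∀ᵐ ω ∂P, Tendsto (fun n => Φ n ω) atTop (𝓝 (U ω)) := by
    filter_upwards [hcg] with ω hω
    exact (cauchySeq_riemann ht.1 hC hω).tendsto_limUnder
  have hUm : AEStronglyMeasurable U P :=
    aestronglyMeasurable_of_tendsto_ae atTop (fun n => (hΦm n).aestronglyMeasurable) hlim
  have heps : ∀ ε : ℝ≥0∞, 0 < ε → ∃ ε', 0 < ε' ∧ γ * ε' ≤ ε := fun ε hε =>
    ⟨ε / (γ + 1), ENNReal.div_pos hε.ne' (by simp [hγt]), by
      refine (mul_le_mul_left (le_self_add (b := 1)) _).trans (le_of_eq ?_)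
      exact ENNReal.mul_div_cancel (by simp) (by simp [hγt])⟩
  have hΦU : Tendsto (fun n => eLpNorm (fun ω => Φ n ω - U ω) 2 P) atTop (𝓝 0) := by
    refine ENNReal.tendsto_atTop_zero.2 fun ε hε => ?_
    obtain ⟨ε', hε', hle⟩ := heps ε hε
    obtain ⟨N, hN⟩ := exists_eLpNorm_riemann_smul_sub_le ht.1 hC hM hmg
      (fun s hs => (hM4 s (hsub hs)).1) hcg hε'
    refine ⟨N, fun n hn => le_trans ?_ hle⟩
    -- Fatou: the `L²` distance to the pathwise limit is at most the lower limit of the distances to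
    -- the finer sums.
    refine (Lp.eLpNorm_lim_le_liminf_eLpNorm (f := fun m ω => Φ n ω - Φ (n + m) ω)
      (fun m => ((hΦm n).sub (hΦm (n + m))).aestronglyMeasurable) _ ?_).trans ?_
    · filter_upwards [hlim] with ω hω
      exact tendsto_const_nhds.sub (hω.comp (tendsto_add_atTop_nat n |>.congr fun m =>
        Nat.add_comm m n))
    · exact (liminf_le_liminf (Eventually.of_forall fun m => hN n hn m)).trans
        (liminf_const _).le
  have hU2 : MemLp U 2 P := by
    obtain ⟨n, hn⟩ := (hΦU.eventually (gt_mem_nhds (zero_lt_one))).exists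
    have h1 : eLpNorm (Φ n) 2 P ≤ γ * M := eLpNorm_sum_smul_le _
      (fun k hk => hmg _ (dyadic_mem_of_mem_range ht.1 hk)) (hC n) fun k hk =>
      (eLpNorm_le_eLpNorm_of_exponent_le (by norm_num)
        (hmg _ (dyadic_mem_of_mem_range ht.1 hk))).trans
        (hM4 _ (hsub (dyadic_mem_of_mem_range ht.1 hk))).1
    have h2 : MemLp (Φ n) 2 P := ⟨(hΦm n).aestronglyMeasurable,
      h1.trans_lt (ENNReal.mul_lt_top hγt.lt_top hM.lt_top)⟩
    have h3 : MemLp (fun ω => Φ n ω - U ω) 2 P :=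
      ⟨(hΦm n).aestronglyMeasurable.sub hUm, hn.trans ENNReal.one_lt_top⟩
    have e : U = Φ n - fun ω => Φ n ω - U ω := by ext ω; simp
    rw [e]
    exact h2.sub h3
  -- The precision `4^(-n)` beats the `2^n` terms of the sum: the total error of the divergences is
  -- of order `2^(-n)`.
  choose F₀ hF₀ using fun (n : ℕ) (s : Icc (0 : ℝ) T) =>
    hB.exists_smoothFunctional hg s.2 (ε := ENNReal.ofReal (1 / 4 ^ n))
      (ENNReal.ofReal_pos.2 (by positivity))
  set F : ℕ → ℝ → SmoothFunctional (gaussianSpace T B P) := fun n s =>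
    F₀ n (projIcc 0 T (ht.1.trans ht.2) s) with hFdef
  have hF : ∀ n, ∀ s ∈ Icc 0 t, eLpNorm (fun ω => (F n s).val ω - g s fun j => B j s ω) 2 P ≤
      ENNReal.ofReal (1 / 4 ^ n) ∧ eLpNorm (fun ω => (F n s).D ω - derivCurve T B P g s ω) 2 P ≤
      ENNReal.ofReal (1 / 4 ^ n) := fun n s hs => by
    rw [hFdef]
    simp only [projIcc_of_mem _ (hsub hs)]
    exact hF₀ n ⟨s, hsub hs⟩
  set V : ℕ → ElementaryProcess (gaussianSpace T B P) := fun n =>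
    riemannProcess (fun k => F n (dyadic t n k)) (b n) n with hV
  have Vval : ∀ n ω, (V n).val ω =
      ∑ k ∈ Finset.range (2 ^ n), (F n (dyadic t n k)).val ω • b n k := fun n ω =>
    (Finset.sum_range fun k => (F n (dyadic t n k)).val ω • b n k).symm
  have VD : ∀ n ω, (V n).D ω =
      ∑ k ∈ Finset.range (2 ^ n), (F n (dyadic t n k)).D ω ⊗ₜ[ℝ] b n k := fun n ω =>
    (Finset.sum_range fun k => (F n (dyadic t n k)).D ω ⊗ₜ[ℝ] b n k).symm
  have Vdiv : ∀ n ω, (V n).div ω = ∑ k ∈ Finset.range (2 ^ n), ((F n (dyadic t n k)).val ω *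
      rv (b n k) ω - inner ℝ ((F n (dyadic t n k)).D ω) (b n k)) := fun n ω =>
    (Finset.sum_range fun k => ((F n (dyadic t n k)).val ω * rv (b n k) ω -
      inner ℝ ((F n (dyadic t n k)).D ω) (b n k))).symm
  have hFg : ∀ n, ∀ s ∈ Icc 0 t,
      AEStronglyMeasurable (fun ω => (F n s).val ω - g s fun j => B j s ω) P := fun n s hs =>
    (F n s).measurable_val.aestronglyMeasurable.sub (hmg s hs)
  have hFD : ∀ n, ∀ s ∈ Icc 0 t,
      AEStronglyMeasurable (fun ω => (F n s).D ω - derivCurve T B P g s ω) P := fun n s hs =>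
    (F n s).stronglyMeasurable_D.aestronglyMeasurable.sub (hmd s hs)
  have hγ0 : Tendsto (fun n : ℕ => γ * ENNReal.ofReal (1 / 4 ^ n)) atTop (𝓝 0) := by
    have h := (tendsto_pow_atTop_nhds_zero_of_lt_one (r := (1 / 4 : ℝ)) (by norm_num)
      (by norm_num))
    have h' := ENNReal.Tendsto.const_mul (a := γ) (ENNReal.tendsto_ofReal h) (Or.inr hγt)
    rw [ENNReal.ofReal_zero, mul_zero] at h'
    exact h'.congr fun n => by rw [one_div_pow]
  have hVΦ : ∀ n, eLpNorm (fun ω => (V n).val ω - Φ n ω) 2 P ≤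
      γ * ENNReal.ofReal (1 / 4 ^ n) := fun n => by
    have e : (fun ω => (V n).val ω - Φ n ω) = fun ω => ∑ k ∈ Finset.range (2 ^ n),
        ((F n (dyadic t n k)).val ω - g (dyadic t n k) fun j => B j (dyadic t n k) ω) • b n k := by
      ext1 ω
      simp only [Vval, hΦ, integrandSum, sub_smul, Finset.sum_sub_distrib, hb]
    rw [e]
    exact eLpNorm_sum_smul_le _ (fun k hk => hFg n _ (dyadic_mem_of_mem_range ht.1 hk)) (hC n)
      fun k hk => (hF n _ (dyadic_mem_of_mem_range ht.1 hk)).1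
  have h1 : Tendsto (fun n => eLpNorm (fun ω => (V n).val ω - U ω) 2 P) atTop (𝓝 0) := by
    have hs := hγ0.add hΦU
    rw [add_zero] at hs
    refine tendsto_of_tendsto_of_tendsto_of_le_of_le tendsto_const_nhds hs (fun _ => zero_le) fun n => ?_
    have e : (fun ω => (V n).val ω - U ω) =
        (fun ω => (V n).val ω - Φ n ω) + fun ω => Φ n ω - U ω := by ext ω; simp
    change eLpNorm (fun ω => (V n).val ω - U ω) 2 P ≤ _
    rw [e]
    exact (eLpNorm_add_le ((V n).stronglyMeasurable_val.sub (hΦm n)).aestronglyMeasurable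
      ((hΦm n).aestronglyMeasurable.sub hUm) one_le_two).trans (add_le_add (hVΦ n) le_rfl)
  -- The Riemann sums of the derivative. Their limit lies in general in the completion of the tensor
  -- product only, so they are shown to be Cauchy and no limit is named.
  set Ψ : ℕ → Ω → gaussianSpace T B P ⊗[ℝ] gaussianSpace T B P := fun n ω =>
    ∑ k ∈ Finset.range (2 ^ n), derivCurve T B P g (dyadic t n k) ω ⊗ₜ[ℝ] b n k with hΨ
  have h2 : Tendsto (fun p : ℕ × ℕ => eLpNorm (fun ω => (V p.1).D ω - (V p.2).D ω) 2 P)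
      (atTop ×ˢ atTop) (𝓝 0) := by
    refine tendsto_eLpNorm_sub_prod (v := fun n => (V n).D) (a := Ψ) (fun n => ?_) (fun n => ?_) ?_ fun ε hε => ?_
    · exact (Finset.stronglyMeasurable_fun_sum _ fun k _ => stronglyMeasurable_tmul_const
        ((V n).F k).stronglyMeasurable_D _).aestronglyMeasurable
    · exact (Finset.stronglyMeasurable_fun_sum _ fun k hk => stronglyMeasurable_tmul_const
        (hB.stronglyMeasurable_derivCurve hg
          (hsub (dyadic_mem_of_mem_range ht.1 hk))) _).aestronglyMeasurable
    · refine tendsto_of_tendsto_of_tendsto_of_le_of_le tendsto_const_nhds hγ0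
        (fun _ => zero_le) fun n => ?_
      have e : (fun ω => (V n).D ω - Ψ n ω) = fun ω => ∑ k ∈ Finset.range (2 ^ n),
          ((F n (dyadic t n k)).D ω - derivCurve T B P g (dyadic t n k) ω) ⊗ₜ[ℝ] b n k := by
        ext1 ω
        simp only [VD, hΨ, TensorProduct.sub_tmul, Finset.sum_sub_distrib]
      change eLpNorm (fun ω => (V n).D ω - Ψ n ω) 2 P ≤ _
      rw [e]
      exact eLpNorm_sum_tmul_le _ (fun k hk => hFD n _ (dyadic_mem_of_mem_range ht.1 hk)) (hC n)
        fun k hk => (hF n _ (dyadic_mem_of_mem_range ht.1 hk)).2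
    · obtain ⟨ε', hε', hle⟩ := heps ε hε
      obtain ⟨N, hN⟩ := exists_eLpNorm_riemann_tmul_sub_le ht.1 hC hM hmd
        (fun s hs => (hM4 s (hsub hs)).2) hcd hε'
      exact ⟨N, fun n hn m => (hN n hn m).trans hle⟩
  obtain ⟨G, hG, hdual⟩ := exists_tendsto_div hB.isGaussianHilbert hU2 h1 h2
  have hbC : ∀ n, ∀ k ∈ Finset.range (2 ^ n), ‖b n k‖ ≤ √C := fun n k hk => by
    refine Real.le_sqrt_of_sq_le ?_
    rw [← real_inner_self_eq_norm_sq (b n k)]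
    refine (le_abs_self _).trans (le_trans ?_ (hC n))
    refine le_trans ?_ (Finset.single_le_sum (f := fun k => ∑ l ∈ Finset.range (2 ^ n),
      |inner ℝ (b n k) (b n l)|) (fun _ _ => Finset.sum_nonneg fun _ _ => abs_nonneg _) hk)
    exact Finset.single_le_sum (f := fun l => |inner ℝ (b n k) (b n l)|)
      (fun _ _ => abs_nonneg _) hk
  have hSm : ∀ n, Measurable (divergenceSum H K B g i t n) := fun n =>
    (measurable_divergenceSum hg i ht n).mono hB.processSigma_le le_rfl
  have hdm : ∀ n, AEStronglyMeasurable (V n).div P := fun n =>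
    ((V n).hasMoments_div hB.isGaussianHilbert 1 (by simp)).1
  -- The summands contain products of an `L²` error with an `L²` increment, so the comparison is
  -- made in `L¹`.
  have hVS : ∀ n, eLpNorm (fun ω => divergenceSum H K B g i t n ω - (V n).div ω) 1 P ≤
      ENNReal.ofReal (2 * √C / 2 ^ n) := fun n => by
    have e : (fun ω => divergenceSum H K B g i t n ω - (V n).div ω) =ᵐ[P]
        -∑ k ∈ Finset.range (2 ^ n), fun ω => (((F n (dyadic t n k)).val ω -
          g (dyadic t n k) fun j => B j (dyadic t n k) ω) * rv (b n k) ω -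
          inner ℝ ((F n (dyadic t n k)).D ω - derivCurve T B P g (dyadic t n k) ω) (b n k)) := by
      filter_upwards [hB.divergenceSum_ae_eq (g := g) i ht n] with ω hω
      rw [hω, Vdiv, Pi.neg_apply, Finset.sum_apply, ← Finset.sum_sub_distrib,
        ← Finset.sum_neg_distrib]
      refine Finset.sum_congr rfl fun k _ => ?_
      have := inner_sub_left (𝕜 := ℝ) ((F n (dyadic t n k)).D ω)
        (derivCurve T B P g (dyadic t n k) ω) (b n k)
      rw [this]
      ring
    rw [eLpNorm_congr_ae e, eLpNorm_neg]
    refine (eLpNorm_sum_le (fun k hk => ?_) le_rfl).trans ((Finset.sum_le_sum fun k hk =>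
      (eLpNorm_mul_rv_sub_inner_le (b n k) (hFg n _ (dyadic_mem_of_mem_range ht.1 hk))
        (hFD n _ (dyadic_mem_of_mem_range ht.1 hk))
        (hF n _ (dyadic_mem_of_mem_range ht.1 hk)).1
        (hF n _ (dyadic_mem_of_mem_range ht.1 hk)).2).trans
      (mul_le_mul_left (mul_le_mul_right (ENNReal.ofReal_le_ofReal (hbC n k hk)) _) _)).trans ?_)
    · exact ((hFg n _ (dyadic_mem_of_mem_range ht.1 hk)).mul
        (measurable_rv _).aestronglyMeasurable).sub
        ((hFD n _ (dyadic_mem_of_mem_range ht.1 hk)).inner aestronglyMeasurable_const)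
    · rw [Finset.sum_const, Finset.card_range, nsmul_eq_mul]
      have e2 : (2 : ℝ≥0∞) = ENNReal.ofReal 2 := by simp
      have e3 : ((2 ^ n : ℕ) : ℝ≥0∞) = ENNReal.ofReal (2 ^ n) := by
        rw [ENNReal.ofReal_pow (by norm_num)]; simp
      rw [e3, e2, ← ENNReal.ofReal_mul (by norm_num), ← ENNReal.ofReal_mul (by positivity),
        ← ENNReal.ofReal_mul (by positivity)]
      refine ENNReal.ofReal_le_ofReal (le_of_eq ?_)
      have : (4 : ℝ) ^ n = 2 ^ n * 2 ^ n := by rw [← mul_pow]; norm_num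
      rw [this]
      field_simp
  have hGm : AEStronglyMeasurable G P := (Lp.memLp G).1
  have hSG : Tendsto (fun n => eLpNorm (fun ω => divergenceSum H K B g i t n ω - G ω) 1 P) atTop
      (𝓝 0) := by
    have h3 := ENNReal.tendsto_ofReal (tendsto_div_two_pow (2 * √C))
    rw [ENNReal.ofReal_zero] at h3
    have hs := h3.add hG
    rw [add_zero] at hs
    refine tendsto_of_tendsto_of_tendsto_of_le_of_le tendsto_const_nhds hs (fun _ => zero_le) fun n => ?_
    have e : (fun ω => divergenceSum H K B g i t n ω - G ω) =
        (fun ω => divergenceSum H K B g i t n ω - (V n).div ω) + fun ω => (V n).div ω - G ω := by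
      ext ω; simp
    change eLpNorm (fun ω => divergenceSum H K B g i t n ω - G ω) 1 P ≤ _
    rw [e]
    exact (eLpNorm_add_le ((hSm n).aestronglyMeasurable.sub (hdm n)) ((hdm n).sub hGm)
      le_rfl).trans (add_le_add (hVS n) (eLpNorm_le_eLpNorm_of_exponent_le one_le_two
      ((hdm n).sub hGm)))
  have hrep : ∀ᵐ ω ∂P, Represents T H K B P i
      (fun s => (Icc 0 t).indicator (fun r => g r fun j => B j r ω) s) (U ω) := by
    filter_upwards [hlim, hcg] with ω h3 h4
    exact hB.represents_of_tendsto hH hK hHK i ht h4 h3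
  exact ⟨U, G, ⟨hU2, V, h1, h2⟩, ⟨hU2, hrep.mono fun ω h => h.1, Lp.memLp G,
    aestronglyMeasurable_of_tendsto_eLpNorm hB.processSigma_le
      (measurable_divergenceSum hg i ht) hGm hSG, hdual⟩, hrep, hSG⟩

end DivergenceIntegral

/-! ### The pathwise expansion -/

section Taylor

variable {d : ℕ}

lemma contDiff_pderiv {φ : (Fin d → ℝ) → ℝ} (hφ : ContDiff ℝ 2 φ) (j : Fin d) :
    ContDiff ℝ 1 (pderiv j φ) :=
  (hφ.fderiv_right (m := 1) (by norm_num)).clm_apply contDiff_const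

/-- The mean value inequality is used twice, for the `∂ⱼφ` and then for `φ` minus its linear part.
Each use sums over `d` coordinates, whence the two factors `d`. -/
lemma abs_taylor_le {φ : (Fin d → ℝ) → ℝ} (hφ : ContDiff ℝ 2 φ) {R M : ℝ} (hM : 0 ≤ M)
    (h : ∀ x ∈ Metric.closedBall (0 : Fin d → ℝ) R, ∀ i j, |pderiv i (pderiv j φ) x| ≤ M)
    {x y : Fin d → ℝ} (hx : x ∈ Metric.closedBall (0 : Fin d → ℝ) R)
    (hy : y ∈ Metric.closedBall (0 : Fin d → ℝ) R) :
    |φ y - φ x - ∑ j, pderiv j φ x * (y j - x j)| ≤ d * (d * M) * ∑ j, (y j - x j) ^ 2 := by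
  have hd : Differentiable ℝ φ := hφ.differentiable two_ne_zero
  have hseg : segment ℝ x y ⊆ Metric.closedBall (0 : Fin d → ℝ) R :=
    (convex_closedBall _ _).segment_subset hx hy
  have h1 : ∀ z ∈ segment ℝ x y, ∀ j, |pderiv j φ z - pderiv j φ x| ≤ d * M * ‖y - x‖ := by
    intro z hz j
    have hb := (convex_closedBall (0 : Fin d → ℝ) R).norm_image_sub_le_of_norm_fderiv_le (𝕜 := ℝ)
      (f := pderiv j φ) (C := d * M)
      (fun w _ => ((contDiff_pderiv hφ j).differentiable one_ne_zero) w)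
      (fun w hw => (norm_fderiv_le_sum_pderiv _ _).trans ((Finset.sum_le_sum fun i _ =>
        h w hw i j).trans (by simp))) hx (hseg hz)
    refine hb.trans (mul_le_mul_of_nonneg_left ?_ (by positivity))
    rw [← dist_eq_norm, ← dist_eq_norm]
    have := dist_add_dist_of_mem_segment hz
    rw [dist_comm z x, dist_comm y x]
    linarith [dist_nonneg (x := z) (y := y)]
  have h2 : ∀ z ∈ segment ℝ x y, ‖fderiv ℝ φ z - fderiv ℝ φ x‖ ≤ d * (d * M) * ‖y - x‖ := by
    intro z hz
    refine ContinuousLinearMap.opNorm_le_bound _ (by positivity) fun v => ?_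
    rw [sub_apply, fderiv_apply_eq_sum_pderiv, fderiv_apply_eq_sum_pderiv,
      ← Finset.sum_sub_distrib]
    refine (norm_sum_le _ _).trans ((Finset.sum_le_sum (g := fun _ => d * M * ‖y - x‖ * ‖v‖)
      fun j _ => ?_).trans (le_of_eq (by simp; ring)))
    rw [← mul_sub, norm_mul, mul_comm]
    exact mul_le_mul (h1 z hz j) (norm_le_pi_norm v j) (norm_nonneg _) (by positivity)
  have h3 := (convex_segment x y).norm_image_sub_le_of_norm_fderiv_le' (𝕜 := ℝ) (f := φ)
    (fun w _ => hd w) h2 (left_mem_segment ℝ x y) (right_mem_segment ℝ x y)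
  have e : fderiv ℝ φ x (y - x) = ∑ j, pderiv j φ x * (y j - x j) := by
    rw [fderiv_apply_eq_sum_pderiv]
    exact Finset.sum_congr rfl fun j _ => mul_comm _ _
  rw [e, mul_assoc, ← pow_two] at h3
  refine h3.trans (mul_le_mul_of_nonneg_left ?_ (by positivity))
  have h4 : ‖y - x‖ ≤ √(∑ j, (y j - x j) ^ 2) :=
    (pi_norm_le_iff_of_nonneg (Real.sqrt_nonneg _)).2 fun j => Real.abs_le_sqrt
      (Finset.single_le_sum (f := fun j => (y j - x j) ^ 2) (fun _ _ => sq_nonneg _)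
        (Finset.mem_univ j))
  calc ‖y - x‖ ^ 2 ≤ √(∑ j, (y j - x j) ^ 2) ^ 2 := by gcongr
    _ = _ := Real.sq_sqrt (Finset.sum_nonneg fun _ _ => sq_nonneg _)

end Taylor

/-! ### Time, trace and quadratic terms along dyadic partitions -/

section Pathwise

variable {d : ℕ} {T : ℝ} {f : ℝ → (Fin d → ℝ) → ℝ} {t : ℝ} {b : ℝ → Fin d → ℝ}

/-- The time increments along a path. -/
lemma IsC12.tendsto_sum_time (hf : IsC12 T f) (ht : t ∈ Icc 0 T) (hb : ContinuousOn b (Icc 0 T)) :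
    Tendsto (fun n => ∑ k ∈ Finset.range (2 ^ n),
      (f (dyadic t n (k + 1)) (b (dyadic t n (k + 1))) -
        f (dyadic t n k) (b (dyadic t n (k + 1))))) atTop
      (𝓝 (∫ s in (0 : ℝ)..t, timeDeriv T f s (b s))) := by
  have hsub : Icc 0 t ⊆ Icc 0 T := Icc_subset_Icc_right ht.2
  -- The time and the position on the path are kept as separate variables: within a dyadic interval
  -- time moves while the path is frozen at the right end point. Joint uniform continuity compares
  -- this with both moving together.
  have hψ : ContinuousOn (fun p : ℝ × ℝ => timeDeriv T f p.1 (b p.2)) (Icc 0 t ×ˢ Icc 0 t) :=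
    hf.cont_time.comp (continuousOn_fst.prodMk (hb.comp continuousOn_snd fun p hp => hsub hp.2))
      fun p hp => ⟨hsub hp.1, mem_univ _⟩
  have hcx : ∀ x, ContinuousOn (fun r => timeDeriv T f r x) (Icc 0 T) := fun x =>
    continuousOn_comp_path hf.cont_time continuousOn_const
  have hcb : ContinuousOn (fun r => timeDeriv T f r (b r)) (Icc 0 t) :=
    (continuousOn_comp_path hf.cont_time hb).mono hsub
  have hii : ∀ {u v : ℝ} {w : ℝ → ℝ}, 0 ≤ u → u ≤ v → v ≤ t → ContinuousOn w (Icc 0 t) →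
      IntervalIntegrable w volume u v := fun hu huv hv hw =>
    (hw.mono (by rw [uIcc_of_le huv]; exact Icc_subset_Icc hu hv)).intervalIntegrable
  have ftc : ∀ (x : Fin d → ℝ) (u v : ℝ), 0 ≤ u → u ≤ v → v ≤ t →
      f v x - f u x = ∫ r in u..v, timeDeriv T f r x := fun x u v hu huv hv => by
    refine (intervalIntegral.integral_eq_sub_of_hasDerivAt_of_le huv
      ((hf.diff_time x).continuousOn.mono (Icc_subset_Icc hu (hv.trans ht.2))) (fun r hr => ?_)
      (hii hu huv hv ((hcx x).mono hsub))).symm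
    have hr' : r ∈ Icc 0 T := ⟨hu.trans hr.1.le, hr.2.le.trans (hv.trans ht.2)⟩
    exact ((hf.diff_time x) r hr').hasDerivWithinAt.hasDerivAt
      (Icc_mem_nhds (hu.trans_lt hr.1) (hr.2.trans_le (hv.trans ht.2)))
  rw [Metric.tendsto_atTop]
  intro ε hε
  obtain ⟨δ, hδ, h⟩ := Metric.uniformContinuousOn_iff_le.1
    ((isCompact_Icc.prod isCompact_Icc).uniformContinuousOn_of_continuous hψ) (ε / (2 * (t + 1)))
    (by have := ht.1; positivity)
  obtain ⟨N, hN⟩ := eventually_atTop.1 ((tendsto_div_two_pow t).eventually (gt_mem_nhds hδ))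
  refine ⟨N, fun n hn => ?_⟩
  have e1 : ∫ s in (0 : ℝ)..t, timeDeriv T f s (b s) = ∑ k ∈ Finset.range (2 ^ n),
      ∫ s in dyadic t n k..dyadic t n (k + 1), timeDeriv T f s (b s) := by
    rw [intervalIntegral.sum_integral_adjacent_intervals (a := dyadic t n) (n := 2 ^ n)
      fun k hk => hii (dyadic_mem_of_mem_range ht.1 (Finset.mem_range.2 hk)).1
        (dyadic_mono ht.1 n (Nat.le_succ k))
        (dyadic_succ_mem_of_mem_range ht.1 (Finset.mem_range.2 hk)).2 hcb,
      dyadic_zero, dyadic_last]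
  rw [e1, dist_eq_norm, ← Finset.sum_sub_distrib]
  refine lt_of_le_of_lt ((norm_sum_le _ _).trans (Finset.sum_le_sum
    (g := fun k => ε / (2 * (t + 1)) * (t / 2 ^ n)) fun k hk => ?_)) ?_
  · have h1 := dyadic_mem_of_mem_range ht.1 hk
    have h2 := dyadic_succ_mem_of_mem_range ht.1 hk
    have hle := dyadic_mono ht.1 n (Nat.le_succ k)
    have hstep := dyadic_succ_sub t n k
    rw [ftc _ _ _ h1.1 hle h2.2, ← intervalIntegral.integral_sub
      (hii h1.1 hle h2.2 ((hcx _).mono hsub)) (hii h1.1 hle h2.2 hcb)]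
    refine (intervalIntegral.norm_integral_le_of_norm_le_const (C := ε / (2 * (t + 1)))
      fun r hr => ?_).trans (le_of_eq ?_)
    · rw [uIoc_of_le hle] at hr
      have hr' : r ∈ Icc 0 t := ⟨h1.1.trans hr.1.le, hr.2.trans h2.2⟩
      rw [← dist_eq_norm]
      refine h (r, _) ⟨hr', h2⟩ (r, r) ⟨hr', hr'⟩ ?_
      rw [Prod.dist_eq, dist_self, max_eq_right dist_nonneg]
      change dist (dyadic t n (k + 1)) r ≤ δ
      rw [Real.dist_eq, abs_of_nonneg (by linarith [hr.2])]
      linarith [hN n hn, hr.1]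
    · rw [hstep, abs_of_nonneg (by have := ht.1; positivity)]
  · rw [Finset.sum_const, Finset.card_range, nsmul_eq_mul]
    have e2 : ((2 ^ n : ℕ) : ℝ) * (ε / (2 * (t + 1)) * (t / 2 ^ n)) = ε * t / (2 * (t + 1)) := by
      push_cast; field_simp
    have ht0 := ht.1
    rw [e2, div_lt_iff₀ (by positivity)]
    nlinarith

variable {Ω : Type*} [MeasurableSpace Ω] {P : Measure Ω} [IsProbabilityMeasure P]
  {H K : Fin d → ℝ} {B : Fin d → ℝ → Ω → ℝ}

/-- Polarization, with `R(s, s) = s^(2HK)`. The increment of the variance produces the trace term of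
the formula; the squared norm is negligible after summation. -/
lemma IsMultiBifBm.bifCov_sub_eq (hB : IsMultiBifBm T H K B P) (hHK : ∀ i, 1 < 2 * H i * K i)
    (i : Fin d) {s r : ℝ} (hs : s ∈ Icc 0 T) (hr : r ∈ Icc 0 T) :
    bifCov (H i) (K i) s r - bifCov (H i) (K i) s s =
      (r ^ (2 * H i * K i) - s ^ (2 * H i * K i)) / 2 -
        ‖timeVec T B P i r - timeVec T B P i s‖ ^ 2 / 2 := by
  have e : ‖timeVec T B P i r - timeVec T B P i s‖ ^ 2 =
      ‖timeVec T B P i r‖ ^ 2 - 2 * inner ℝ (timeVec T B P i r) (timeVec T B P i s) +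
        ‖timeVec T B P i s‖ ^ 2 := norm_sub_sq_real (timeVec T B P i r) (timeVec T B P i s)
  rw [e, ← real_inner_self_eq_norm_sq (timeVec T B P i r),
    ← real_inner_self_eq_norm_sq (timeVec T B P i s), hB.inner_timeVec i hr hr,
    hB.inner_timeVec i hr hs, hB.inner_timeVec i hs hs, bifCov_comm r s, ← bifCov_self hs.1 (hHK i),
    ← bifCov_self hr.1 (hHK i)]
  ring

/-- Each of the `2^n` terms is at most `2 (t / 2^n)^(2HK)`, and `2HK > 1` leaves a positive power of
the mesh after summation. -/
lemma IsMultiBifBm.tendsto_sum_norm_incr_sq (hB : IsMultiBifBm T H K B P)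
    (hK : ∀ i, K i ∈ Ioc (0 : ℝ) 1) (hHK : ∀ i, 1 < 2 * H i * K i) (i : Fin d) (ht : t ∈ Icc 0 T) :
    Tendsto (fun n => ∑ k ∈ Finset.range (2 ^ n), ‖incr (timeVec T B P i) t n k‖ ^ 2) atTop
      (𝓝 0) := by
  set p := 2 * H i * K i with hp
  have hp1 : 0 < p - 1 := by linarith [hHK i]
  have hlim : Tendsto (fun n : ℕ => 2 * t * (t / 2 ^ n) ^ (p - 1)) atTop (𝓝 0) := by
    have h := ((Real.continuousAt_rpow_const 0 (p - 1) (Or.inr hp1.le)).tendsto.comp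
      (tendsto_div_two_pow t)).const_mul (2 * t)
    rwa [Real.zero_rpow hp1.ne', mul_zero] at h
  refine squeeze_zero (fun n => Finset.sum_nonneg fun _ _ => sq_nonneg _) (fun n => ?_) hlim
  have hx : 0 ≤ t / 2 ^ n := div_nonneg ht.1 (by positivity)
  calc ∑ k ∈ Finset.range (2 ^ n), ‖incr (timeVec T B P i) t n k‖ ^ 2
      ≤ ∑ k ∈ Finset.range (2 ^ n), 2 * (t / 2 ^ n) ^ p := by
        refine Finset.sum_le_sum fun k hk => ?_
        have h := hB.norm_sub_timeVec_sq_le hK hHK i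
          (Icc_subset_Icc_right ht.2 (dyadic_succ_mem_of_mem_range ht.1 hk))
          (Icc_subset_Icc_right ht.2 (dyadic_mem_of_mem_range ht.1 hk))
        rwa [dyadic_succ_sub, abs_of_nonneg hx] at h
    _ = 2 * t * (t / 2 ^ n) ^ (p - 1) := by
        have e : (t / 2 ^ n) ^ p = t / 2 ^ n * (t / 2 ^ n) ^ (p - 1) := by
          rw [← Real.rpow_one_add' hx (by linarith)]
          congr 1; ring
        rw [Finset.sum_const, Finset.card_range, nsmul_eq_mul, e]
        push_cast
        field_simp

/-- The trace terms along a path. -/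
lemma IsMultiBifBm.tendsto_sum_trace (hB : IsMultiBifBm T H K B P)
    (hK : ∀ i, K i ∈ Ioc (0 : ℝ) 1) (hHK : ∀ i, 1 < 2 * H i * K i) (i : Fin d) (ht : t ∈ Icc 0 T)
    {φ : ℝ → ℝ} (hφ : ContinuousOn φ (Icc 0 t)) :
    Tendsto (fun n => ∑ k ∈ Finset.range (2 ^ n), φ (dyadic t n k) *
      (bifCov (H i) (K i) (dyadic t n k) (dyadic t n (k + 1)) -
        bifCov (H i) (K i) (dyadic t n k) (dyadic t n k))) atTop
      (𝓝 (H i * K i * ∫ s in (0 : ℝ)..t, φ s * s ^ (2 * H i * K i - 1))) := by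
  set p := 2 * H i * K i with hp
  have hp1 : 0 < p - 1 := by linarith [hHK i]
  -- The derivative of the variance `s^p`; half of it is `HK s^(2HK-1)`.
  have hw : Continuous fun s : ℝ => p * s ^ (p - 1) :=
    continuous_const.mul (Real.continuous_rpow_const hp1.le)
  have h1 := tendsto_sum_mul_integral ht.1 hφ (hw.intervalIntegrable 0 t)
  obtain ⟨M, hM⟩ := isCompact_Icc.exists_bound_of_continuousOn hφ
  have h2 : Tendsto (fun n => ∑ k ∈ Finset.range (2 ^ n), φ (dyadic t n k) *
      ‖incr (timeVec T B P i) t n k‖ ^ 2) atTop (𝓝 0) := by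
    have h := (hB.tendsto_sum_norm_incr_sq hK hHK i ht).const_mul M
    rw [mul_zero] at h
    refine squeeze_zero_norm (fun n => ?_) h
    rw [Finset.mul_sum]
    refine (norm_sum_le _ _).trans (Finset.sum_le_sum fun k hk => ?_)
    rw [norm_mul, norm_pow, norm_norm]
    exact mul_le_mul_of_nonneg_right (hM _ (dyadic_mem_of_mem_range ht.1 hk)) (sq_nonneg _)
  have h3 := (h1.const_mul (1 / 2)).sub (h2.const_mul (1 / 2))
  have e : 1 / 2 * (∫ v in (0 : ℝ)..t, φ v * (p * v ^ (p - 1))) - 1 / 2 * 0 =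
      H i * K i * ∫ s in (0 : ℝ)..t, φ s * s ^ (p - 1) := by
    rw [mul_zero, sub_zero, ← intervalIntegral.integral_const_mul,
      ← intervalIntegral.integral_const_mul]
    congr 1
    ext v
    rw [hp]; ring
  rw [e] at h3
  refine h3.congr fun n => ?_
  rw [Finset.mul_sum, Finset.mul_sum, ← Finset.sum_sub_distrib]
  refine Finset.sum_congr rfl fun k hk => ?_
  have k1 := dyadic_mem_of_mem_range ht.1 hk
  have k2 := dyadic_succ_mem_of_mem_range ht.1 hk
  have e2 : ∫ v in dyadic t n k..dyadic t n (k + 1), p * v ^ (p - 1) =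
      dyadic t n (k + 1) ^ p - dyadic t n k ^ p := by
    rw [intervalIntegral.integral_const_mul, integral_rpow (Or.inl (by linarith))]
    have hp0 : p ≠ 0 := by linarith
    rw [sub_add_cancel]
    exact mul_div_cancel₀ _ hp0
  rw [e2, hB.bifCov_sub_eq hHK i (Icc_subset_Icc_right ht.2 k1) (Icc_subset_Icc_right ht.2 k2),
    ← hp, incr]
  ring

/-- The quadratic variation of the process along the dyadic partitions. -/
def quadSum (B : Fin d → ℝ → Ω → ℝ) (t : ℝ) (n : ℕ) (ω : Ω) : ℝ :=
  ∑ k ∈ Finset.range (2 ^ n), ∑ j, (B j (dyadic t n (k + 1)) ω - B j (dyadic t n k) ω) ^ 2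

lemma IsMultiBifBm.hasMoments_quadSum (hB : IsMultiBifBm T H K B P) (ht : t ∈ Icc 0 T) (n : ℕ) :
    HasMoments (quadSum B t n) P := fun p hp =>
  memLp_finsetSum _ fun _ hk => memLp_finsetSum _ fun j _ =>
    (((hB.hasMoments j (Icc_subset_Icc_right ht.2 (dyadic_succ_mem_of_mem_range ht.1 hk))).sub
      (hB.hasMoments j (Icc_subset_Icc_right ht.2 (dyadic_mem_of_mem_range ht.1 hk)))).pow 2) p hp

/-- The sum is nonnegative, so its `L¹` norm is its expectation, the sum of the squared Hilbert
norms of the increments. -/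
lemma IsMultiBifBm.tendsto_quadSum (hB : IsMultiBifBm T H K B P)
    (hK : ∀ i, K i ∈ Ioc (0 : ℝ) 1) (hHK : ∀ i, 1 < 2 * H i * K i) (ht : t ∈ Icc 0 T) :
    Tendsto (fun n => eLpNorm (quadSum B t n) 1 P) atTop (𝓝 0) := by
  have h := tendsto_finsetSum Finset.univ fun j _ => hB.tendsto_sum_norm_incr_sq hK hHK j ht
  rw [Finset.sum_const_zero] at h
  have h' := ENNReal.tendsto_ofReal h
  rw [ENNReal.ofReal_zero] at h'
  refine h'.congr fun n => ?_
  have hnn : ∀ ω, 0 ≤ quadSum B t n ω := fun ω =>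
    Finset.sum_nonneg fun _ _ => Finset.sum_nonneg fun _ _ => sq_nonneg _
  have e : ∀ k ∈ Finset.range (2 ^ n), ∀ j, ∫ ω, (B j (dyadic t n (k + 1)) ω -
      B j (dyadic t n k) ω) ^ 2 ∂P = ‖incr (timeVec T B P j) t n k‖ ^ 2 := fun k hk j => by
    rw [← real_inner_self_eq_norm_sq (incr (timeVec T B P j) t n k), inner_eq_integral]
    refine integral_congr_ae ?_
    filter_upwards [rv_sub (timeVec T B P j (dyadic t n (k + 1))) (timeVec T B P j (dyadic t n k)),
      hB.rv_timeVec j (Icc_subset_Icc_right ht.2 (dyadic_mem_of_mem_range ht.1 hk)),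
      hB.rv_timeVec j (Icc_subset_Icc_right ht.2 (dyadic_succ_mem_of_mem_range ht.1 hk))]
      with ω e1 e2 e3
    rw [incr, e1, e2, e3, pow_two]
  have hint : ∀ k ∈ Finset.range (2 ^ n), ∀ j, Integrable (fun ω =>
      (B j (dyadic t n (k + 1)) ω - B j (dyadic t n k) ω) ^ 2) P := fun k hk j =>
    (((hB.hasMoments j (Icc_subset_Icc_right ht.2 (dyadic_succ_mem_of_mem_range ht.1 hk))).sub
      (hB.hasMoments j (Icc_subset_Icc_right ht.2
        (dyadic_mem_of_mem_range ht.1 hk)))).pow 2).integrable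
  rw [eLpNorm_one_eq_lintegral_enorm, ← ofReal_integral_norm_eq_lintegral_enorm
    (hB.hasMoments_quadSum ht n).integrable]
  congr 1
  simp only [Real.norm_of_nonneg (hnn _)]
  simp only [quadSum]
  rw [integral_finsetSum _ fun k hk => integrable_finsetSum _ fun j _ => hint k hk j,
    Finset.sum_comm]
  refine Finset.sum_congr rfl fun k hk => ?_
  rw [integral_finsetSum _ fun j _ => hint k hk j]
  exact Finset.sum_congr rfl fun j _ => (e k hk j).symm

/-- The pathwise Itô expansion in terms of divergence sums. -/
theorem IsMultiBifBm.tendsto_sub_sum_divergenceSum (hB : IsMultiBifBm T H K B P)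
    (hK : ∀ i, K i ∈ Ioc (0 : ℝ) 1) (hHK : ∀ i, 1 < 2 * H i * K i) (hf : IsC12 T f)
    (ht : t ∈ Icc 0 T) {ω : Ω} (hc : ContinuousOn (fun s j => B j s ω) (Icc 0 T)) {ns : ℕ → ℕ}
    (hns : Tendsto ns atTop atTop) (hQ : Tendsto (fun k => quadSum B t (ns k) ω) atTop (𝓝 0)) :
    Tendsto (fun k => f t (fun j => B j t ω) - f 0 (fun j => B j 0 ω) -
        ∑ i, divergenceSum H K B (fun s => pderiv i (f s)) i t (ns k) ω) atTop
      (𝓝 ((∫ s in (0 : ℝ)..t, timeDeriv T f s (fun j => B j s ω)) +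
        ∑ i, H i * K i * ∫ s in (0 : ℝ)..t,
          pderiv i (pderiv i (f s)) (fun j => B j s ω) * s ^ (2 * H i * K i - 1))) := by
  have hsub : Icc 0 t ⊆ Icc 0 T := Icc_subset_Icc_right ht.2
  set b : ℝ → Fin d → ℝ := fun s j => B j s ω with hb
  -- A continuous path stays in a ball, which is convex and compact, so the second derivatives have
  -- a common bound on all segments between points of the path.
  obtain ⟨R, hR⟩ := isCompact_Icc.exists_bound_of_continuousOn hc
  have hbR : ∀ s ∈ Icc 0 t, b s ∈ Metric.closedBall (0 : Fin d → ℝ) R := fun s hs =>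
    mem_closedBall_zero_iff.2 (hR s (hsub hs))
  obtain ⟨M, hM0, hM⟩ : ∃ M, 0 ≤ M ∧ ∀ s ∈ Icc 0 T, ∀ x ∈ Metric.closedBall (0 : Fin d → ℝ) R,
      ∀ i j, |pderiv i (pderiv j (f s)) x| ≤ M := by
    choose M hM using fun i j =>
      (isCompact_Icc.prod (isCompact_closedBall (0 : Fin d → ℝ) R)).exists_bound_of_continuousOn
        ((hf.cont_snd i j).mono (prod_mono_right (subset_univ _)))
    refine ⟨∑ i, ∑ j, |M i j|, by positivity, fun s hs x hx i j => ?_⟩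
    refine (hM i j (s, x) ⟨hs, hx⟩).trans ((le_abs_self _).trans ?_)
    exact (Finset.single_le_sum (f := fun j => |M i j|) (fun _ _ => abs_nonneg _)
      (Finset.mem_univ j)).trans (Finset.single_le_sum (f := fun i => ∑ j, |M i j|)
      (fun _ _ => Finset.sum_nonneg fun _ _ => abs_nonneg _) (Finset.mem_univ i))
  -- Each increment of `f` along the path splits into a time increment at the new position, a linear
  -- part and this remainder. The linear part is that of the divergence sums and cancels, leaving
  -- the trace terms. The remainders are dominated by the quadratic variation.
  set rem : ℕ → ℕ → ℝ := fun n k => f (dyadic t n k) (b (dyadic t n (k + 1))) -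
    f (dyadic t n k) (b (dyadic t n k)) - ∑ j, pderiv j (f (dyadic t n k)) (b (dyadic t n k)) *
      (b (dyadic t n (k + 1)) j - b (dyadic t n k) j) with hrem
  have hrem0 : Tendsto (fun m => ∑ k ∈ Finset.range (2 ^ ns m), rem (ns m) k) atTop (𝓝 0) := by
    have h := hQ.const_mul (d * (d * M))
    rw [mul_zero] at h
    refine squeeze_zero_norm (fun m => ?_) h
    rw [quadSum, Finset.mul_sum]
    refine (norm_sum_le _ _).trans (Finset.sum_le_sum fun k hk => ?_)
    have k1 := dyadic_mem_of_mem_range ht.1 hk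
    exact abs_taylor_le (hf.diff_space _ (hsub k1)) hM0 (hM _ (hsub k1)) (hbR _ k1)
      (hbR _ (dyadic_succ_mem_of_mem_range ht.1 hk))
  have htime := (hf.tendsto_sum_time ht hc).comp hns
  have htr := tendsto_finsetSum Finset.univ fun i _ => (hB.tendsto_sum_trace hK hHK i ht
    ((continuousOn_comp_path (u := fun s => pderiv i (pderiv i (f s))) (hf.cont_snd i i)
      hc).mono hsub)).comp hns
  have h := (htime.add htr).add hrem0
  rw [add_zero] at h
  refine h.congr fun m => ?_
  have e1 : f t (b t) - f 0 (b 0) = ∑ k ∈ Finset.range (2 ^ ns m),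
      (f (dyadic t (ns m) (k + 1)) (b (dyadic t (ns m) (k + 1))) -
        f (dyadic t (ns m) k) (b (dyadic t (ns m) k))) := by
    rw [Finset.sum_range_sub (fun k => f (dyadic t (ns m) k) (b (dyadic t (ns m) k))),
      dyadic_zero, dyadic_last]
  rw [e1]
  simp only [Function.comp_apply, divergenceSum, hrem]
  rw [Finset.sum_comm, Finset.sum_comm (s := Finset.univ), ← Finset.sum_add_distrib,
    ← Finset.sum_add_distrib, ← Finset.sum_sub_distrib]
  refine Finset.sum_congr rfl fun k _ => ?_
  rw [Finset.sum_sub_distrib]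
  ring

end Pathwise

/-! ### Localization -/

section Localization

variable {d : ℕ} {T : ℝ} {f : ℝ → (Fin d → ℝ) → ℝ}

lemma pderiv_mul {u v : (Fin d → ℝ) → ℝ} {x : Fin d → ℝ} (hu : DifferentiableAt ℝ u x)
    (hv : DifferentiableAt ℝ v x) (j : Fin d) :
    pderiv j (fun y => u y * v y) x = u x * pderiv j v x + v x * pderiv j u x := by
  simp only [pderiv]
  rw [fderiv_fun_mul hu hv]
  simp

/-- A smooth function equal to one in a neighbourhood of the ball of radius `m`, with support in
the ball of radius `m + 2`. -/
def ballCutoff (d m : ℕ) : ContDiffBump (0 : Fin d → ℝ) :=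
  ⟨m + 1, m + 2, by positivity, by linarith⟩

/-- The cutoff function vanishes outside one fixed ball for all times, so compactness bounds the
value and the derivatives and the growth exponent can be taken to be `0`. -/
lemma IsC12.isAdmissible_cutoff (hf : IsC12 T f) (i : Fin d) (m : ℕ) :
    IsAdmissible T fun s x => ballCutoff d m x * pderiv i (f s) x := by
  set χ := ballCutoff d m with hχ
  have cχ : ContDiff ℝ 1 χ := χ.contDiff
  have dχ : Differentiable ℝ χ := cχ.differentiable one_ne_zero
  have cχ' : ∀ j, Continuous (pderiv j χ) := fun j =>
    (cχ.continuous_fderiv one_ne_zero).clm_apply continuous_const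
  have cu : ∀ s ∈ Icc 0 T, ContDiff ℝ 1 (pderiv i (f s)) := fun s hs =>
    contDiff_pderiv (hf.diff_space s hs) i
  have hpd : ∀ s ∈ Icc 0 T, ∀ j x, pderiv j (fun x => χ x * pderiv i (f s) x) x =
      χ x * pderiv j (pderiv i (f s)) x + pderiv i (f s) x * pderiv j χ x := fun s hs j x =>
    pderiv_mul (dχ x) ((cu s hs).differentiable one_ne_zero x) j
  have c1 : ContinuousOn (fun p : ℝ × (Fin d → ℝ) => χ p.2 * pderiv i (f p.1) p.2)
      (Icc 0 T ×ˢ univ) := (cχ.continuous.comp continuous_snd).continuousOn.mul (hf.cont_fst i)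
  have c2 : ∀ j, ContinuousOn (fun p : ℝ × (Fin d → ℝ) =>
      pderiv j (fun x => χ x * pderiv i (f p.1) x) p.2) (Icc 0 T ×ˢ univ) := fun j =>
    (((cχ.continuous.comp continuous_snd).continuousOn.mul (hf.cont_snd j i)).add
      ((hf.cont_fst i).mul ((cχ' j).comp continuous_snd).continuousOn)).congr
      fun p hp => hpd p.1 hp.1 j p.2
  refine ⟨fun s hs => cχ.mul (cu s hs), c1, c2, ?_⟩
  have hK := isCompact_Icc (a := (0 : ℝ)) (b := T) |>.prod
    (isCompact_closedBall (0 : Fin d → ℝ) (m + 2))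
  obtain ⟨M, hM⟩ := hK.exists_bound_of_continuousOn (c1.mono (prod_mono_right (subset_univ _)))
  choose M' hM' using fun j =>
    hK.exists_bound_of_continuousOn ((c2 j).mono (prod_mono_right (subset_univ _)))
  have hout : ∀ x ∉ Metric.closedBall (0 : Fin d → ℝ) (m + 2), χ =ᶠ[𝓝 x] fun _ => 0 := fun x hx => by
    filter_upwards [Metric.isClosed_closedBall.isOpen_compl.mem_nhds hx] with y hy
    refine χ.zero_of_le_dist ?_
    rw [mem_compl_iff, Metric.mem_closedBall, not_le] at hy
    exact hy.le
  refine ⟨|M| + ∑ j, |M' j|, 0, by positivity, fun s hs x => ?_⟩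
  rw [pow_zero, mul_one]
  by_cases hx : x ∈ Metric.closedBall (0 : Fin d → ℝ) (m + 2)
  · refine ⟨(hM (s, x) ⟨hs, hx⟩).trans ((le_abs_self M).trans (le_add_of_nonneg_right
      (by positivity))), fun j => (hM' j (s, x) ⟨hs, hx⟩).trans ((le_abs_self _).trans ?_)⟩
    exact (Finset.single_le_sum (f := fun j => |M' j|) (fun _ _ => abs_nonneg _)
      (Finset.mem_univ j)).trans (le_add_of_nonneg_left (abs_nonneg _))
  · have h0 := (hout x hx).eq_of_nhds
    have h1 : ∀ j, pderiv j χ x = 0 := fun j => by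
      rw [pderiv, (hout x hx).fderiv_eq]
      simp
    refine ⟨?_, fun j => ?_⟩
    · rw [h0, zero_mul, abs_zero]; positivity
    · rw [hpd s hs, h0, h1, zero_mul, mul_zero, add_zero, abs_zero]; positivity

lemma IsC12.isAdmissible_pderiv (hf : IsC12 T f) (hg : HasPolyGrowth T f) (i : Fin d) :
    IsAdmissible T fun s => pderiv i (f s) := by
  obtain ⟨C, N, h⟩ := hg
  refine ⟨fun s hs => contDiff_pderiv (hf.diff_space s hs) i, hf.cont_fst i,
    fun j => hf.cont_snd j i, |C|, N, abs_nonneg C, fun s hs x => ⟨?_, fun j => ?_⟩⟩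
  · exact ((h s hs x).2.2.1 i).trans
      (mul_le_mul_of_nonneg_right (le_abs_self C) (by positivity))
  · exact ((h s hs x).2.2.2 j i).trans
      (mul_le_mul_of_nonneg_right (le_abs_self C) (by positivity))

lemma ballCutoff_eventuallyEq {m : ℕ} {x : Fin d → ℝ} (hx : ‖x‖ ≤ m) :
    ballCutoff d m =ᶠ[𝓝 x] fun _ => 1 :=
  (ballCutoff d m).eventuallyEq_one_of_mem_ball (by
    rw [mem_ball_zero_iff]
    exact hx.trans_lt (lt_add_one (m : ℝ)))

lemma cutoff_mul_eventuallyEq {m : ℕ} {x : Fin d → ℝ} (hx : ‖x‖ ≤ m) (u : (Fin d → ℝ) → ℝ) :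
    (fun y => ballCutoff d m y * u y) =ᶠ[𝓝 x] u := by
  filter_upwards [ballCutoff_eventuallyEq hx] with y hy
  rw [hy, one_mul]

variable {Ω : Type*} [MeasurableSpace Ω] {P : Measure Ω} {H K : Fin d → ℝ}
  {B : Fin d → ℝ → Ω → ℝ}

/-- The cutoff is one on a neighbourhood of the ball of radius `m`, not only on the ball, so the
derivatives in the sum are unchanged as well, even when the path touches the boundary. -/
lemma divergenceSum_cutoff {m : ℕ} {ω : Ω} {t : ℝ} (ht : t ∈ Icc 0 T)
    (hω : ∀ s ∈ Icc 0 T, ‖fun j => B j s ω‖ ≤ m) (g : ℝ → (Fin d → ℝ) → ℝ) (i : Fin d) (n : ℕ) :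
    divergenceSum H K B (fun s x => ballCutoff d m x * g s x) i t n ω =
      divergenceSum H K B g i t n ω := by
  refine Finset.sum_congr rfl fun k hk => ?_
  have h := cutoff_mul_eventuallyEq
    (hω _ (Icc_subset_Icc_right ht.2 (dyadic_mem_of_mem_range ht.1 hk))) (g (dyadic t n k))
  have h' : pderiv i (fun x => ballCutoff d m x * g (dyadic t n k) x)
      (fun j => B j (dyadic t n k) ω) =
      pderiv i (g (dyadic t n k)) (fun j => B j (dyadic t n k) ω) := by
    rw [pderiv, h.fderiv_eq, pderiv]
  have h0 := h.eq_of_nhds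
  beta_reduce at h0 ⊢
  rw [h', h0]

/-- Limits in the mean of sequences that agree on an event agree on that event. -/
lemma ae_eq_of_tendsto_eLpNorm {S S' : ℕ → Ω → ℝ} {G G' : Ω → ℝ} {A : Set Ω}
    (hA : MeasurableSet A) (hG : AEStronglyMeasurable G P) (hG' : AEStronglyMeasurable G' P)
    (hSm : ∀ n, AEStronglyMeasurable (S n) P) (hSm' : ∀ n, AEStronglyMeasurable (S' n) P)
    (hS : Tendsto (fun n => eLpNorm (fun ω => S n ω - G ω) 1 P) atTop (𝓝 0))
    (hS' : Tendsto (fun n => eLpNorm (fun ω => S' n ω - G' ω) 1 P) atTop (𝓝 0))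
    (h : ∀ᵐ ω ∂P, ω ∈ A → ∀ n, S n ω = S' n ω) : ∀ᵐ ω ∂P, ω ∈ A → G ω = G' ω := by
  have hz : eLpNorm (A.indicator fun ω => G ω - G' ω) 1 P = 0 := by
    have hs := hS.add hS'
    rw [add_zero] at hs
    refine le_antisymm (ge_of_tendsto' hs fun n => ?_) zero_le
    refine le_trans (eLpNorm_mono_ae (g := fun ω => ‖S n ω - G ω‖ + ‖S' n ω - G' ω‖) ?_)
      ((eLpNorm_add_le ((hSm n).sub hG).norm ((hSm' n).sub hG').norm le_rfl).trans
        (add_le_add (eLpNorm_norm _).le (eLpNorm_norm _).le))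
    filter_upwards [h] with ω hω
    rw [Real.norm_of_nonneg (r := ‖S n ω - G ω‖ + ‖S' n ω - G' ω‖) (by positivity)]
    by_cases hωA : ω ∈ A
    · rw [indicator_of_mem hωA, hω hωA n]
      have := norm_sub_le (S' n ω - G' ω) (S' n ω - G ω)
      rw [sub_sub_sub_cancel_left] at this
      linarith
    · rw [indicator_of_notMem hωA, norm_zero]; positivity
  have h0 := (eLpNorm_eq_zero_iff ((hG.sub hG').indicator hA) one_ne_zero).1 hz
  filter_upwards [h0] with ω hω hωA
  rw [indicator_of_mem hωA] at hω
  exact sub_eq_zero.1 hω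

/-- Events on which the process stays in a ball. -/
lemma IsMultiBifBm.exists_localizing [IsProbabilityMeasure P] (hB : IsMultiBifBm T H K B P) :
    ∃ A : ℕ → Set Ω, Monotone A ∧ (∀ n, MeasurableSet (A n)) ∧ (∀ᵐ ω ∂P, ∃ n, ω ∈ A n) ∧
      ∀ᵐ ω ∂P, ∀ n, ω ∈ A n → ∀ s ∈ Icc 0 T, ‖fun j => B j s ω‖ ≤ n := by
  -- A countable dense set of times makes the event measurable; on continuous paths the bound
  -- extends to all times.
  obtain ⟨D, hDc, hDd⟩ := TopologicalSpace.exists_countable_dense (Icc (0 : ℝ) T)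
  refine ⟨fun n => {ω | ∀ s ∈ D, ‖fun j => B j s ω‖ ≤ n}, fun m n hmn ω hω s hs =>
    (hω s hs).trans (Nat.cast_le.2 hmn), fun n => ?_, ?_, ?_⟩
  · change MeasurableSet {ω | ∀ s ∈ D, ‖fun j => B j s ω‖ ≤ n}
    have e : {ω | ∀ s ∈ D, ‖fun j => B j s ω‖ ≤ n} = ⋂ s ∈ D, {ω | ‖fun j => B j s ω‖ ≤ n} := by
      ext ω; simp
    rw [e]
    exact MeasurableSet.biInter hDc fun s _ => measurableSet_le
      (measurable_pi_lambda _ fun j => (hB.component j).measurable s s.2).norm measurable_const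
  · filter_upwards [hB.ae_continuousOn_vec] with ω hω
    obtain ⟨R, hR⟩ := isCompact_Icc.exists_bound_of_continuousOn hω
    obtain ⟨n, hn⟩ := exists_nat_ge R
    exact ⟨n, fun s _ => (hR s s.2).trans hn⟩
  · filter_upwards [hB.ae_continuousOn_vec] with ω hω n hn s hs
    have hcl : IsClosed {r : Icc (0 : ℝ) T | ‖fun j => B j r ω‖ ≤ n} :=
      isClosed_le (continuousOn_iff_continuous_domRestrict.1 hω).norm continuous_const
    have := hcl.closure_subset_iff.2 (show D ⊆ _ from hn)
    exact this (hDd ⟨s, hs⟩)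

lemma IsDivergence.congr_right {i : Fin d} {U : Ω → gaussianSpace T B P} {G G' : Ω → ℝ}
    (h : IsDivergence T B P i U G) (hG : G =ᵐ[P] G') : IsDivergence T B P i U G' := by
  obtain ⟨h1, h2, h3, h4, h5⟩ := h
  refine ⟨h1, h2, h3.ae_eq hG, h4.congr hG, fun F => ?_⟩
  rw [← h5 F]
  refine integral_congr_ae ?_
  filter_upwards [hG] with ω hω
  rw [hω]

lemma Represents.congr {i : Fin d} {φ ψ : ℝ → ℝ} {h : gaussianSpace T B P}
    (hr : Represents T H K B P i φ h) (e : φ = ψ) : Represents T H K B P i ψ h := e ▸ hr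

/-- The Itô formula on an event where the divergence sums of the integrand converge in the mean. -/
lemma IsMultiBifBm.ae_ito [IsProbabilityMeasure P] (hB : IsMultiBifBm T H K B P)
    (hK : ∀ i, K i ∈ Ioc (0 : ℝ) 1) (hHK : ∀ i, 1 < 2 * H i * K i) (hf : IsC12 T f) {t : ℝ}
    (ht : t ∈ Icc 0 T) {A : Set Ω} {S : Fin d → ℕ → Ω → ℝ} {G : Fin d → Ω → ℝ}
    (hSm : ∀ i n, AEStronglyMeasurable (S i n) P) (hG : ∀ i, AEStronglyMeasurable (G i) P)
    (hS : ∀ i, Tendsto (fun n => eLpNorm (fun ω => S i n ω - G i ω) 1 P) atTop (𝓝 0))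
    (h : ∀ᵐ ω ∂P, ω ∈ A → ∀ i n,
      S i n ω = divergenceSum H K B (fun s => pderiv i (f s)) i t n ω) :
    ∀ᵐ ω ∂P, ω ∈ A → f t (fun j => B j t ω) =
      f 0 0 + (∫ s in (0 : ℝ)..t, timeDeriv T f s (fun j => B j s ω)) + (∑ i, G i ω) +
        ∑ i, H i * K i * ∫ s in (0 : ℝ)..t,
          pderiv i (pderiv i (f s)) (fun j => B j s ω) * s ^ (2 * H i * K i - 1) := by
  -- All errors are added into one sequence, so that a single subsequence gives almost sure
  -- convergence of every divergence sum and of the quadratic variation together.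
  set X : ℕ → Ω → ℝ := fun n => (∑ i, fun ω => ‖S i n ω - G i ω‖) + quadSum B t n with hX
  have hXm : ∀ n i, AEStronglyMeasurable (fun ω => ‖S i n ω - G i ω‖) P := fun n i =>
    ((hSm i n).sub (hG i)).norm
  have hQm : ∀ n, AEStronglyMeasurable (quadSum B t n) P := fun n =>
    (hB.hasMoments_quadSum ht n 1 (by simp)).1
  have hX0 : Tendsto (fun n => eLpNorm (X n) 1 P) atTop (𝓝 0) := by
    have h1 := (tendsto_finsetSum Finset.univ fun i _ => hS i).add (hB.tendsto_quadSum hK hHK ht)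
    rw [Finset.sum_const_zero, add_zero] at h1
    refine tendsto_of_tendsto_of_tendsto_of_le_of_le tendsto_const_nhds h1
      (fun _ => zero_le) fun n => ?_
    refine (eLpNorm_add_le (Finset.aestronglyMeasurable_sum _ fun i _ => hXm n i) (hQm n)
      le_rfl).trans (add_le_add ((eLpNorm_sum_le (fun i _ => hXm n i) le_rfl).trans
        (Finset.sum_le_sum fun i _ => (eLpNorm_norm _).le)) le_rfl)
  have hmeas := tendstoInMeasure_of_tendsto_eLpNorm (f := X) (g := 0) one_ne_zero
    (fun n => (Finset.aestronglyMeasurable_sum _ fun i _ => hXm n i).add (hQm n))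
    aestronglyMeasurable_zero (by simpa using hX0)
  obtain ⟨ns, hns, hlim⟩ := hmeas.exists_seq_tendsto_ae
  have hstart : ∀ᵐ ω ∂P, ∀ j, B j 0 ω = 0 := ae_all_iff.2 fun j => (hB.component j).start
  filter_upwards [h, hlim, hB.ae_continuousOn_vec, hstart] with ω h1 h2 hc h0 hωA
  have hQ0 : ∀ n, 0 ≤ quadSum B t n ω := fun n =>
    Finset.sum_nonneg fun _ _ => Finset.sum_nonneg fun _ _ => sq_nonneg _
  have hXe : ∀ n, X n ω = (∑ i, ‖S i n ω - G i ω‖) + quadSum B t n ω := fun n => by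
    simp [hX]
  have hN0 : ∀ n, 0 ≤ ∑ i, ‖S i n ω - G i ω‖ := fun n => Finset.sum_nonneg fun _ _ => norm_nonneg _
  simp only [hXe, Pi.zero_apply] at h2
  have hQ : Tendsto (fun k => quadSum B t (ns k) ω) atTop (𝓝 0) :=
    squeeze_zero (fun k => hQ0 _) (fun k => le_add_of_nonneg_left (hN0 _)) h2
  have hSi : ∀ i, Tendsto (fun k => S i (ns k) ω) atTop (𝓝 (G i ω)) := fun i => by
    rw [tendsto_iff_norm_sub_tendsto_zero]
    refine squeeze_zero (fun k => norm_nonneg _) (fun k => ?_) h2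
    exact (Finset.single_le_sum (f := fun i => ‖S i (ns k) ω - G i ω‖)
      (fun _ _ => norm_nonneg _) (Finset.mem_univ i)).trans (le_add_of_nonneg_right (hQ0 _))
  have hl := hB.tendsto_sub_sum_divergenceSum hK hHK hf ht hc hns.tendsto_atTop hQ
  have hl' : Tendsto (fun k => f t (fun j => B j t ω) - f 0 (fun j => B j 0 ω) -
      ∑ i, divergenceSum H K B (fun s => pderiv i (f s)) i t (ns k) ω) atTop
      (𝓝 (f t (fun j => B j t ω) - f 0 (fun j => B j 0 ω) - ∑ i, G i ω)) := by
    refine (tendsto_const_nhds.sub (tendsto_finsetSum Finset.univ fun i _ => hSi i)).congr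
      fun k => ?_
    simp only [h1 hωA]
  have he := tendsto_nhds_unique hl' hl
  have hz : (fun j => B j 0 ω) = 0 := funext h0
  rw [hz] at he
  linarith

end Localization


end

/-! ### The Itô formula -/

theorem mainTheorem4 {Ω : Type*} [MeasurableSpace Ω] (P : Measure Ω) [IsProbabilityMeasure P]
    (d : ℕ) (T : ℝ) (hT : 0 < T) (H K : Fin d → ℝ)
    (hH : ∀ i, H i ∈ Icc (0 : ℝ) 1) (hK : ∀ i, K i ∈ Ioc (0 : ℝ) 1)
    (hHK : ∀ i, 1 < 2 * H i * K i)
    (B : Fin d → ℝ → Ω → ℝ) (hB : IsMultiBifBm T H K B P)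
    (f : ℝ → (Fin d → ℝ) → ℝ) (hf : IsC12 T f)
    (t : ℝ) (ht : t ∈ Icc 0 T) :
    ∃ G : Fin d → Ω → ℝ,
      (∀ i, IsLocalDivergenceIntegral T H K B P i
        (fun s ω => (Icc 0 t).indicator (fun r => pderiv i (f r) (fun j => B j r ω)) s) (G i)) ∧
      (HasPolyGrowth T f → ∀ i, IsDivergenceIntegral T H K B P i
        (fun s ω => (Icc 0 t).indicator (fun r => pderiv i (f r) (fun j => B j r ω)) s) (G i)) ∧
      ∀ᵐ ω ∂P,
        f t (fun j => B j t ω) =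
          f 0 0 + (∫ s in (0 : ℝ)..t, timeDeriv T f s (fun j => B j s ω))
            + (∑ i, G i ω)
            + ∑ i, H i * K i *
                ∫ s in (0 : ℝ)..t,
                  pderiv i (pderiv i (f s)) (fun j => B j s ω) * s ^ (2 * H i * K i - 1) := by
  obtain ⟨A, hAm, hAs, hAe, hAb⟩ := hB.exists_localizing
  choose U g hU hg hrep hS using fun (i : Fin d) (m : ℕ) =>
    hB.exists_divergence hH hK hHK (hf.isAdmissible_cutoff i m) i ht
  have hSm : ∀ i m n, AEStronglyMeasurable
      (divergenceSum H K B (fun s x => ballCutoff d m x * pderiv i (f s) x) i t n) P :=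
    fun i m n => ((measurable_divergenceSum (hf.isAdmissible_cutoff i m) i ht n).mono
      hB.processSigma_le le_rfl).aestronglyMeasurable
  have hgm : ∀ i m, AEStronglyMeasurable (g i m) P := fun i m => (hg i m).2.2.1.1
  have hSe : ∀ m, ∀ᵐ ω ∂P, ω ∈ A m → ∀ m' ≥ m, ∀ i n,
      divergenceSum H K B (fun s x => ballCutoff d m' x * pderiv i (f s) x) i t n ω =
        divergenceSum H K B (fun s => pderiv i (f s)) i t n ω := fun m => by
    filter_upwards [hAb] with ω hω hωA m' hm' i n
    exact divergenceSum_cutoff ht (fun s hs => hω m' (hAm hm' hωA) s hs) _ i n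
  -- On `A m` the sums for the cutoffs `m` and `m' ≥ m` both equal the sums without cutoff, so their
  -- limits agree there.
  have hcons : ∀ m, ∀ m' ≥ m, ∀ i, ∀ᵐ ω ∂P, ω ∈ A m → g i m ω = g i m' ω := fun m m' hm' i =>
    ae_eq_of_tendsto_eLpNorm (hAs m) (hgm i m) (hgm i m') (hSm i m) (hSm i m') (hS i m) (hS i m')
      (by
        filter_upwards [hSe m] with ω hω hωA n
        rw [hω hωA m le_rfl, hω hωA m' hm'])
  classical
  -- The pieces are glued by taking the smallest index whose event contains `ω`. By consistency this
  -- agrees with every later piece; the value `0` is used only on a null set.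
  let G : Fin d → Ω → ℝ := fun i ω => if h : ∃ n, ω ∈ A n then g i (Nat.find h) ω else 0
  have hG : ∀ i m, ∀ᵐ ω ∂P, ω ∈ A m → G i ω = g i m ω := fun i m => by
    have h := ae_all_iff.2 fun m₀ => (ae_all_iff.2 fun hm : m₀ ≤ m => hcons m₀ m hm i)
    filter_upwards [h] with ω hω hωA
    have hex : ∃ n, ω ∈ A n := ⟨m, hωA⟩
    simp only [G, dif_pos hex]
    exact hω _ (Nat.find_min' hex hωA) (Nat.find_spec hex)
  refine ⟨G, fun i => ⟨A, U i, g i, hAm, hAs, hAe, fun m => ⟨hU i m, hg i m, ?_⟩⟩,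
    fun hpoly i => ?_, ?_⟩
  · filter_upwards [hrep i m, hAb, hG i m] with ω h1 h2 h3 hωA
    refine ⟨h1.congr (indicator_congr fun r hr => ?_), h3 hωA⟩
    exact (cutoff_mul_eventuallyEq (h2 m hωA r (Icc_subset_Icc_right ht.2 hr)) _).eq_of_nhds
  -- Under polynomial growth the integrand needs no cutoff. Its divergence is the limit of the same
  -- sums, so it agrees with the glued process on each `A m`, hence almost surely.
  · obtain ⟨V, g', -, hV, hVr, hVS⟩ :=
      hB.exists_divergence hH hK hHK (hf.isAdmissible_pderiv hpoly i) i ht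
    refine ⟨V, hVr, hV.congr_right ?_⟩
    have h : ∀ m, ∀ᵐ ω ∂P, ω ∈ A m → g' ω = g i m ω := fun m =>
      ae_eq_of_tendsto_eLpNorm (hAs m) hV.2.2.1.1 (hgm i m)
        (fun n => ((measurable_divergenceSum (hf.isAdmissible_pderiv hpoly i) i ht n).mono
          hB.processSigma_le le_rfl).aestronglyMeasurable) (hSm i m) hVS (hS i m) (by
          filter_upwards [hSe m] with ω hω hωA n
          exact (hω hωA m le_rfl i n).symm)
    filter_upwards [hAe, ae_all_iff.2 h, ae_all_iff.2 (hG i)] with ω ⟨m, hm⟩ h1 h2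
    rw [h1 m hm, h2 m hm]
  · have h := ae_all_iff.2 fun m => hB.ae_ito hK hHK hf ht (A := A m) (fun i n => hSm i m n)
      (fun i => hgm i m) (fun i => hS i m) (by
        filter_upwards [hSe m] with ω hω hωA i n
        exact hω hωA m le_rfl i n)
    filter_upwards [hAe, h, ae_all_iff.2 fun i => ae_all_iff.2 (hG i)] with ω ⟨m, hm⟩ h1 h2
    rw [h1 m hm]
    congr 2
    exact Finset.sum_congr rfl fun i _ => (h2 i m hm).symm
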